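/- Let $k$ be a field with algebraic closure $\bar k$, let $n\ge 0$, let $\mathbb P=\mathbb P^n_k$, and let $i:\mathbb P\hookrightarrow\tilde{\mathbb P}$ be the Veronese embedding of degree $2$, so that $\tilde{\mathbb P}$ is a projective space of dimension $N=\binom{n+2}{2}-1$ and the points of the dual projective space $\tilde{\mathbb P}^\vee$ are the quadrics in $\mathbb P$. Let $\tilde Q\subset\tilde{\mathbb P}\times\tilde{\mathbb P}^\vee$ be the incidence variety, with projection $\tilde p^\vee:\tilde Q\to\tilde{\mathbb P}^\vee$; it is identified with $P(T^*\tilde{\mathbb P})$, where $(x,h)\in \tilde Q$ corresponds to the conormal line of the hyperplane $h$ at $x$. For a closed conical (i.e. $\mathbb G_m$-invariant) subset $C\subset T^*\mathbb P$ let $i_\circ C\subset T^*\tilde{\mathbb P}$ be the image under the projection $T^*\tilde{\mathbb P}\times_{\tilde{\mathbb P}}\mathbb P\to T^*\tilde{\mathbb P}$ of the preimage of $C$ under the codifferential $di: T^*\tilde{\mathbb P}\times_{\tilde{\mathbb P}}\mathbb P\to T^*\mathbb P$, and let $P(i_\circ C)\subset P(T^*\tilde{\mathbb P})=\tilde Q$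 be its projectivization. Say that $Z_1,Z_2\subset\tilde Q$ intersect well relative to $\tilde p^\vee$ if every irreducible component of $Z_1\times_{\tilde{\mathbb P}^\vee}Z_2$ minus the diagonal of $\tilde Q\times_{\tilde{\mathbb P}^\vee}\tilde Q$ has dimension $\dim Z_1+\dim Z_2-\dim\tilde{\mathbb P}^\vee$. For a linear projective subspace $\mathbb P'\subset\mathbb P_{\bar k}$ let $C_{\mathbb P'}\subset T^*\mathbb P$ be the image of the conormal bundle $T^*_{\mathbb P'}\mathbb P_{\bar k}$ under $T^*\mathbb P_{\bar k}\to T^*\mathbb P$ (if $\mathbb P'$ is defined over $k$, this is the conormal bundle to $\mathbb P'$ in $\mathbb P$). (1) Let $C_1,C_2\subset T^*\mathbb P$ be closed irreducible conical subsets of dimension $n$. Then $P(i_\circ C_1)$ and $P(i_\circ C_2)$ intersect well relative to $\tilde p^\vee$, unless $C_1=C_2=C_{\mathbb P'}$ for some linear projective subspace $\mathbb P'\subset\mathbb P_{\bar k}$ of dimension $\ge 1$. (2) For every linear projective subspace $\mathbb P'\subset\mathbb P_{\bar k}$ of dimension $\ge1$, the projection of $P(i_\circ C_{\mathbb P'})$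 to its image in $\tilde{\mathbb P}^\vee$ is generically radicial, i.e. it is injective on $\bar k$-points over a dense open subset of the image. -/

import Mathlib

/-!
# Cotangent bundles of projective spaces and the quadratic Veronese embedding

A `k`-variety `X` is represented by its set `X(K)` of geometric points, `K` an algebraic closure
of `k`, with the topology whose closed sets are the sets of `K`-points of closed subschemes of `X`
defined over `k`.  By the Nullstellensatz the lattice of closed (or locally closed) subsets of the
scheme `X` is the lattice of closed (or locally closed) subsets of `X(K)` for this topology, so
"closed", "irreducible", "irreducible component" and "dimension" have their scheme-theoretic
meaning over `k`.  If `k` is algebraically closed, one may take `K = k`: this is then the usual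
Zariski topology on closed points.
-/

namespace VeroneseQuadric

noncomputable section

section Spaces

variable (k K : Type*) [Field k] [Field K] [Algebra k K]

/-- The Zariski topology, with respect to polynomials over `k`, on the set `K^σ` of `K`-points of
the affine space `𝔸^σ`; the sets `{f ≠ 0}` form a basis. -/
@[reducible]
def affineZariski (σ : Type*) : TopologicalSpace (σ → K) :=
  TopologicalSpace.generateFrom
    {U | ∃ f : MvPolynomial σ k, U = {x | MvPolynomial.aeval x f ≠ 0}}

/-- The quotient Zariski topology on `X`: `H` is a set of homogeneous coordinate vectors, embedded
by `coord` as a locally closed subset of `K^σ`, and `q : H → X` is the quotient map. -/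
@[reducible]
def quotientZariski {σ H X : Type*} (coord : H → σ → K) (q : H → X) : TopologicalSpace X :=
  TopologicalSpace.coinduced q (TopologicalSpace.induced coord (affineZariski k K σ))

/-- The projective space of lines in `K^ι`, with its Zariski topology over `k`. -/
@[nolint unusedArguments]
def ProjSpace (_k K : Type*) [Field K] (ι : Type*) : Type _ := Projectivization K (ι → K)

instance (ι : Type*) : TopologicalSpace (ProjSpace k K ι) :=
  quotientZariski (X := ProjSpace k K ι) k K
    (fun v : {v : ι → K // v ≠ 0} => v.1) (fun v => Projectivization.mk K v.1 v.2)

end Spaces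

section Cotangent

/-- Homogeneous coordinates on the cotangent bundle of the projective space of lines in `K^ι`:
a nonzero vector `v` and a linear form `ξ` with `ξ v = 0`. -/
@[ext]
structure CotangentCoord (K : Type*) [Field K] (ι : Type*) [Fintype ι] where
  /-- homogeneous coordinates of the base point -/
  vec : ι → K
  /-- the covector, as a linear form on `K^ι` -/
  form : ι → K
  vec_ne_zero : vec ≠ 0
  form_vec : form ⬝ᵥ vec = 0

/-- `(v, ξ)` and `(t v, t⁻¹ ξ)` describe the same cotangent vector. -/
instance cotangentSetoid (K : Type*) [Field K] (ι : Type*) [Fintype ι] :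
    Setoid (CotangentCoord K ι) where
  r a b := ∃ t : Kˣ, b.vec = t • a.vec ∧ b.form = t⁻¹ • a.form
  iseqv :=
    { refl := fun _ => ⟨1, by simp, by simp⟩
      symm := by
        rintro a b ⟨t, h1, h2⟩
        exact ⟨t⁻¹, by simp [h1], by simp [h2]⟩
      trans := by
        rintro a b c ⟨t, h1, h2⟩ ⟨s, h3, h4⟩
        exact ⟨s * t, by simp [h1, h3, mul_smul],
          by rw [h4, h2, smul_smul, mul_inv_rev, mul_comm]⟩ }

/-- The (points of the total space of the) cotangent bundle `T*ℙ` of the projective space `ℙ` of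
lines in `V = K^ι`.  If `f` is a function on `ℙ` near the line `x` of `v`, regarded as a function
of degree `0` on `V ∖ 0`, then its differential at `v` is a linear form `ξ` on `V` with `ξ v = 0`,
and replacing `v` by `t v` replaces `ξ` by `t⁻¹ ξ`; the class of `(v, ξ)` is the cotangent vector
`df(x)`.  This is the identification `T*_x ℙ = x ⊗ x^⊥` coming from the Euler sequence. -/
@[nolint unusedArguments]
def Cotangent (_k K : Type*) [Field K] (ι : Type*) [Fintype ι] : Type _ :=
  Quotient (cotangentSetoid K ι)

variable {k K : Type*} [Field k] [Field K] [Algebra k K] {ι : Type*} [Fintype ι]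

/-- The cotangent vector with homogeneous coordinates `w = (v, ξ)`. -/
def Cotangent.mk (k : Type*) (w : CotangentCoord K ι) : Cotangent k K ι :=
  Quotient.mk (cotangentSetoid K ι) w

instance : TopologicalSpace (Cotangent k K ι) :=
  quotientZariski (X := Cotangent k K ι) k K
    (fun w : CotangentCoord K ι => Sum.elim w.vec w.form) (fun w => Cotangent.mk k w)

/-- Fibrewise multiplication by `t` on homogeneous coordinates of the cotangent bundle. -/
def CotangentCoord.scale (t : Kˣ) (w : CotangentCoord K ι) : CotangentCoord K ι where
  vec := w.vec
  form := t • w.form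
  vec_ne_zero := w.vec_ne_zero
  form_vec := by rw [smul_dotProduct, w.form_vec, smul_zero]

/-- A set of cotangent vectors is conical if it is invariant under fibrewise multiplication by
nonzero scalars. -/
def IsConical (C : Set (Cotangent k K ι)) : Prop :=
  ∀ (t : Kˣ) (w : CotangentCoord K ι), Cotangent.mk k w ∈ C → Cotangent.mk k (w.scale t) ∈ C

/-- The conormal bundle `T*_{ℙ'} ℙ` to the linear projective subspace `ℙ' = ℙ(W)` of the
projective space `ℙ` over `K`: the cotangent vectors at points `x` of `ℙ'` that vanish on
`T_x ℙ'`. -/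
def conormal (k : Type*) (W : Submodule K (ι → K)) : Set (Cotangent k K ι) :=
  {τ | ∃ w : CotangentCoord K ι, τ = Cotangent.mk k w ∧ w.vec ∈ W ∧
    ∀ u ∈ W, w.form ⬝ᵥ u = 0}

/-- The image in `T*ℙ`, as a closed subset of a `k`-variety, of the conormal bundle to a linear
projective subspace `ℙ(W)` of `ℙ_K`.  It equals `conormal k W` if `W` is defined over `k`. -/
def conormalClosure (k : Type*) [Field k] [Algebra k K] (W : Submodule K (ι → K)) :
    Set (Cotangent k K ι) :=
  closure (conormal k W)

end Cotangent

section Incidence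

/-- The incidence variety `Q` of pairs `(x, h)`, `x` a point of the projective space `ℙ` of lines
in `K^ι`, `h` a point of the dual projective space `ℙ^∨` (a hyperplane), and `x ∈ h`.
It is identified with the projectivization `P(T*ℙ)`, the pair `(x, h)` corresponding
to the conormal line to the hyperplane `h` at `x`. -/
@[ext, nolint unusedArguments]
structure Incidence (k K : Type*) [Field K] (ι : Type*) [Fintype ι] where
  /-- the point -/
  pt : ProjSpace k K ι
  /-- the hyperplane -/
  hyp : ProjSpace k K ι
  mem : Projectivization.orthogonal (F := K) (m := ι) pt hyp

variable {k K : Type*} [Field k] [Field K] [Algebra k K] {ι : Type*} [Fintype ι]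

/-- The point of `Q = P(T*ℙ)` given by the line spanned by the nonzero cotangent vector with
homogeneous coordinates `w`. -/
def Incidence.ofCoord (k : Type*) (w : CotangentCoord K ι) (hw : w.form ≠ 0) :
    Incidence k K ι where
  pt := Projectivization.mk K w.vec w.vec_ne_zero
  hyp := Projectivization.mk K w.form hw
  mem := by
    rw [Projectivization.orthogonal_mk, dotProduct_comm]
    exact w.form_vec

instance : TopologicalSpace (Incidence k K ι) :=
  quotientZariski k K
    (fun w : {w : CotangentCoord K ι // w.form ≠ 0} => Sum.elim w.1.vec w.1.form)
    (fun w => Incidence.ofCoord k w.1 w.2)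

/-- The projectivization `P(C) ⊂ P(T*ℙ) = Q` of a conical subset `C` of `T*ℙ`. -/
def projectivization (C : Set (Cotangent k K ι)) : Set (Incidence k K ι) :=
  {z | ∃ (w : CotangentCoord K ι) (hw : w.form ≠ 0),
    Cotangent.mk k w ∈ C ∧ z = Incidence.ofCoord k w hw}

/-- The fibre product `Q ×_{ℙ^∨} Q`: pairs of points of `Q` over the same point of `ℙ^∨`. -/
@[ext]
structure IncidencePair (k K : Type*) [Field K] (ι : Type*) [Fintype ι] where
  /-- the first point of `Q` -/
  fst : Incidence k K ι
  /-- the second point of `Q` -/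
  snd : Incidence k K ι
  hyp_eq : fst.hyp = snd.hyp

/-- Homogeneous coordinates `(v₁, v₂, ξ)` on `Q ×_{ℙ^∨} Q`. -/
structure PairCoord (K : Type*) [Field K] (ι : Type*) [Fintype ι] where
  /-- homogeneous coordinates of the first point -/
  vec₁ : ι → K
  /-- homogeneous coordinates of the second point -/
  vec₂ : ι → K
  /-- homogeneous coordinates of the hyperplane -/
  form : ι → K
  vec₁_ne_zero : vec₁ ≠ 0
  vec₂_ne_zero : vec₂ ≠ 0
  form_ne_zero : form ≠ 0
  form_vec₁ : form ⬝ᵥ vec₁ = 0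
  form_vec₂ : form ⬝ᵥ vec₂ = 0

/-- The point of `Q ×_{ℙ^∨} Q` with given homogeneous coordinates. -/
def IncidencePair.ofCoord (k : Type*) (w : PairCoord K ι) : IncidencePair k K ι where
  fst := Incidence.ofCoord k ⟨w.vec₁, w.form, w.vec₁_ne_zero, w.form_vec₁⟩ w.form_ne_zero
  snd := Incidence.ofCoord k ⟨w.vec₂, w.form, w.vec₂_ne_zero, w.form_vec₂⟩ w.form_ne_zero
  hyp_eq := rfl

instance : TopologicalSpace (IncidencePair k K ι) :=
  quotientZariski k K
    (fun w : PairCoord K ι => Sum.elim w.vec₁ (Sum.elim w.vec₂ w.form))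
    (fun w => IncidencePair.ofCoord k w)

/-- The part of `Z₁ ×_{ℙ^∨} Z₂` off the diagonal of `Q ×_{ℙ^∨} Q`. -/
def offDiagonal (Z₁ Z₂ : Set (Incidence k K ι)) : Set (IncidencePair k K ι) :=
  {t | t.fst ∈ Z₁ ∧ t.snd ∈ Z₂ ∧ t.fst ≠ t.snd}

/-- `Z₁, Z₂ ⊂ Q` intersect well relative to the projection `p^∨ : Q → ℙ^∨`: every irreducible
component `S` of `Z₁ ×_{ℙ^∨} Z₂` minus the diagonal has dimension
`dim Z₁ + dim Z₂ - dim ℙ^∨`. -/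
def IntersectWell (Z₁ Z₂ : Set (Incidence k K ι)) : Prop :=
  ∀ S ∈ irreducibleComponents (offDiagonal Z₁ Z₂),
    topologicalKrullDim S + topologicalKrullDim (ProjSpace k K ι) =
      topologicalKrullDim Z₁ + topologicalKrullDim Z₂

/-- The projection of `Z ⊂ Q` to its image `D ⊂ ℙ^∨` is generically radicial: it is injective on
geometric points over a dense (relatively) open subset `D ∩ U` of `D`. -/
def GenericallyRadicial (Z : Set (Incidence k K ι)) : Prop :=
  ∃ U : Set (ProjSpace k K ι), IsOpen U ∧
    Incidence.hyp '' Z ⊆ closure (Incidence.hyp '' Z ∩ U) ∧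
    Set.InjOn Incidence.hyp (Z ∩ Incidence.hyp ⁻¹' U)

end Incidence

section Veronese

variable {k K : Type*} [Field k] [Field K] [Algebra k K] {ι : Type*}

/-- The quadratic monomial `X_a X_b` attached to the unordered pair `{a, b}`. -/
def quadMonomial (K : Type*) [Field K] (s : Sym2 ι) : MvPolynomial ι K :=
  (s.map MvPolynomial.X).mul

/-- The degree `2` Veronese map `v ↦ (v_a v_b)_{a, b}` on homogeneous coordinates.  A point
`(η_s)` of the dual of the target projective space is the quadric `∑ η_s X^s = 0`. -/
def veronese (v : ι → K) : Sym2 ι → K :=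
  fun s => MvPolynomial.eval v (quadMonomial K s)

/-- The transpose of the differential of the Veronese map at `v`, applied to the linear form `η`:
the differential at `v` of the quadratic form `∑ η_s X^s`. -/
def codiff [Fintype ι] [DecidableEq ι] (v : ι → K) (η : Sym2 ι → K) : ι → K :=
  fun j => ∑ s, η s * MvPolynomial.eval v (MvPolynomial.pderiv j (quadMonomial K s))

theorem veronese_ne_zero {v : ι → K} (hv : v ≠ 0) : veronese v ≠ 0 := by
  obtain ⟨a, ha⟩ := Function.ne_iff.mp hv
  intro h
  have := congrFun h s(a, a)
  simp only [veronese, quadMonomial, Sym2.map_mk, Pi.zero_apply] at this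
  simp [Sym2.mul] at this
  exact ha this

theorem codiff_dotProduct [Fintype ι] [DecidableEq ι] (v : ι → K) (η : Sym2 ι → K) :
    codiff v η ⬝ᵥ v = 2 * (η ⬝ᵥ veronese v) := by
  have key : ∀ s : Sym2 ι, ∑ j, v j * MvPolynomial.eval v
      (MvPolynomial.pderiv j (quadMonomial K s)) = 2 * veronese v s := by
    intro s
    have h : (quadMonomial K s).IsHomogeneous 2 := by
      induction s with
      | _ a b =>
        exact (MvPolynomial.isHomogeneous_X K a).mul (MvPolynomial.isHomogeneous_X K b)
    have := congrArg (MvPolynomial.eval v) h.sum_X_mul_pderiv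
    simpa [veronese] using this
  simp only [dotProduct, codiff, Finset.sum_mul, Finset.mul_sum]
  rw [Finset.sum_comm]
  refine Finset.sum_congr rfl fun s _ => ?_
  rw [mul_left_comm, ← key s, Finset.mul_sum]
  exact Finset.sum_congr rfl fun j _ => by ring

variable [Fintype ι] [DecidableEq ι]

/-- Homogeneous coordinates on the restriction `T*ℙ̃ ×_ℙ̃ ℙ` of the cotangent bundle of the target
of the Veronese embedding `i : ℙ → ℙ̃` to `ℙ`: a nonzero vector `v` and a linear form `η` that
vanishes at `i(v)`. -/
structure VeroneseCoord (K : Type*) [Field K] (ι : Type*) [Fintype ι] [DecidableEq ι] where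
  /-- homogeneous coordinates of the point of `ℙ` -/
  vec : ι → K
  /-- the covector on `ℙ̃` -/
  form : Sym2 ι → K
  vec_ne_zero : vec ≠ 0
  form_veronese : form ⬝ᵥ veronese vec = 0

/-- The projection `T*ℙ̃ ×_ℙ̃ ℙ → T*ℙ̃`. -/
def VeroneseCoord.target (w : VeroneseCoord K ι) : CotangentCoord K (Sym2 ι) where
  vec := veronese w.vec
  form := w.form
  vec_ne_zero := veronese_ne_zero w.vec_ne_zero
  form_vec := w.form_veronese

/-- The codifferential `di : T*ℙ̃ ×_ℙ̃ ℙ → T*ℙ`. -/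
def VeroneseCoord.source (w : VeroneseCoord K ι) : CotangentCoord K ι where
  vec := w.vec
  form := codiff w.vec w.form
  vec_ne_zero := w.vec_ne_zero
  form_vec := by rw [codiff_dotProduct, w.form_veronese, mul_zero]

/-- `i_∘ C ⊂ T*ℙ̃`, for the Veronese embedding `i : ℙ → ℙ̃` of degree `2`: the image of the preimage
of `C` under `di : T*ℙ̃ ×_ℙ̃ ℙ → T*ℙ` by the projection to `T*ℙ̃`. -/
def veronesePush (C : Set (Cotangent k K ι)) : Set (Cotangent k K (Sym2 ι)) :=
  {τ | ∃ w : VeroneseCoord K ι, Cotangent.mk k w.source ∈ C ∧ τ = Cotangent.mk k w.target}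

end Veronese

end

end VeroneseQuadric

/-!
# Quadrics conormal to conical subsets of the cotangent bundle of projective space

All geometry takes place in sets of coordinate vectors in `K^σ`. A set is irreducible over `k` if its
ideal over `k` is prime (`ZIrred`), and its dimension `zdim` is the transcendence degree of its ring
of polynomial functions. The spaces of the statement are quotients of such sets by free torus actions
(`TorusQuotient`). Krull dimensions in the quotient are dimensions of sets of coordinate vectors minus
the rank of the torus, where a set of coordinate vectors may be replaced by a parametrization with
finite fibres (`TorusQuotient.topologicalKrullDim_eq`,
`TorusQuotient.topologicalKrullDim_irreducibleComponent`). The tools are the principal ideal theorem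
(`exists_hypersurface_section`) and the theorem on the dimension of fibres (`exists_fibre`).

Let `V = K^ι`, and let `M` be the dimension of the space of quadratic forms on `V`. Let `Tᵢ` be the
set of coordinate vectors `(v, ξ)` of `Cᵢ`; its dimension is `dim V`. The set `P(i_∘ Cᵢ)` is
parametrized by the pairs `(v, η)` of a vector and a quadratic form such that `η(v) = 0` and
`(v, dη(v))` is in `Tᵢ` (`conormalQuadrics`), and the fibre product off the diagonal is parametrized
by triples `(v₁, v₂, η)` with independent `v₁, v₂` (`conormalQuadricPairs`). Given `(vᵢ, ξᵢ)`, the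
conditions `η(vᵢ) = 0`, `dη(vᵢ) = ξᵢ` on `η` amount to `2 dim V` equations, so all components of the
set of triples have dimension at least `M` (`exists_large_subset_conormalQuadricPairs`). Only one
relation exists between these equations, the symmetry `ξ₁(v₂) = ξ₂(v₁)` of the polar form of `η`.
Hence the dimension can exceed `M` only if this relation holds identically on a product of dense
subsets of components of `T₁` and `T₂`. Since `ξ₁` can be scaled independently, then
`ξ₁(v₂) = 0 = ξ₂(v₁)` identically. If `U` is the span of the vectors `v₁`, a dimension count shows
that both sets are dense in the conormal bundle of `U` (`exists_eq_conormalVectors`). This proves the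
first part of the theorem, as all dimensions that occur are now known.

For the second part let `T` be the closure over `k` of the conormal bundle of `U`. Over the open set
`v_a ≠ 0`, the pairs `(v, η)` form a trivial bundle over `T` (`IsConicalSet.conormalChart_eq`), so the
image of the pairs with `(v, dη(v))` conormal to `U` is irreducible and is dense over `k` in the dual
variety. Its dimension is at least `M - 1`, because some `η` is singular along `U` at a single
point (`exists_form_singular_at_point`, `card_le_zdim_formPoly_conormalChart`). On the other hand,
the forms `η` that are conormal at two different points form a set of dimension at most `M - 2`
(`zdim_pairFormPoly_add_two_le`). If the set of triples has dimension at most `M`, this follows by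
scaling `v₁` and `v₂`. In the exceptional case `η` is singular along a linear subspace at all points
of a line, and so at a point of a given hyperplane, and one counts these. The complement of the
closure of this small set is the open set over which the projection is injective.
-/

namespace VeroneseQuadric

noncomputable section

/-! ### Transcendence degrees of finitely generated domains -/

section Algebra

open Polynomial in
/-- For `g = f h` with `g` in the integrally closed domain `R`, the polynomial
`∑ Pᵢ gⁱ X^(n - i)`, where `P = ∑ Pᵢ Xⁱ` is the minimal polynomial of `f`, is killed by `h`. -/
theorem exists_reflected_polynomial {R A : Type*} [CommRing R] [CommRing A] [Algebra R A]
    (P : R[X]) {f h : A} {g : R} (hgf : algebraMap R A g = f * h) (hP : aeval f P = 0) :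
    ∃ Q : R[X], aeval h Q = 0 ∧ Q.natDegree ≤ P.natDegree ∧
      Q.coeff 0 = P.leadingCoeff * g ^ P.natDegree ∧ Q.coeff P.natDegree = P.coeff 0 := by
  classical
  refine ⟨∑ i ∈ Finset.range (P.natDegree + 1), C (P.coeff i * g ^ i) * X ^ (P.natDegree - i),
    ?_, ?_, ?_, ?_⟩
  · have : aeval h (∑ i ∈ Finset.range (P.natDegree + 1),
        C (P.coeff i * g ^ i) * X ^ (P.natDegree - i)) = h ^ P.natDegree * aeval f P := by
      rw [map_sum, aeval_eq_sum_range, Finset.mul_sum]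
      refine Finset.sum_congr rfl fun i hi => ?_
      have hi' : i ≤ P.natDegree := Nat.lt_succ_iff.mp (Finset.mem_range.mp hi)
      have : h ^ P.natDegree = h ^ i * h ^ (P.natDegree - i) := by
        rw [← pow_add, Nat.add_sub_cancel' hi']
      simp only [map_mul, map_pow, aeval_C, aeval_X, hgf, Algebra.smul_def, mul_pow]
      rw [this]
      ring
    rw [this, hP, mul_zero]
  · refine natDegree_sum_le_of_forall_le _ _ fun i _ => ?_
    exact (natDegree_C_mul_X_pow_le _ _).trans (Nat.sub_le _ _)
  · simp only [finsetSum_coeff, coeff_C_mul, coeff_X_pow]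
    rw [Finset.sum_eq_single P.natDegree]
    · rw [Nat.sub_self, if_pos rfl, mul_one, leadingCoeff]
    · intro i hi hne
      have : i ≤ P.natDegree := Nat.lt_succ_iff.mp (Finset.mem_range.mp hi)
      rw [if_neg (by omega), mul_zero]
    · intro h; simp at h
  · simp only [finsetSum_coeff, coeff_C_mul, coeff_X_pow]
    rw [Finset.sum_eq_single 0]
    · simp
    · intro i hi hne
      have : i ≤ P.natDegree := Nat.lt_succ_iff.mp (Finset.mem_range.mp hi)
      rw [if_neg (by omega), mul_zero]
    · intro h; simp at h

open Polynomial in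
/-- A substitute for the norm: if `f` divides `g ∈ R` in an integral extension of the integrally
closed domain `R`, then the constant coefficient of the minimal polynomial of `f` divides a power
of `g` in `R`. -/
theorem minpoly_coeff_zero_dvd_pow {R A : Type*} [CommRing R] [IsDomain R] [IsIntegrallyClosed R]
    [CommRing A] [IsDomain A] [Algebra R A] [Module.IsTorsionFree R A] [Algebra.IsIntegral R A]
    {f : A} {g : R} (h : f ∣ algebraMap R A g) :
    (minpoly R f).coeff 0 ∣ g ^ (minpoly R f).natDegree := by
  obtain ⟨h, hgf⟩ := h
  have hf := Algebra.IsIntegral.isIntegral (R := R) f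
  have hh := Algebra.IsIntegral.isIntegral (R := R) h
  by_cases hg : g = 0
  · rw [hg, zero_pow (minpoly.natDegree_pos hf).ne']
    exact dvd_zero _
  obtain ⟨Q, hQ, hQd, hQ0, hQn⟩ := exists_reflected_polynomial _ hgf (minpoly.aeval R f)
  obtain ⟨Q', hQ', hQd', hQ0', -⟩ := exists_reflected_polynomial (f := h) (h := f) _
    (by rw [hgf, mul_comm]) (minpoly.aeval R h)
  rw [(minpoly.monic hf).leadingCoeff, one_mul] at hQ0
  rw [(minpoly.monic hh).leadingCoeff, one_mul] at hQ0'
  have hne : Q ≠ 0 := fun h0 => pow_ne_zero _ hg (by rw [← hQ0, h0, coeff_zero])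
  have hne' : Q' ≠ 0 := fun h0 => pow_ne_zero _ hg (by rw [← hQ0', h0, coeff_zero])
  have h1 : (minpoly R f).natDegree ≤ (minpoly R h).natDegree :=
    (natDegree_le_of_dvd (minpoly.isIntegrallyClosed_dvd hf hQ') hne').trans hQd'
  obtain ⟨S, rfl⟩ := minpoly.isIntegrallyClosed_dvd hh hQ
  have hS : S ≠ 0 := right_ne_zero_of_mul hne
  rw [natDegree_mul (left_ne_zero_of_mul hne) hS] at hQd
  obtain ⟨c, rfl⟩ := natDegree_eq_zero.mp (show S.natDegree = 0 by omega)
  have h2 : (minpoly R f).natDegree = (minpoly R h).natDegree := by omega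
  have h3 : (minpoly R f).coeff 0 = c := by
    rw [← hQn, coeff_mul_C, h2, (minpoly.monic hh).coeff_natDegree, one_mul]
  rw [← hQ0, coeff_mul_C, h3]
  exact dvd_mul_left _ _

open Polynomial in
theorem minpoly_coeff_zero_ne_zero {R A : Type*} [CommRing R] [IsDomain R] [IsIntegrallyClosed R]
    [CommRing A] [IsDomain A] [Algebra R A] [Module.IsTorsionFree R A] [Algebra.IsIntegral R A]
    {f : A} (hf0 : f ≠ 0) : (minpoly R f).coeff 0 ≠ 0 := by
  intro h0
  have hf := Algebra.IsIntegral.isIntegral (R := R) f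
  obtain ⟨Q, hQ⟩ := X_dvd_iff.mpr h0
  have hne : Q ≠ 0 := by
    rintro rfl
    exact minpoly.ne_zero hf (by rw [hQ, mul_zero])
  have : aeval f Q = 0 := by
    have := minpoly.aeval R f
    rw [hQ, map_mul, aeval_X] at this
    exact (mul_eq_zero.mp this).resolve_left hf0
  have := natDegree_le_of_dvd (minpoly.isIntegrallyClosed_dvd hf this) hne
  rw [hQ, natDegree_mul X_ne_zero hne, natDegree_X] at this
  omega

open Polynomial in
theorem dvd_minpoly_coeff_zero {R A : Type*} [CommRing R] [CommRing A] [Algebra R A] (f : A) :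
    f ∣ algebraMap R A ((minpoly R f).coeff 0) := by
  have h := minpoly.aeval R f
  rw [← divX_mul_X_add (minpoly R f), map_add, map_mul, aeval_X, aeval_C] at h
  rw [eq_neg_of_add_eq_zero_right h]
  exact (dvd_mul_left _ _).neg_right

universe u v

/-- The principal ideal theorem in the case in which `p` is the radical of `(f)`. After Noether
normalization, `p` contains a nonconstant polynomial `a` that divides a power of every polynomial
in `p`. Hence no polynomial in `p` omits a variable that occurs in `a`, and the other variables
stay independent modulo `p`. -/
theorem trdeg_le_trdeg_quotient_add_one_of_forall_dvd_pow {K : Type v} [Field K] {A : Type u}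
    [CommRing A] [IsDomain A] [Algebra K A] [Algebra.FiniteType K A] {f : A} (hf0 : f ≠ 0)
    (p : Ideal A) [hp : p.IsPrime] (hfp : f ∈ p) (hrad : ∀ x ∈ p, ∃ m : ℕ, f ∣ x ^ m) :
    Algebra.trdeg K A ≤ Algebra.trdeg K (A ⧸ p) + 1 := by
  classical
  obtain ⟨s, φ, hinj, hint⟩ := exists_integral_inj_algHom_of_fg K A
  algebraize [φ.toRingHom]
  have : FaithfulSMul (MvPolynomial (Fin s) K) A :=
    (faithfulSMul_iff_algebraMap_injective _ _).mpr hinj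
  have : Module.IsTorsionFree (MvPolynomial (Fin s) K) A := inferInstance
  have hst : IsScalarTower K (MvPolynomial (Fin s) K) A :=
    IsScalarTower.of_algebraMap_eq fun x => (φ.commutes x).symm
  have hA : Cardinal.lift.{u} (s : Cardinal.{v}) = Cardinal.lift.{v} (Algebra.trdeg K A) := by
    have h := lift_trdeg_add_eq K (MvPolynomial (Fin s) K) A
    rw [trdeg_eq_zero (R := MvPolynomial (Fin s) K) (A := A),
      MvPolynomial.trdeg_of_isDomain] at h
    simpa using h
  have hA' : Algebra.trdeg K A = s := by
    have : Cardinal.lift.{v} (Algebra.trdeg K A) = s := by rw [← hA]; simp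
    simpa using this
  -- `a` plays the role of the norm of `f`
  set a := (minpoly (MvPolynomial (Fin s) K) f).coeff 0 with ha
  have ha0 : a ≠ 0 := minpoly_coeff_zero_ne_zero hf0
  have hfa : f ∣ algebraMap _ A a := dvd_minpoly_coeff_zero f
  have hap : algebraMap _ A a ∈ p := p.mem_of_dvd hfa hfp
  have key : ∀ G : MvPolynomial (Fin s) K, algebraMap _ A G ∈ p → ∃ m : ℕ, a ∣ G ^ m := by
    intro G hG
    obtain ⟨m, hm⟩ := hrad _ hG
    rw [← map_pow] at hm
    exact ⟨_, (minpoly_coeff_zero_dvd_pow hm).trans (dvd_of_eq (pow_mul G m _).symm)⟩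
  obtain ⟨i, hi⟩ : ∃ i, i ∈ a.vars := by
    by_contra! hv
    have hc : a = MvPolynomial.C (a.coeff 0) := by
      rw [← MvPolynomial.vars_eq_empty_iff_eq_C]
      exact Finset.eq_empty_of_forall_notMem hv
    have hc0 : a.coeff 0 ≠ 0 := fun h => ha0 (by rw [hc, h, map_zero])
    refine hp.ne_top (Ideal.eq_top_of_isUnit_mem _ hap ?_)
    rw [hc]
    exact ((isUnit_iff_ne_zero.mpr hc0).map MvPolynomial.C).map _
  have hind : AlgebraicIndependent K
      (fun j : {j : Fin s // j ≠ i} =>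
        Ideal.Quotient.mk p (algebraMap _ A (MvPolynomial.X j.1 : MvPolynomial (Fin s) K))) := by
    rw [algebraicIndependent_iff]
    intro F hF
    by_contra hF0
    set G : MvPolynomial (Fin s) K := MvPolynomial.rename Subtype.val F with hG
    have hG0 : G ≠ 0 := by
      rw [hG, Ne, map_eq_zero_iff _ (MvPolynomial.rename_injective _ Subtype.val_injective)]
      exact hF0
    have hGp : algebraMap _ A G ∈ p := by
      rw [← Ideal.Quotient.eq_zero_iff_mem, ← hF, hG]
      have : ((Ideal.Quotient.mkₐ K p).comp (IsScalarTower.toAlgHom K (MvPolynomial (Fin s) K) A)).comp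
          (MvPolynomial.rename Subtype.val) = MvPolynomial.aeval
          (fun j : {j : Fin s // j ≠ i} => Ideal.Quotient.mk p
            (algebraMap _ A (MvPolynomial.X j.1 : MvPolynomial (Fin s) K))) := by
        ext j
        simp
      exact DFunLike.congr_fun this F
    obtain ⟨m, hm⟩ := key G hGp
    have h1 : MvPolynomial.degreeOf i a ≤ MvPolynomial.degreeOf i (G ^ m) := by
      obtain ⟨b, hb⟩ := hm
      have hb0 : b ≠ 0 := by
        rintro rfl
        exact pow_ne_zero m hG0 (by rw [hb, mul_zero])
      rw [hb, MvPolynomial.degreeOf_mul_eq ha0 hb0]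
      exact Nat.le_add_right _ _
    have h2 : MvPolynomial.degreeOf i G = 0 := by
      by_contra hmem
      rw [← Ne, ← MvPolynomial.mem_vars_iff_degreeOf_ne_zero] at hmem
      have := MvPolynomial.vars_rename _ _ hmem
      simp at this
    have h3 : MvPolynomial.degreeOf i a ≠ 0 := MvPolynomial.mem_vars_iff_degreeOf_ne_zero.mp hi
    have h4 := MvPolynomial.degreeOf_pow_le i G m
    rw [h2, mul_zero] at h4
    omega
  have hcard := hind.lift_cardinalMk_le_trdeg
  have hs : 0 < s := Fin.pos i
  rw [hA']
  have h5 : ((s - 1 : ℕ) : Cardinal.{u}) ≤ Algebra.trdeg K (A ⧸ p) := by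
    simpa using hcard
  calc (s : Cardinal.{u}) = ((s - 1 : ℕ) : Cardinal.{u}) + 1 := by
        rw [← Nat.cast_succ, Nat.succ_eq_add_one, Nat.sub_add_cancel hs]
    _ ≤ _ := by gcongr

/-- Adjoining fractions does not change the transcendence degree. -/
theorem trdeg_eq_of_isAlgebraic {K : Type v} [Field K] {A B : Type u} [CommRing A] [CommRing B]
    [IsDomain B] [Algebra K A] [Algebra K B] (φ : A →ₐ[K] B) (hφ : Function.Injective φ)
    (halg : ∀ b : B, ∃ a : A, a ≠ 0 ∧ ∃ c : A, φ a * b = φ c) :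
    Algebra.trdeg K A = Algebra.trdeg K B := by
  algebraize [φ.toRingHom]
  have : FaithfulSMul A B := (faithfulSMul_iff_algebraMap_injective _ _).mpr hφ
  have : IsScalarTower K A B := IsScalarTower.of_algebraMap_eq fun x => (φ.commutes x).symm
  have : IsDomain A := hφ.isDomain φ.toRingHom
  have : FaithfulSMul K A := inferInstance
  have : Algebra.IsAlgebraic A B := ⟨fun b => by
    obtain ⟨a, ha, c, hc⟩ := halg b
    refine ⟨Polynomial.C a * Polynomial.X - Polynomial.C c, fun h => ha ?_, ?_⟩
    · simpa using congrArg (fun q => Polynomial.coeff q 1) h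
    · have : algebraMap A B a * b = algebraMap A B c := hc
      simp [this]⟩
  rw [← trdeg_add_eq K A (A := B), trdeg_eq_zero (R := A) (A := B), add_zero]

/-- Krull's principal ideal theorem in terms of transcendence degrees: dividing a finitely
generated domain by a minimal prime over a nonzero element lowers the transcendence degree by at
most one. -/
theorem trdeg_le_trdeg_quotient_add_one {K : Type v} [Field K] {A : Type u}
    [CommRing A] [IsDomain A] [Algebra K A] [Algebra.FiniteType K A] {f : A} (hf0 : f ≠ 0)
    {p : Ideal A} (hp : p ∈ (Ideal.span {f}).minimalPrimes) :
    Algebra.trdeg K A ≤ Algebra.trdeg K (A ⧸ p) + 1 := by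
  classical
  have hpp : p.IsPrime := hp.1.1
  have hfp : f ∈ p := hp.1.2 (Ideal.mem_span_singleton_self f)
  have : IsNoetherianRing A := Algebra.FiniteType.isNoetherianRing K A
  have hfin := (Ideal.span {f}).finite_minimalPrimes_of_isNoetherianRing A
  -- `g` lies in all minimal primes over `f` except `p`, so that `p` becomes the radical of `(f)`
  -- once `g` is inverted
  obtain ⟨g, hgp, hg⟩ : ∃ g, g ∉ p ∧ ∀ q ∈ (Ideal.span {f}).minimalPrimes, q ≠ p → g ∈ q := by
    have hex : ∀ q : Ideal A, ∃ g, g ∉ p ∧ (q ∈ (Ideal.span {f}).minimalPrimes → q ≠ p → g ∈ q) := by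
      intro q
      by_cases hq : q ∈ (Ideal.span {f}).minimalPrimes ∧ q ≠ p
      · have : ¬ q ≤ p := fun hle => hq.2 (le_antisymm hle (hp.2 hq.1.1 hle))
        obtain ⟨g, hgq, hgp⟩ := SetLike.not_le_iff_exists.mp this
        exact ⟨g, hgp, fun _ _ => hgq⟩
      · exact ⟨1, fun h => hpp.ne_top ((Ideal.eq_top_iff_one p).mpr h), fun h1 h2 => absurd ⟨h1, h2⟩ hq⟩
    choose g hg1 hg2 using hex
    refine ⟨∏ q ∈ hfin.toFinset, g q, ?_, fun q hq hqp => ?_⟩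
    · rw [hpp.prod_mem_iff]
      rintro ⟨q, -, hq⟩
      exact hg1 q hq
    · exact Ideal.mem_of_dvd _ (Finset.dvd_prod_of_mem g (hfin.mem_toFinset.mpr hq)) (hg2 q hq hqp)
  have hgrad : ∀ x ∈ p, ∃ m : ℕ, f ∣ (g * x) ^ m := by
    intro x hx
    have : g * x ∈ (Ideal.span {f}).radical := by
      rw [← Ideal.sInf_minimalPrimes, Ideal.mem_sInf]
      intro q hq
      by_cases hqp : q = p
      · rw [hqp]; exact p.mul_mem_left _ hx
      · exact q.mul_mem_right _ (hg q hq hqp)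
    obtain ⟨m, hm⟩ := this
    exact ⟨m, Ideal.mem_span_singleton.mp hm⟩
  have hg0 : g ≠ 0 := fun h => hgp (h ▸ p.zero_mem)
  let B := Localization.Away g
  have hle : Submonoid.powers g ≤ nonZeroDivisors A := powers_le_nonZeroDivisors_of_noZeroDivisors hg0
  have : IsDomain B := IsLocalization.isDomain_localization hle
  have hinj : Function.Injective (algebraMap A B) := IsLocalization.injective B hle
  have hdisj : Disjoint (Submonoid.powers g : Set A) p := by
    rw [Set.disjoint_left]
    rintro _ ⟨m, rfl⟩ hm
    exact hgp (hpp.mem_of_pow_mem m hm)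
  let p' : Ideal B := p.map (algebraMap A B)
  have hp' : p'.IsPrime := IsLocalization.isPrime_of_isPrime_disjoint (Submonoid.powers g) B p hpp hdisj
  have hcomap : p'.comap (algebraMap A B) = p :=
    IsLocalization.under_map_of_isPrime_disjoint (Submonoid.powers g) B hpp hdisj
  have hsurj : ∀ b : B, ∃ (m : ℕ) (c : A), algebraMap A B (g ^ m) * b = algebraMap A B c := by
    intro b
    obtain ⟨⟨c, ⟨_, m, rfl⟩⟩, hc⟩ := IsLocalization.surj (Submonoid.powers g) b
    exact ⟨m, c, by rw [mul_comm]; exact hc⟩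
  have : Algebra.FiniteType A B := inferInstance
  have : Algebra.FiniteType K B := Algebra.FiniteType.trans (S := A) inferInstance inferInstance
  have hA : Algebra.trdeg K A = Algebra.trdeg K B := by
    refine trdeg_eq_of_isAlgebraic (IsScalarTower.toAlgHom K A B) hinj fun b => ?_
    obtain ⟨m, c, h⟩ := hsurj b
    exact ⟨g ^ m, pow_ne_zero m hg0, c, h⟩
  have hq : Algebra.trdeg K (A ⧸ p) = Algebra.trdeg K (B ⧸ p') := by
    refine trdeg_eq_of_isAlgebraic
      (Ideal.quotientMapₐ p' (IsScalarTower.toAlgHom K A B) hcomap.ge) ?_ fun b => ?_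
    · exact Ideal.quotientMap_injective' (H := hcomap.ge) hcomap.le
    · obtain ⟨b, rfl⟩ := Ideal.Quotient.mk_surjective b
      obtain ⟨m, c, h⟩ := hsurj b
      refine ⟨Ideal.Quotient.mk p (g ^ m), ?_, Ideal.Quotient.mk p c, ?_⟩
      · rw [Ne, Ideal.Quotient.eq_zero_iff_mem]
        exact fun h => hgp (hpp.mem_of_pow_mem m h)
      · have := congrArg (Ideal.Quotient.mk p') h
        rwa [map_mul] at this
  rw [hA, hq]
  refine trdeg_le_trdeg_quotient_add_one_of_forall_dvd_pow (f := algebraMap A B f)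
    (by rwa [Ne, map_eq_zero_iff _ hinj]) p' (Ideal.mem_map_of_mem _ hfp) fun b hb => ?_
  obtain ⟨m, c, h⟩ := hsurj b
  have hu : IsUnit (algebraMap A B g) := IsLocalization.Away.algebraMap_isUnit g
  have hc : c ∈ p := by
    rw [← hcomap, Ideal.mem_comap, ← h]
    exact p'.mul_mem_left _ hb
  obtain ⟨l, hl⟩ := hgrad c hc
  refine ⟨l, ?_⟩
  have h1 := map_dvd (algebraMap A B) hl
  rw [map_pow, map_mul, ← h, mul_pow, mul_pow, ← mul_assoc] at h1
  refine (IsUnit.dvd_mul_left ?_).mp h1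
  rw [map_pow]
  exact (hu.pow l).mul ((hu.pow m).pow l)

theorem trdeg_quotient_lt_aleph0 {K : Type v} [Field K] {B : Type u} [CommRing B] [Algebra K B]
    [Algebra.FiniteType K B] (p : Ideal B) [p.IsPrime] :
    Algebra.trdeg K (B ⧸ p) < Cardinal.aleph0 :=
  have : Algebra.FiniteType K (B ⧸ p) := inferInstance
  trdeg_lt_aleph0_of_finiteType

/-- Strict monotonicity of the transcendence degree along a strict inclusion of primes. -/
theorem trdeg_quotient_lt {K : Type v} [Field K] {B : Type u} [CommRing B] [Algebra K B]
    [Algebra.FiniteType K B] {p q : Ideal B} [hp : p.IsPrime] [hq : q.IsPrime] (hlt : p < q) :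
    Algebra.trdeg K (B ⧸ q) < Algebra.trdeg K (B ⧸ p) := by
  by_contra! hle
  obtain ⟨f, hfq, hfp⟩ := SetLike.exists_of_lt hlt
  obtain ⟨s, hs⟩ := exists_isTranscendenceBasis K (B ⧸ q)
  have hsfin : Finite s := by
    rw [← Cardinal.lt_aleph0_iff_finite, hs.cardinalMk_eq_trdeg]
    exact trdeg_quotient_lt_aleph0 q
  choose b hb using fun y : s => Ideal.Quotient.mk_surjective (I := q) y.1
  let π : (B ⧸ p) →ₐ[K] (B ⧸ q) := Ideal.Quotient.factorₐ K hlt.le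
  have hπ : π ∘ (fun y => Ideal.Quotient.mk p (b y)) = (Subtype.val : s → B ⧸ q) := by
    ext y
    simp [π, hb]
  have hind : AlgebraicIndependent K (fun y => Ideal.Quotient.mk p (b y)) :=
    AlgebraicIndependent.of_comp π (by rw [hπ]; exact hs.1)
  have hbasis := hind.isTranscendenceBasis_of_trdeg_le_of_finite
    (hle.trans_eq hs.cardinalMk_eq_trdeg.symm)
  have halg := hbasis.isAlgebraic.isAlgebraic (Ideal.Quotient.mk p f)
  obtain ⟨r, hr0, c, hc⟩ := halg.exists_nonzero_dvd
    (mem_nonZeroDivisors_of_ne_zero (by rwa [Ne, Ideal.Quotient.eq_zero_iff_mem]))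
  have hr : π r.1 = 0 := by
    have : (r : B ⧸ p) = Ideal.Quotient.mk p f * c := hc
    rw [this, map_mul]
    have : π (Ideal.Quotient.mk p f) = 0 := by
      simpa [π] using Ideal.Quotient.eq_zero_iff_mem.mpr hfq
    rw [this, zero_mul]
  obtain ⟨F, hF⟩ := (AlgebraicIndependent.aevalEquiv hind).surjective r
  have hF' : (r : B ⧸ p) = MvPolynomial.aeval (fun y => Ideal.Quotient.mk p (b y)) F := by
    rw [← hF]
    exact hind.algebraMap_aevalEquiv F
  have hF0 : F = 0 := by
    refine hs.1.eq_zero_of_aeval_eq_zero F ?_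
    rw [← hπ, ← hr, hF', MvPolynomial.comp_aeval_apply]
    rfl
  apply hr0
  rw [← hF, hF0, map_zero]

end Algebra

/-! ### Zariski irreducible sets of points and their dimension -/

section Dimension

open MvPolynomial

section Basic

variable (k : Type*) {K : Type*} [Field k] [Field K] [Algebra k K] {σ τ : Type}

/-- A set of `K`-points of affine space is irreducible over `k` if the polynomials over `k` that
vanish on it form a prime ideal. -/
def ZIrred (V : Set (σ → K)) : Prop := (vanishingIdeal k V).IsPrime

/-- The dimension over `k` of an irreducible set of `K`-points of affine space: the
transcendence degree of the ring of polynomial functions on it. -/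
def zdim (V : Set (σ → K)) : ℕ :=
  Cardinal.toNat (Algebra.trdeg k (MvPolynomial σ k ⧸ vanishingIdeal k V))

variable {k}

/-- Irreducibility, in terms of principal open subsets. -/
theorem zirred_iff {V : Set (σ → K)} :
    ZIrred k V ↔ V.Nonempty ∧ ∀ f g : MvPolynomial σ k, (∃ x ∈ V, aeval x f ≠ 0) →
      (∃ x ∈ V, aeval x g ≠ 0) → ∃ x ∈ V, aeval x f ≠ 0 ∧ aeval x g ≠ 0 := by
  constructor
  · intro h
    refine ⟨?_, fun f g hf hg => ?_⟩
    · rw [Set.nonempty_iff_ne_empty]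
      rintro rfl
      exact h.ne_top vanishingIdeal_empty
    · by_contra! hfg
      have : f * g ∈ vanishingIdeal k V := fun x hx => by
        by_cases hfx : aeval x f = 0
        · rw [map_mul, hfx, zero_mul]
        · rw [map_mul, hfg x hx hfx, mul_zero]
      rcases h.mem_or_mem this with h | h
      · obtain ⟨x, hx, hfx⟩ := hf
        exact hfx (h x hx)
      · obtain ⟨x, hx, hgx⟩ := hg
        exact hgx (h x hx)
  · rintro ⟨⟨x, hx⟩, h⟩
    refine ⟨fun htop => ?_, fun {f g} hfg => ?_⟩
    · have : (1 : MvPolynomial σ k) ∈ vanishingIdeal k V := htop ▸ Submodule.mem_top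
      simpa using this x hx
    · by_contra! hn
      simp only [mem_vanishingIdeal_iff, not_forall] at hn
      obtain ⟨⟨x, hx, hfx⟩, y, hy, hgy⟩ := hn
      obtain ⟨z, hz, hfz, hgz⟩ := h f g ⟨x, hx, hfx⟩ ⟨y, hy, hgy⟩
      have := hfg z hz
      rw [map_mul] at this
      exact (mul_ne_zero hfz hgz) this

theorem ZIrred.nonempty {V : Set (σ → K)} (h : ZIrred k V) : V.Nonempty := (zirred_iff.mp h).1

theorem ZIrred.exists_ne {V : Set (σ → K)} (h : ZIrred k V) {f g : MvPolynomial σ k}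
    (hf : f ∉ vanishingIdeal k V) (hg : g ∉ vanishingIdeal k V) :
    ∃ x ∈ V, aeval x f ≠ 0 ∧ aeval x g ≠ 0 := by
  simp only [mem_vanishingIdeal_iff, not_forall, exists_prop] at hf hg
  exact (zirred_iff.mp h).2 f g hf hg

theorem ZIrred.of_vanishingIdeal_eq {V W : Set (σ → K)} (h : ZIrred k V)
    (he : vanishingIdeal k W = vanishingIdeal k V) : ZIrred k W := by
  unfold ZIrred; rwa [he]

theorem zdim_congr {V W : Set (σ → K)} (he : vanishingIdeal k W = vanishingIdeal k V) :
    zdim k W = zdim k V := by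
  unfold zdim; rw [he]

/-- A nonempty relatively open subset of an irreducible set is dense. -/
theorem ZIrred.vanishingIdeal_inter {V : Set (σ → K)} (h : ZIrred k V) {f : MvPolynomial σ k}
    (hf : ∃ x ∈ V, aeval x f ≠ 0) :
    vanishingIdeal k {x ∈ V | aeval x f ≠ 0} = vanishingIdeal k V := by
  refine le_antisymm (fun g hg => ?_) (vanishingIdeal_anti_mono fun x hx => hx.1)
  by_contra hgV
  obtain ⟨x, hx, hgx, hfx⟩ := h.exists_ne hgV (g := f) fun hfV => by
    obtain ⟨x, hx, hfx⟩ := hf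
    exact hfx (hfV x hx)
  exact hgx (hg x ⟨hx, hfx⟩)

theorem vanishingIdeal_eq_of_subset_of_subset {V W : Set (σ → K)} (h : V ⊆ W)
    (h' : W ⊆ zeroLocus K (vanishingIdeal k V)) : vanishingIdeal k W = vanishingIdeal k V :=
  le_antisymm (vanishingIdeal_anti_mono h) (le_zeroLocus_iff_le_vanishingIdeal.mp h')

theorem vanishingIdeal_closure (V : Set (σ → K)) :
    vanishingIdeal k (zeroLocus K (vanishingIdeal k V)) = vanishingIdeal k V :=
  vanishingIdeal_eq_of_subset_of_subset (zeroLocus_vanishingIdeal_le V) subset_rfl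

variable [Finite σ]

theorem zdim_anti {V W : Set (σ → K)} (hV : ZIrred k V) (hW : ZIrred k W)
    (hle : vanishingIdeal k V ≤ vanishingIdeal k W) : zdim k W ≤ zdim k V := by
  have := hV; have := hW
  unfold ZIrred at *
  exact Cardinal.toNat_le_toNat
    (trdeg_le_of_surjective (Ideal.Quotient.factorₐ k hle) (Ideal.Quotient.factor_surjective hle))
    (trdeg_quotient_lt_aleph0 _)

theorem zdim_strictAnti {V W : Set (σ → K)} (hV : ZIrred k V) (hW : ZIrred k W)
    (hlt : vanishingIdeal k V < vanishingIdeal k W) : zdim k W < zdim k V := by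
  have := hV; have := hW
  unfold ZIrred at *
  exact Cardinal.toNat_lt_toNat (trdeg_quotient_lt hlt) (trdeg_quotient_lt_aleph0 _)

theorem vanishingIdeal_eq_of_zdim_le {V W : Set (σ → K)} (hV : ZIrred k V) (hW : ZIrred k W)
    (hle : vanishingIdeal k V ≤ vanishingIdeal k W) (hd : zdim k V ≤ zdim k W) :
    vanishingIdeal k V = vanishingIdeal k W := by
  by_contra hne
  exact absurd (zdim_strictAnti hV hW (lt_of_le_of_ne hle hne)) (by omega)

theorem zdim_mono {V W : Set (σ → K)} (hV : ZIrred k V) (hW : ZIrred k W) (h : V ⊆ W) :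
    zdim k V ≤ zdim k W :=
  zdim_anti hW hV (vanishingIdeal_anti_mono h)

end Basic

section Independent

variable (k : Type*) {K : Type*} [Field k] [Field K] [Algebra k K] {σ τ : Type}

/-- The polynomial functions `g i` on `V` are algebraically independent over `k`. -/
def IndepOn {ι : Type} (V : Set (σ → K)) (g : ι → MvPolynomial σ k) : Prop :=
  ∀ F : MvPolynomial ι k, (∀ x ∈ V, aeval (fun i => aeval x (g i)) F = 0) → F = 0

variable {k}

theorem indepOn_iff {ι : Type} {V : Set (σ → K)} {g : ι → MvPolynomial σ k} :
    IndepOn k V g ↔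
      AlgebraicIndependent k (fun i => Ideal.Quotient.mk (vanishingIdeal k V) (g i)) := by
  rw [algebraicIndependent_iff]
  refine forall_congr' fun F => imp_congr_left ?_
  have h1 : aeval (fun i => Ideal.Quotient.mk (vanishingIdeal k V) (g i)) F =
      Ideal.Quotient.mk (vanishingIdeal k V) (aeval g F) :=
    (comp_aeval_apply g (Ideal.Quotient.mkₐ k (vanishingIdeal k V)) F).symm
  rw [h1, Ideal.Quotient.eq_zero_iff_mem, mem_vanishingIdeal_iff]
  refine forall₂_congr fun x _ => ?_
  rw [comp_aeval_apply]

theorem zdim_le_card [Fintype σ] {V : Set (σ → K)} : zdim k V ≤ Fintype.card σ := by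
  have h1 := trdeg_le_of_surjective (Ideal.Quotient.mkₐ k (vanishingIdeal k V))
    (Ideal.Quotient.mkₐ_surjective _ _)
  rw [MvPolynomial.trdeg_of_isDomain] at h1
  have h2 := Cardinal.toNat_le_toNat h1 (by simp)
  simpa [zdim] using h2

theorem zirred_univ [Infinite k] : ZIrred k (Set.univ : Set (σ → K)) := by
  have h0 : vanishingIdeal k (Set.univ : Set (σ → K)) = ⊥ := by
    rw [eq_bot_iff]
    intro f hf
    have : f = 0 := MvPolynomial.funext fun x => by
      have := hf (algebraMap k K ∘ x) trivial
      rw [aeval_algebraMap_apply] at this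
      simpa [aeval_eq_eval] using this
    rw [this]; exact Submodule.zero_mem _
  unfold ZIrred
  rw [h0]
  exact Ideal.isPrime_bot

variable [Finite σ]

theorem IndepOn.card_le_zdim {ι : Type} [Fintype ι] {V : Set (σ → K)} (hV : ZIrred k V)
    {g : ι → MvPolynomial σ k} (hg : IndepOn k V g) : Fintype.card ι ≤ zdim k V := by
  have := hV
  unfold ZIrred at this
  have h := (indepOn_iff.mp hg).lift_cardinalMk_le_trdeg
  have h2 := Cardinal.toNat_le_toNat h (by simpa using trdeg_quotient_lt_aleph0 _)
  simpa [zdim] using h2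

theorem exists_indepOn {V : Set (σ → K)} (hV : ZIrred k V) :
    ∃ g : Fin (zdim k V) → MvPolynomial σ k, IndepOn k V g := by
  have := hV
  unfold ZIrred at this
  obtain ⟨s, hs⟩ := exists_isTranscendenceBasis k (MvPolynomial σ k ⧸ vanishingIdeal k V)
  have hc := hs.cardinalMk_eq_trdeg
  have hfin : Finite s := by
    rw [← Cardinal.lt_aleph0_iff_finite, hc]
    exact trdeg_quotient_lt_aleph0 _
  have hcard : Nat.card s = zdim k V := by
    unfold zdim; rw [← hc]; rfl
  choose b hb using fun y : s => Ideal.Quotient.mk_surjective (I := vanishingIdeal k V) y.1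
  let e : Fin (zdim k V) ≃ s := (finCongr hcard.symm).trans (Finite.equivFin s).symm
  refine ⟨b ∘ e, indepOn_iff.mpr ?_⟩
  have : (fun i => Ideal.Quotient.mk (vanishingIdeal k V) ((b ∘ e) i)) =
      (Subtype.val : s → MvPolynomial σ k ⧸ vanishingIdeal k V) ∘ e := by
    ext i; simp [hb]
  rw [this]
  exact hs.1.comp e e.injective

end Independent

section PolyMap

variable {k : Type*} {K : Type*} [Field k] [Field K] [Algebra k K] {σ τ ρ : Type}

/-- The map of affine spaces with components `p t`. -/
def polyMap (p : τ → MvPolynomial σ k) (x : σ → K) : τ → K := fun t => aeval x (p t)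

theorem aeval_polyMap (p : τ → MvPolynomial σ k) (x : σ → K) (f : MvPolynomial τ k) :
    aeval (polyMap p x) f = aeval x (aeval p f) := by
  rw [comp_aeval_apply]; rfl

theorem mem_vanishingIdeal_image (p : τ → MvPolynomial σ k) {V : Set (σ → K)}
    {f : MvPolynomial τ k} :
    f ∈ vanishingIdeal k (polyMap p '' V) ↔ aeval p f ∈ vanishingIdeal k V := by
  simp only [mem_vanishingIdeal_iff, Set.forall_mem_image, aeval_polyMap]

theorem vanishingIdeal_image (p : τ → MvPolynomial σ k) (V : Set (σ → K)) :
    vanishingIdeal k (polyMap p '' V) =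
      (vanishingIdeal k V).comap (aeval p : MvPolynomial τ k →ₐ[k] MvPolynomial σ k) := by
  ext f
  rw [mem_vanishingIdeal_image, Ideal.mem_comap]

theorem ZIrred.image {V : Set (σ → K)} (hV : ZIrred k V) (p : τ → MvPolynomial σ k) :
    ZIrred k (polyMap p '' V) := by
  unfold ZIrred at *
  rw [vanishingIdeal_image]
  exact Ideal.IsPrime.comap _

theorem zdim_image_le [Finite σ] [Finite τ] {V : Set (σ → K)} (hV : ZIrred k V)
    (p : τ → MvPolynomial σ k) : zdim k (polyMap p '' V) ≤ zdim k V := by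
  obtain ⟨g, hg⟩ := exists_indepOn (hV.image p)
  have : IndepOn k V (fun i => aeval p (g i)) := fun F hF => hg F fun y hy => by
    obtain ⟨x, hx, rfl⟩ := hy
    simpa only [aeval_polyMap] using hF x hx
  simpa using this.card_le_zdim hV

theorem vanishingIdeal_image_anti {V W : Set (σ → K)} (p : τ → MvPolynomial σ k)
    (h : vanishingIdeal k V ≤ vanishingIdeal k W) :
    vanishingIdeal k (polyMap p '' V) ≤ vanishingIdeal k (polyMap p '' W) := by
  rw [vanishingIdeal_image, vanishingIdeal_image]
  exact Ideal.comap_mono h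

end PolyMap

section BaseChange

variable (k : Type*) {K : Type*} [Field k] [Field K] [Algebra k K] {σ τ : Type}

theorem vanishingIdeal_eq_comap (V : Set (σ → K)) :
    vanishingIdeal k V = (vanishingIdeal K V).comap (MvPolynomial.map (algebraMap k K)) := by
  ext f
  simp [Ideal.mem_comap, aeval_map_algebraMap]

variable {k}

theorem vanishingIdeal_mono_base {V W : Set (σ → K)}
    (h : vanishingIdeal K V ≤ vanishingIdeal K W) : vanishingIdeal k V ≤ vanishingIdeal k W := by
  rw [vanishingIdeal_eq_comap, vanishingIdeal_eq_comap k W]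
  exact Ideal.comap_mono h

theorem ZIrred.base {V : Set (σ → K)} (h : ZIrred K V) : ZIrred k V := by
  unfold ZIrred at *
  rw [vanishingIdeal_eq_comap]
  exact Ideal.IsPrime.comap _

attribute [local instance] MvPolynomial.algebraMvPolynomial

/-- The transcendence degree does not change along an integral extension if the base field is
replaced by an algebraic extension. -/
theorem toNat_trdeg_eq_of_isIntegral [Algebra.IsAlgebraic k K] {S A : Type*} [CommRing S]
    [CommRing A] [IsDomain A] [Algebra k S] [Algebra k A] [Algebra K A] [IsScalarTower k K A]
    (φ : S →ₐ[k] A) (hφ : Function.Injective φ) (hint : φ.toRingHom.IsIntegral) :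
    Cardinal.toNat (Algebra.trdeg k S) = Cardinal.toNat (Algebra.trdeg K A) := by
  algebraize [φ.toRingHom]
  have : IsDomain S := hφ.isDomain φ.toRingHom
  have : FaithfulSMul S A := (faithfulSMul_iff_algebraMap_injective _ _).mpr hφ
  have : IsScalarTower k S A := IsScalarTower.of_algebraMap_eq fun x => (φ.commutes x).symm
  have h1 := lift_trdeg_add_eq k S (A := A)
  rw [trdeg_eq_zero (R := S)] at h1
  have h2 := lift_trdeg_add_eq k K (A := A)
  rw [trdeg_eq_zero (R := k) (A := K)] at h2
  have h3 := congrArg Cardinal.toNat h1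
  have h4 := congrArg Cardinal.toNat h2
  simp only [Cardinal.lift_zero, add_zero, zero_add, Cardinal.toNat_lift] at h3 h4
  rw [h3, h4]

/-- The dimension of a geometrically irreducible set does not depend on the ground field. -/
theorem zdim_base [Algebra.IsAlgebraic k K] {V : Set (σ → K)} (h : ZIrred K V) :
    zdim k V = zdim K V := by
  have := h
  unfold ZIrred at this
  have hI := vanishingIdeal_eq_comap k V
  unfold zdim
  rw [hI]
  let φ : MvPolynomial σ k →ₐ[k] MvPolynomial σ K :=
    IsScalarTower.toAlgHom k (MvPolynomial σ k) (MvPolynomial σ K)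
  refine toNat_trdeg_eq_of_isIntegral (Ideal.quotientMapₐ (vanishingIdeal K V) φ le_rfl)
    Ideal.quotientMap_injective ?_
  exact RingHom.IsIntegral.quotient (f := (φ : MvPolynomial σ k →+* MvPolynomial σ K))
    (algebraMap_isIntegral_iff.mpr inferInstance)

/-- Equidimensionality of the geometric components of an irreducible `k`-variety: through every
point of the closure over `k` of `V` there passes an irreducible closed set over `K` that is dense
in `V` over `k`. -/
theorem exists_irreducible_through_point [IsAlgClosed K] [Algebra.IsAlgebraic k K] [Finite σ]
    {V : Set (σ → K)} (hV : ZIrred k V) {c : σ → K} (hc : c ∈ zeroLocus K (vanishingIdeal k V)) :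
    ∃ W : Set (σ → K), ZIrred K W ∧ c ∈ W ∧ W = zeroLocus K (vanishingIdeal K W) ∧
      vanishingIdeal k W = vanishingIdeal k V ∧ zdim K W = zdim k V := by
  have := hV
  unfold ZIrred at this
  have : Module.Flat (MvPolynomial σ k) (MvPolynomial σ K) := by
    exact Module.Flat.isBaseChange k (MvPolynomial σ k) K (MvPolynomial σ K)
      (Algebra.IsPushout.out (R := k) (S := MvPolynomial σ k) (R' := K) (S' := MvPolynomial σ K))
  have hover : (vanishingIdeal K {c}).LiesOver (vanishingIdeal k {c}) :=
    ⟨vanishingIdeal_eq_comap k {c}⟩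
  have hle : vanishingIdeal k V ≤ vanishingIdeal k {c} := by
    rw [← le_zeroLocus_iff_le_vanishingIdeal]
    exact Set.singleton_subset_iff.mpr hc
  -- going down for the flat extension from polynomials over `k` to polynomials over `K`
  obtain ⟨Q, hQc, hQ, hQV⟩ := Ideal.exists_ideal_le_liesOver_of_le
    (Q := vanishingIdeal K {c}) hle
  have hIQ : vanishingIdeal K (zeroLocus K Q) = Q := IsPrime.vanishingIdeal_zeroLocus Q
  have hQV' : vanishingIdeal k V = Q.comap (MvPolynomial.map (algebraMap k K)) := hQV.over
  have hirr : ZIrred K (zeroLocus K Q) := by unfold ZIrred; rwa [hIQ]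
  have hk : vanishingIdeal k (zeroLocus K Q) = vanishingIdeal k V := by
    rw [vanishingIdeal_eq_comap, hIQ, hQV']
  refine ⟨zeroLocus K Q, hirr, fun f hf => ?_, by rw [hIQ], hk, ?_⟩
  · exact hQc hf c rfl
  · rw [← zdim_base (k := k) hirr, zdim_congr hk]

end BaseChange

end Dimension

/-! ### Images, products, hypersurface sections and fibres -/

section Geometry

open MvPolynomial

set_option linter.unusedSectionVars false

section Dense

variable {k : Type*} {K : Type*} [Field k] [Field K] [Algebra k K] {σ τ : Type} [Finite τ]

/-- If the image of `E` under a map of affine spaces is dense in an irreducible set with ideal `P`, then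
this is already true for an irreducible subset of `E`. -/
theorem exists_zirred_subset_image_dense (E : Set (τ → K)) (φ : (τ → K) → σ → K)
    (P : Ideal (MvPolynomial σ k)) [hP : P.IsPrime] (hE : vanishingIdeal k (φ '' E) ≤ P) :
    ∃ W ⊆ E, ZIrred K W ∧ vanishingIdeal k (φ '' W) ≤ P := by
  let S : Set (Ideal (MvPolynomial τ K)) :=
    {I | ∃ W ⊆ E, vanishingIdeal K W = I ∧ vanishingIdeal k (φ '' W) ≤ P}
  obtain ⟨I, ⟨W, hWE, rfl, hWP⟩, hmax⟩ :=
    set_has_maximal_iff_noetherian.mpr (inferInstance : IsNoetherianRing (MvPolynomial τ K)) S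
      ⟨_, E, subset_rfl, rfl, hE⟩
  refine ⟨W, hWE, ⟨fun htop => ?_, fun {f g} hfg => ?_⟩, hWP⟩
  · have hW : W = ∅ := by
      by_contra hne
      obtain ⟨x, hx⟩ := Set.nonempty_iff_ne_empty.mpr hne
      have : (1 : MvPolynomial τ K) ∈ vanishingIdeal K W := htop ▸ Submodule.mem_top
      simpa using this x hx
    rw [hW, Set.image_empty, vanishingIdeal_empty] at hWP
    exact hP.ne_top (top_le_iff.mp hWP)
  · by_contra! hn
    -- otherwise `W` is the union of two smaller relatively closed subsets
    have hcase : ∀ h : MvPolynomial τ K, h ∉ vanishingIdeal K W →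
        ¬ vanishingIdeal k (φ '' {x ∈ W | aeval x h = 0}) ≤ P := by
      intro h hh hle
      refine hmax _ ⟨{x ∈ W | aeval x h = 0}, fun x hx => hWE hx.1, rfl, hle⟩ ?_
      refine lt_of_le_of_ne (vanishingIdeal_anti_mono fun x hx => hx.1) fun he => hh ?_
      rw [he]
      exact fun x hx => hx.2
    obtain ⟨u, hu, huP⟩ := SetLike.not_le_iff_exists.mp (hcase f hn.1)
    obtain ⟨v, hv, hvP⟩ := SetLike.not_le_iff_exists.mp (hcase g hn.2)
    have : u * v ∈ P := hWP <| by
      rintro _ ⟨x, hx, rfl⟩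
      have hx' := hfg x hx
      rw [map_mul] at hx' ⊢
      rcases mul_eq_zero.mp hx' with h | h
      · rw [hu _ ⟨x, ⟨hx, h⟩, rfl⟩, zero_mul]
      · rw [hv _ ⟨x, ⟨hx, h⟩, rfl⟩, mul_zero]
    rcases hP.mem_or_mem this with h | h
    · exact huP h
    · exact hvP h

theorem polyMap_X (x : τ → K) : polyMap (X : τ → MvPolynomial τ k) x = x := by
  ext t; simp [polyMap]

theorem polyMap_X_image (V : Set (τ → K)) : polyMap (X : τ → MvPolynomial τ k) '' V = V := by
  have : polyMap (X : τ → MvPolynomial τ k) = (id : (τ → K) → τ → K) := funext polyMap_X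
  rw [this, Set.image_id]

end Dense

variable {K : Type*} [Field K] {σ τ ρ : Type}

section Product

/-- The product of two sets of points of affine spaces. -/
def prodSet (V : Set (σ → K)) (W : Set (τ → K)) : Set (σ ⊕ τ → K) :=
  {x | x ∘ Sum.inl ∈ V ∧ x ∘ Sum.inr ∈ W}

theorem elim_mem_prodSet {V : Set (σ → K)} {W : Set (τ → K)} {x : σ → K} {y : τ → K} :
    Sum.elim x y ∈ prodSet V W ↔ x ∈ V ∧ y ∈ W := by
  simp [prodSet]

/-- Restriction of a polynomial function on a product to a slice `y = const`. -/
def sliceLeft (f : MvPolynomial (σ ⊕ τ) K) (y : τ → K) : MvPolynomial σ K :=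
  aeval (Sum.elim X (fun t => C (y t))) f

/-- Restriction of a polynomial function on a product to a slice `x = const`. -/
def sliceRight (f : MvPolynomial (σ ⊕ τ) K) (x : σ → K) : MvPolynomial τ K :=
  aeval (Sum.elim (fun s => C (x s)) X) f

theorem aeval_sliceLeft (f : MvPolynomial (σ ⊕ τ) K) (x : σ → K) (y : τ → K) :
    aeval x (sliceLeft f y) = aeval (Sum.elim x y) f := by
  rw [sliceLeft, comp_aeval_apply]
  congr 2
  ext i
  cases i <;> simp

theorem aeval_sliceRight (f : MvPolynomial (σ ⊕ τ) K) (x : σ → K) (y : τ → K) :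
    aeval y (sliceRight f x) = aeval (Sum.elim x y) f := by
  rw [sliceRight, comp_aeval_apply]
  congr 2
  ext i
  cases i <;> simp

theorem exists_elim_eq (z : σ ⊕ τ → K) : ∃ x y, z = Sum.elim x y :=
  ⟨z ∘ Sum.inl, z ∘ Sum.inr, (Sum.elim_comp_inl_inr z).symm⟩

theorem ZIrred.prod {V : Set (σ → K)} {W : Set (τ → K)} (hV : ZIrred K V) (hW : ZIrred K W) :
    ZIrred K (prodSet V W) := by
  obtain ⟨⟨v, hv⟩, hV⟩ := zirred_iff.mp hV
  obtain ⟨⟨w, hw⟩, hW⟩ := zirred_iff.mp hW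
  refine zirred_iff.mpr ⟨⟨Sum.elim v w, elim_mem_prodSet.mpr ⟨hv, hw⟩⟩, fun f g hf hg => ?_⟩
  obtain ⟨z, hz, hfz⟩ := hf
  obtain ⟨z', hz', hgz⟩ := hg
  obtain ⟨x, y, rfl⟩ := exists_elim_eq z
  obtain ⟨x', y', rfl⟩ := exists_elim_eq z'
  rw [elim_mem_prodSet] at hz hz'
  obtain ⟨x₀, hx₀, h1, h2⟩ := hV (sliceLeft f y) (sliceLeft g y')
    ⟨x, hz.1, by rwa [aeval_sliceLeft]⟩ ⟨x', hz'.1, by rwa [aeval_sliceLeft]⟩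
  rw [aeval_sliceLeft, ← aeval_sliceRight] at h1 h2
  obtain ⟨y₀, hy₀, h3, h4⟩ := hW _ _ ⟨y, hz.2, h1⟩ ⟨y', hz'.2, h2⟩
  rw [aeval_sliceRight] at h3 h4
  exact ⟨_, elim_mem_prodSet.mpr ⟨hx₀, hy₀⟩, h3, h4⟩

theorem zdim_prod_ge [Finite σ] [Finite τ] {V : Set (σ → K)} {W : Set (τ → K)} (hV : ZIrred K V)
    (hW : ZIrred K W) : zdim K V + zdim K W ≤ zdim K (prodSet V W) := by
  obtain ⟨g, hg⟩ := exists_indepOn hV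
  obtain ⟨h, hh⟩ := exists_indepOn hW
  have : IndepOn K (prodSet V W) (Sum.elim (fun i => rename Sum.inl (g i))
      (fun j => rename Sum.inr (h j))) := by
    intro F hF
    have hF' : ∀ x ∈ V, ∀ y ∈ W,
        aeval (Sum.elim (fun i => aeval x (g i)) (fun j => aeval y (h j))) F = 0 := by
      intro x hx y hy
      rw [← hF _ (elim_mem_prodSet.mpr ⟨hx, hy⟩)]
      congr 2
      ext i
      cases i <;> simp [aeval_rename]
    have h1 : ∀ x ∈ V, sliceRight F (fun i => aeval x (g i)) = 0 := fun x hx =>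
      hh _ fun y hy => by rw [aeval_sliceRight]; exact hF' x hx y hy
    -- coefficientwise in the second group of variables
    let e := sumAlgEquiv K (Fin (zdim K W)) (Fin (zdim K V))
    let G := rename (Equiv.sumComm _ _) F
    have h2 : e G = 0 := by
      ext1 m
      rw [coeff_zero]
      refine hg _ fun x hx => ?_
      have h3 : MvPolynomial.map (aeval (fun i => aeval x (g i)) :
          MvPolynomial (Fin (zdim K V)) K →ₐ[K] K).toRingHom (e G) =
          sliceRight F (fun i => aeval x (g i)) := by
        have : ((mapAlgHom (aeval (fun i => aeval x (g i)) :
          MvPolynomial (Fin (zdim K V)) K →ₐ[K] K)).comp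
            e.toAlgHom).comp (rename (Equiv.sumComm _ _)) =
          aeval (Sum.elim (fun s => C (aeval x (g s))) X) := by
          ext i
          cases i <;> simp [e, sumAlgEquiv_X_inl, sumAlgEquiv_X_inr]
        exact DFunLike.congr_fun this F
      have h4 := congrArg (coeff m) h3
      rw [h1 x hx, coeff_zero, coeff_map] at h4
      exact h4
    have h5 : G = 0 := by simpa using h2
    exact (map_eq_zero_iff _ (rename_injective _ (Equiv.injective _))).mp h5
  simpa using this.card_le_zdim (hV.prod hW)

end Product

section Alg

variable [IsAlgClosed K]

theorem zdim_univ [Fintype σ] : zdim K (Set.univ : Set (σ → K)) = Fintype.card σ := by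
  refine le_antisymm zdim_le_card ?_
  have : IndepOn K (Set.univ : Set (σ → K)) X := fun F hF => MvPolynomial.funext fun x => by
    simpa [aeval_eq_eval] using hF x trivial
  simpa using this.card_le_zdim zirred_univ

theorem zdim_eq_zero_of_finite [Finite σ] {V : Set (σ → K)} (hV : ZIrred K V) (hfin : V.Finite) :
    zdim K V = 0 := by
  obtain ⟨g, hg⟩ := exists_indepOn hV
  by_contra hne
  let i : Fin (zdim K V) := ⟨0, Nat.pos_of_ne_zero hne⟩
  have := hg (∏ x ∈ hfin.toFinset, (X i - C (aeval x (g i)))) fun y hy => by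
    rw [map_prod]
    refine Finset.prod_eq_zero (hfin.mem_toFinset.mpr hy) ?_
    simp
  rw [Finset.prod_eq_zero_iff] at this
  obtain ⟨x, -, hx⟩ := this
  have h1 := congrArg (aeval (fun _ => aeval x (g i) + 1 : Fin (zdim K V) → K)) hx
  simp at h1

/-- A set of points of affine space is locally closed over `K` if each of its points has a
principal open neighbourhood in its closure. -/
def LocClosed (E : Set (σ → K)) : Prop :=
  ∀ x ∈ E, ∃ g : MvPolynomial σ K, aeval x g ≠ 0 ∧
    ∀ y ∈ zeroLocus K (vanishingIdeal K E), aeval y g ≠ 0 → y ∈ E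

/-- A set cut out by polynomial equations inside a set that is a union of principal open sets
is locally closed. -/
theorem LocClosed.of_forall {E : Set (σ → K)} (Z O : Set (MvPolynomial σ K))
    (h : ∀ x, x ∈ E ↔ (∀ f ∈ Z, aeval x f = 0) ∧ ∃ g ∈ O, aeval x g ≠ 0) : LocClosed E := by
  intro x hx
  obtain ⟨g, hgO, hg⟩ := ((h x).mp hx).2
  exact ⟨g, hg, fun y hy hgy => (h y).mpr ⟨fun f hf => hy f fun z hz => ((h z).mp hz).1 f hf,
    g, hgO, hgy⟩⟩

theorem LocClosed.preimage {E : Set (σ → K)} (hE : LocClosed E) (p : σ → MvPolynomial τ K) :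
    LocClosed (polyMap p ⁻¹' E) := by
  intro x hx
  obtain ⟨g, hg, h⟩ := hE _ hx
  refine ⟨aeval p g, by rwa [← aeval_polyMap], fun y hy hgy => ?_⟩
  refine h _ (fun f hf => ?_) (by rwa [aeval_polyMap])
  rw [aeval_polyMap]
  exact hy _ fun z hz => by rw [← aeval_polyMap]; exact hf _ hz

theorem LocClosed.inter {E F : Set (σ → K)} (hE : LocClosed E) (hF : LocClosed F) :
    LocClosed (E ∩ F) := by
  rintro x ⟨hx, hx'⟩
  obtain ⟨g, hg, h⟩ := hE x hx
  obtain ⟨g', hg', h'⟩ := hF x hx'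
  refine ⟨g * g', by rw [map_mul]; exact mul_ne_zero hg hg', fun y hy hgy => ?_⟩
  rw [map_mul] at hgy
  exact ⟨h y (zeroLocus_anti_mono (vanishingIdeal_anti_mono Set.inter_subset_left) hy)
      (left_ne_zero_of_mul hgy),
    h' y (zeroLocus_anti_mono (vanishingIdeal_anti_mono Set.inter_subset_right) hy)
      (right_ne_zero_of_mul hgy)⟩

theorem LocClosed.zeroLocus (I : Ideal (MvPolynomial σ K)) : LocClosed (zeroLocus K I) :=
  LocClosed.of_forall I {1} fun x => by simp

variable [Finite σ]

/-- The principal ideal theorem: the hypersurface section `f = 0` of an irreducible subset of a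
locally closed set has, through each of its points, an irreducible subset of codimension at most
one. -/
theorem exists_hypersurface_section {E S : Set (σ → K)} (hE : LocClosed E) (hSE : S ⊆ E)
    (hS : ZIrred K S) {x : σ → K} (hx : x ∈ S) {f : MvPolynomial σ K} (hf : aeval x f = 0) :
    ∃ W ⊆ E, x ∈ W ∧ ZIrred K W ∧ vanishingIdeal K S ≤ vanishingIdeal K W ∧
      f ∈ vanishingIdeal K W ∧ zdim K S ≤ zdim K W + 1 := by
  by_cases hfS : f ∈ vanishingIdeal K S
  · exact ⟨S, hSE, hx, hS, le_rfl, hfS, Nat.le_succ _⟩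
  have hSp : (vanishingIdeal K S).IsPrime := hS
  let P := vanishingIdeal K S
  let A := MvPolynomial σ K ⧸ P
  let π := Ideal.Quotient.mk P
  have hf0 : π f ≠ 0 := by rwa [Ne, Ideal.Quotient.eq_zero_iff_mem]
  have hPx : P ≤ vanishingIdeal K {x} := vanishingIdeal_anti_mono (Set.singleton_subset_iff.mpr hx)
  have hπ : Function.Surjective π := Ideal.Quotient.mk_surjective
  have hker : RingHom.ker π ≤ vanishingIdeal K {x} := by rwa [Ideal.mk_ker]
  have hm : ((vanishingIdeal K {x}).map π).IsPrime := Ideal.map_isPrime_of_surjective hπ hker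
  -- a minimal prime over `f` in the coordinate ring of `S` that is contained in the ideal of `x`
  obtain ⟨q, hq, hqx⟩ := Ideal.exists_minimalPrimes_le (I := Ideal.span {π f})
    (J := (vanishingIdeal K {x}).map π) (by
      rw [Ideal.span_singleton_le_iff_mem]
      exact Ideal.mem_map_of_mem π ((mem_vanishingIdeal_singleton_iff x f).mpr hf))
  have hqp : q.IsPrime := hq.1.1
  have hd := trdeg_le_trdeg_quotient_add_one (K := K) hf0 hq
  let Q := q.comap π
  have hQp : Q.IsPrime := Ideal.IsPrime.comap _
  have hPQ : P ≤ Q := by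
    intro g hg
    change π g ∈ q
    rw [Ideal.Quotient.eq_zero_iff_mem.mpr hg]
    exact q.zero_mem
  have hQx : Q ≤ vanishingIdeal K {x} := by
    have := Ideal.comap_mono (f := π) hqx
    rwa [Ideal.comap_map_of_surjective' π hπ, sup_eq_left.mpr hker] at this
  have hfQ : f ∈ Q := hq.1.2 (Ideal.mem_span_singleton_self _)
  have hIQ : vanishingIdeal K (MvPolynomial.zeroLocus K Q) = Q :=
    IsPrime.vanishingIdeal_zeroLocus Q
  have hQirr : ZIrred K (MvPolynomial.zeroLocus K Q) := by unfold ZIrred; rwa [hIQ]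
  have hxQ : x ∈ MvPolynomial.zeroLocus K Q := fun g hg => hQx hg x rfl
  obtain ⟨g, hgx, hg⟩ := hE x (hSE hx)
  let W := {y ∈ MvPolynomial.zeroLocus K Q | aeval y g ≠ 0}
  have hIW : vanishingIdeal K W = Q := by
    rw [hQirr.vanishingIdeal_inter ⟨x, hxQ, hgx⟩, hIQ]
  refine ⟨W, fun y hy => hg y ?_ hy.2, ⟨hxQ, hgx⟩, ?_, ?_, ?_, ?_⟩
  · exact zeroLocus_anti_mono ((vanishingIdeal_anti_mono hSE).trans hPQ) hy.1
  · unfold ZIrred; rwa [hIW]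
  · rwa [hIW]
  · rwa [hIW]
  · have he : Algebra.trdeg K (A ⧸ q) ≤ Algebra.trdeg K (MvPolynomial σ K ⧸ Q) :=
      trdeg_le_of_surjective (Ideal.Quotient.liftₐ Q
        ((Ideal.Quotient.mkₐ K q).comp (Ideal.Quotient.mkₐ K P))
        fun a ha => Ideal.Quotient.eq_zero_iff_mem.mpr ha) fun b => by
          obtain ⟨b, rfl⟩ := Ideal.Quotient.mk_surjective b
          obtain ⟨b, rfl⟩ := hπ b
          exact ⟨Ideal.Quotient.mk Q b, rfl⟩
    have h2 : Algebra.trdeg K A ≤ Algebra.trdeg K (MvPolynomial σ K ⧸ Q) + 1 := by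
      refine hd.trans ?_
      gcongr
    have hfin := trdeg_quotient_lt_aleph0 (K := K) Q
    have h3 := Cardinal.toNat_le_toNat h2 (Cardinal.add_lt_aleph0 hfin Cardinal.one_lt_aleph0)
    rw [Cardinal.toNat_add hfin Cardinal.one_lt_aleph0, Cardinal.one_toNat] at h3
    unfold zdim
    rw [hIW]
    exact h3

/-- Iterating `exists_hypersurface_section`: a finite family of equations lowers the dimension by
at most the number of equations. -/
theorem exists_section {E S : Set (σ → K)} (hE : LocClosed E) (hSE : S ⊆ E)
    (hS : ZIrred K S) {x : σ → K} (hx : x ∈ S) {ι : Type} [Fintype ι] {f : ι → MvPolynomial σ K}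
    (hf : ∀ i, aeval x (f i) = 0) :
    ∃ W ⊆ E, x ∈ W ∧ ZIrred K W ∧ vanishingIdeal K S ≤ vanishingIdeal K W ∧
      (∀ i, f i ∈ vanishingIdeal K W) ∧ zdim K S ≤ zdim K W + Fintype.card ι := by
  classical
  suffices h : ∀ s : Finset ι, ∃ W ⊆ E, x ∈ W ∧ ZIrred K W ∧
      vanishingIdeal K S ≤ vanishingIdeal K W ∧
      (∀ i ∈ s, f i ∈ vanishingIdeal K W) ∧ zdim K S ≤ zdim K W + s.card by
    obtain ⟨W, h1, h2, h3, h4, h5, h6⟩ := h Finset.univ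
    exact ⟨W, h1, h2, h3, h4, fun i => h5 i (Finset.mem_univ i), h6⟩
  intro s
  induction s using Finset.induction_on with
  | empty => exact ⟨S, hSE, hx, hS, le_rfl, by simp, by simp⟩
  | insert a s ha ih =>
    obtain ⟨W, h1, h2, h3, h4, h5, h6⟩ := ih
    obtain ⟨W', h1', h2', h3', h4', h5', h6'⟩ := exists_hypersurface_section hE h1 h3 h2 (hf a)
    refine ⟨W', h1', h2', h3', h4.trans h4', fun i hi => ?_, ?_⟩
    · rcases Finset.mem_insert.mp hi with rfl | hi
      · exact h5'
      · exact h4' (h5 i hi)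
    · rw [Finset.card_insert_of_notMem ha]; omega

variable [Finite τ]

/-- Every fibre of a polynomial map on an irreducible set has, through each of its points, an
irreducible subset whose dimension is at least the difference of the dimensions of the source and
of the image. -/
theorem exists_fibre {E : Set (σ → K)} (hE : LocClosed E) (p : τ → MvPolynomial σ K) {x : σ → K}
    {S : Set (σ → K)} (hSE : S ⊆ E) (hS : ZIrred K S) (hx : x ∈ S) :
    ∃ W ⊆ E, x ∈ W ∧ ZIrred K W ∧ vanishingIdeal K S ≤ vanishingIdeal K W ∧
      (∀ y ∈ W, polyMap p y = polyMap p x) ∧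
      zdim K S ≤ zdim K W + zdim K (polyMap p '' S) := by
  induction hd : zdim K (polyMap p '' S) using Nat.strong_induction_on generalizing S with
  | _ d ih =>
    by_cases hc : ∀ y ∈ S, polyMap p y = polyMap p x
    · exact ⟨S, hSE, hx, hS, le_rfl, hc, Nat.le_add_right _ _⟩
    push Not at hc
    obtain ⟨y, hy, hne⟩ := hc
    obtain ⟨t, ht⟩ := Function.ne_iff.mp hne
    -- cutting with a level set of the nonconstant component `p t` lowers both dimensions
    obtain ⟨S', h1, h2, h3, h4, h5, h6⟩ := exists_hypersurface_section hE hSE hS hx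
      (f := p t - C (polyMap p x t)) (by simp [polyMap])
    have hlt : vanishingIdeal K (polyMap p '' S) < vanishingIdeal K (polyMap p '' S') := by
      refine lt_of_le_of_ne (vanishingIdeal_image_anti p h4) fun he => ?_
      have : X t - C (polyMap p x t) ∈ vanishingIdeal K (polyMap p '' S) := by
        rw [he]
        rintro _ ⟨z, hz, rfl⟩
        simpa [polyMap] using h5 z hz
      have := this _ ⟨y, hy, rfl⟩
      simp only [map_sub, aeval_X, aeval_C, Algebra.algebraMap_self, RingHom.id_apply] at this
      exact ht (sub_eq_zero.mp this)
    have hlt' := zdim_strictAnti (hS.image p) (h3.image p) hlt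
    obtain ⟨W, hW1, hW2, hW3, hWI, hW4, hW5⟩ := ih _ (hd ▸ hlt') h1 h3 h2 rfl
    exact ⟨W, hW1, hW2, hW3, h4.trans hWI, hW4, by omega⟩

theorem zdim_le_of_fibre_le {E : Set (σ → K)} (hE : LocClosed E) (p : τ → MvPolynomial σ K) {c : ℕ}
    (hc : ∀ W ⊆ E, ZIrred K W → (∀ x ∈ W, ∀ y ∈ W, polyMap p x = polyMap p y) → zdim K W ≤ c)
    {S : Set (σ → K)} (hSE : S ⊆ E) (hS : ZIrred K S) :
    zdim K S ≤ zdim K (polyMap p '' S) + c := by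
  obtain ⟨x, hx⟩ := hS.nonempty
  obtain ⟨W, h1, h2, h3, -, h4, h5⟩ := exists_fibre hE p hSE hS hx
  have := hc W h1 h3 fun y hy z hz => (h4 y hy).trans (h4 z hz).symm
  omega

/-- The product of two irreducible sets has the expected dimension. -/
theorem zdim_prod {V : Set (σ → K)} {W : Set (τ → K)} (hV : ZIrred K V)
    (hW : ZIrred K W) : zdim K (prodSet V W) = zdim K V + zdim K W := by
  refine le_antisymm ?_ (zdim_prod_ge hV hW)
  let E : Set (σ ⊕ τ → K) := MvPolynomial.zeroLocus K (vanishingIdeal K (prodSet V W))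
  have hE : LocClosed E := LocClosed.zeroLocus _
  let p : σ → MvPolynomial (σ ⊕ τ) K := fun s => X (Sum.inl s)
  have hp : ∀ (x : σ → K) (y : τ → K), polyMap p (Sum.elim x y) = x := fun x y => by ext s; simp [p, polyMap]
  have himg : zdim K (polyMap p '' prodSet V W) ≤ zdim K V := by
    refine zdim_mono ((hV.prod hW).image p) hV ?_
    rintro _ ⟨z, hz, rfl⟩
    obtain ⟨x, y, rfl⟩ := exists_elim_eq z
    rw [hp]
    exact (elim_mem_prodSet.mp hz).1
  refine (zdim_le_of_fibre_le hE p (c := zdim K W) ?_ (zeroLocus_vanishingIdeal_le _)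
    (hV.prod hW)).trans (by omega)
  intro S hSE hS hc
  obtain ⟨z, hz⟩ := hS.nonempty
  obtain ⟨x, y, rfl⟩ := exists_elim_eq z
  -- the fibre is the image of a subset of the closure of `W`
  let W' := MvPolynomial.zeroLocus K (vanishingIdeal K W)
  have hIW' : vanishingIdeal K W' = vanishingIdeal K W := vanishingIdeal_closure W
  let i : σ ⊕ τ → MvPolynomial τ K := Sum.elim (fun s => C (x s)) X
  have hi : ∀ w : τ → K, polyMap i w = Sum.elim x w := fun w => by
    ext s; cases s <;> simp [i, polyMap]
  have hW' : ZIrred K W' := hW.of_vanishingIdeal_eq hIW'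
  rw [← zdim_congr hIW']
  refine (zdim_mono hS (hW'.image i) ?_).trans (zdim_image_le hW' i)
  intro z' hz'
  obtain ⟨x', y', rfl⟩ := exists_elim_eq z'
  have hx' : x' = x := by simpa [hp] using hc _ hz' _ hz
  refine ⟨y', fun f hf => ?_, by rw [hi, hx']⟩
  have := hSE hz' (rename (Sum.inr : τ → σ ⊕ τ) f) fun u hu => by
    rw [aeval_rename]
    exact hf _ hu.2
  simpa [aeval_rename] using this

end Alg

end Geometry

/-! ### Torus actions -/

section Torus

open MvPolynomial

set_option linter.unusedSectionVars false

variable {k K : Type*} [Field k] [Field K] [Algebra k K] {ι σ τ : Type} [Fintype ι]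

/-- The linear action of the torus `(Kˣ)^ι` on affine space for which the coordinate `s` has
weight `w s`. -/
def torusAct (w : σ → ι → ℤ) (t : ι → Kˣ) (x : σ → K) : σ → K :=
  fun s => ((∏ i, t i ^ w s i : Kˣ) : K) * x s

/-- The union of the torus orbits that meet `V`. -/
def torusSat (w : σ → ι → ℤ) (V : Set (σ → K)) : Set (σ → K) :=
  {y | ∃ t : ι → Kˣ, ∃ x ∈ V, y = torusAct w t x}

variable (w : σ → ι → ℤ)

theorem torusAct_one (x : σ → K) : torusAct w 1 x = x := by
  ext s; simp [torusAct]

theorem torusAct_mul (t u : ι → Kˣ) (x : σ → K) :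
    torusAct w (t * u) x = torusAct w t (torusAct w u x) := by
  ext s; simp [torusAct, mul_zpow, Finset.prod_mul_distrib, mul_assoc]

theorem torusAct_apply_of_single [DecidableEq ι] {s : σ} {i : ι} (h : w s = Pi.single i 1)
    (t : ι → Kˣ) (x : σ → K) : torusAct w t x s = t i * x s := by
  unfold torusAct
  rw [h, Finset.prod_eq_single i]
  · simp
  · intro j _ hj; simp [Pi.single_eq_of_ne hj]
  · simp

theorem torusAct_apply_of_zero {s : σ} (h : w s = 0) (t : ι → Kˣ) (x : σ → K) :
    torusAct w t x s = x s := by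
  simp [torusAct, h]

theorem subset_torusSat (V : Set (σ → K)) : V ⊆ torusSat w V :=
  fun x hx => ⟨1, x, hx, (torusAct_one w x).symm⟩

/-- The character of the torus with exponents `m`. -/
def torusChar (K : Type*) [Field K] (m : ι → ℤ) : (ι → Kˣ) →* K where
  toFun t := ((∏ i, t i ^ m i : Kˣ) : K)
  map_one' := by simp
  map_mul' t u := by simp [mul_zpow, Finset.prod_mul_distrib]

/-- The universal evaluation of a polynomial along torus orbits, as a Laurent polynomial in the
torus variables. -/
def orbitPoly : MvPolynomial σ k →ₐ[k] AddMonoidAlgebra (MvPolynomial σ k) (ι → ℤ) :=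
  aeval (fun s => AddMonoidAlgebra.single (w s) (X s))

/-- The component of weight `m` of a polynomial. -/
def weightPart (m : ι → ℤ) (f : MvPolynomial σ k) : MvPolynomial σ k := (orbitPoly w f).coeff m

/-- The restriction of a polynomial function to the torus orbit of `x`. -/
def orbitFun (x : σ → K) : MvPolynomial σ k →ₐ[k] AddMonoidAlgebra K (ι → ℤ) :=
  aeval (fun s => AddMonoidAlgebra.single (w s) (x s))

theorem orbitFun_coeff (x : σ → K) (f : MvPolynomial σ k) (m : ι → ℤ) :
    (orbitFun w x f).coeff m = aeval x (weightPart w m f) := by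
  have h : (AddMonoidAlgebra.mapRingHom (ι → ℤ) (aeval x : MvPolynomial σ k →ₐ[k] K).toRingHom).comp
      (orbitPoly w : MvPolynomial σ k →ₐ[k] _).toRingHom =
      (orbitFun w x : MvPolynomial σ k →ₐ[k] _).toRingHom := by
    refine MvPolynomial.ringHom_ext (fun r => ?_) fun s => ?_
    · simp [orbitPoly, orbitFun]
    · simp [orbitPoly, orbitFun]
  have h1 := congrArg (fun F : AddMonoidAlgebra K (ι → ℤ) => F.coeff m) (RingHom.congr_fun h f)
  simp only [RingHom.comp_apply] at h1
  rw [weightPart]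
  erw [← h1]
  simp

/-- Evaluation of a Laurent polynomial at a point of the torus. -/
def evalTorus (t : ι → Kˣ) : AddMonoidAlgebra K (ι → ℤ) →ₐ[K] K :=
  AddMonoidAlgebra.lift K K (ι → ℤ)
    { toFun := fun m => torusChar K m.toAdd t
      map_one' := by simp [torusChar]
      map_mul' := fun a b => by simp [torusChar, zpow_add, Finset.prod_mul_distrib] }

theorem evalTorus_single (t : ι → Kˣ) (m : ι → ℤ) (c : K) :
    evalTorus t (AddMonoidAlgebra.single m c) = c * torusChar K m t := by
  simp [evalTorus]

theorem evalTorus_orbitFun (t : ι → Kˣ) (x : σ → K) (f : MvPolynomial σ k) :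
    evalTorus t (orbitFun w x f) = aeval (torusAct w t x) f := by
  have h : ((evalTorus t).restrictScalars k).comp (orbitFun w x : MvPolynomial σ k →ₐ[k] _) =
      aeval (torusAct w t x) := by
    ext s
    simp only [AlgHom.comp_apply, orbitFun, aeval_X, AlgHom.restrictScalars_apply,
      evalTorus_single]
    rw [mul_comm]
    rfl
  exact DFunLike.congr_fun h f

theorem exists_unit_zpow_ne [Infinite K] {d : ℤ} (hd : d ≠ 0) : ∃ u : Kˣ, u ^ d ≠ 1 := by
  obtain ⟨a, ha⟩ : ∃ a : K, a * (a ^ d.natAbs - 1) ≠ 0 := by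
    by_contra! h
    have h0 : (Polynomial.X * (Polynomial.X ^ d.natAbs - 1) : Polynomial K) = 0 :=
      Polynomial.funext fun a => by simpa using h a
    rcases mul_eq_zero.mp h0 with h1 | h1
    · exact Polynomial.X_ne_zero h1
    · exact (Polynomial.X_pow_sub_C_ne_zero (Int.natAbs_pos.mpr hd) (1 : K))
        (by rwa [Polynomial.C_1])
  have ha0 : a ≠ 0 := left_ne_zero_of_mul ha
  refine ⟨Units.mk0 a ha0, fun h => right_ne_zero_of_mul ha (sub_eq_zero.mpr ?_)⟩
  have h2 : Units.mk0 a ha0 ^ d.natAbs = 1 := by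
    rcases Int.natAbs_eq d with he | he
    · rw [he] at h; simpa using h
    · rw [he] at h; simpa using h
  simpa using congrArg Units.val h2

theorem torusChar_injective [Infinite K] : Function.Injective (torusChar (ι := ι) K) := by
  classical
  intro m m' h
  ext i
  by_contra hne
  obtain ⟨u, hu⟩ := exists_unit_zpow_ne (K := K) (sub_ne_zero.mpr hne)
  apply hu
  have h1 := DFunLike.congr_fun h (Pi.mulSingle i u)
  have h2 : ∀ m : ι → ℤ, torusChar K m (Pi.mulSingle i u) = ((u ^ m i : Kˣ) : K) := by
    intro m
    simp only [torusChar, MonoidHom.coe_mk, OneHom.coe_mk]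
    rw [Finset.prod_eq_single i]
    · rw [Pi.mulSingle_eq_same]
    · intro j _ hj; rw [Pi.mulSingle_eq_of_ne hj, one_zpow]
    · simp
  rw [h2, h2, Units.val_inj] at h1
  rw [zpow_sub, h1, mul_inv_cancel]

/-- A Laurent polynomial that vanishes on the torus is zero, by Dedekind's independence of
characters. -/
theorem eq_zero_of_evalTorus [Infinite K] {F : AddMonoidAlgebra K (ι → ℤ)}
    (h : ∀ t, evalTorus t F = 0) : F = 0 := by
  have hli := (linearIndependent_monoidHom (ι → Kˣ) K).comp (torusChar K)
    (torusChar_injective (ι := ι))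
  have := (linearIndependent_iff.mp hli) F.coeff <| by
    ext t
    have := h t
    rw [evalTorus, AddMonoidAlgebra.lift_apply] at this
    simpa [Finsupp.linearCombination_apply, Finsupp.sum, Finset.sum_apply] using this
  ext m
  simp [this]

theorem exists_torusAct_ne_iff [Infinite K] {x : σ → K} {f : MvPolynomial σ k} :
    (∃ t, aeval (torusAct w t x) f ≠ 0) ↔ orbitFun w x f ≠ 0 := by
  constructor
  · rintro ⟨t, ht⟩ h0
    rw [← evalTorus_orbitFun, h0, map_zero] at ht
    exact ht rfl
  · intro h
    by_contra! hc
    exact h (eq_zero_of_evalTorus fun t => by rw [evalTorus_orbitFun, hc])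

theorem orbitFun_ne_zero_iff {x : σ → K} {f : MvPolynomial σ k} :
    orbitFun w x f ≠ 0 ↔ ∃ m, aeval x (weightPart w m f) ≠ 0 := by
  simp only [← orbitFun_coeff]
  constructor
  · intro h
    by_contra! hc
    exact h (by ext m; simp [hc])
  · rintro ⟨m, hm⟩ h0
    rw [h0] at hm
    simp at hm

/-- The ideal of the saturation of `V` consists of the polynomials all of whose weight components
vanish on `V`. -/
theorem mem_vanishingIdeal_torusSat [Infinite K] {V : Set (σ → K)} {f : MvPolynomial σ k} :
    f ∈ vanishingIdeal k (torusSat w V) ↔ ∀ m, weightPart w m f ∈ vanishingIdeal k V := by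
  constructor
  · intro hf m x hx
    by_contra hm
    obtain ⟨t, ht⟩ := (exists_torusAct_ne_iff w).mpr ((orbitFun_ne_zero_iff w).mpr ⟨m, hm⟩)
    exact ht (hf _ ⟨t, x, hx, rfl⟩)
  · rintro hf _ ⟨t, x, hx, rfl⟩
    by_contra h
    obtain ⟨m, hm⟩ := (orbitFun_ne_zero_iff w).mp ((exists_torusAct_ne_iff w).mp ⟨t, h⟩)
    exact hm (hf m x hx)

/-- Torus orbits are irreducible. -/
theorem exists_torusAct_ne_and_ne [Infinite K] {x : σ → K} {f g : MvPolynomial σ k}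
    (hf : orbitFun w x f ≠ 0) (hg : orbitFun w x g ≠ 0) :
    ∃ t, aeval (torusAct w t x) f ≠ 0 ∧ aeval (torusAct w t x) g ≠ 0 := by
  obtain ⟨t, ht⟩ := (exists_torusAct_ne_iff w).mpr (show orbitFun w x (f * g) ≠ 0 by
    rw [map_mul]; exact mul_ne_zero hf hg)
  rw [map_mul] at ht
  exact ⟨t, left_ne_zero_of_mul ht, right_ne_zero_of_mul ht⟩

/-- Saturation under a torus preserves irreducibility over the small field `k`. -/
theorem ZIrred.torusSat [Infinite K] {V : Set (σ → K)} (hV : ZIrred k V) :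
    ZIrred k (torusSat w V) := by
  refine zirred_iff.mpr ⟨hV.nonempty.mono (subset_torusSat w V), ?_⟩
  rintro f g ⟨_, ⟨t, x, hx, rfl⟩, hf⟩ ⟨_, ⟨u, y, hy, rfl⟩, hg⟩
  obtain ⟨m, hm⟩ := (orbitFun_ne_zero_iff w).mp ((exists_torusAct_ne_iff w).mp ⟨t, hf⟩)
  obtain ⟨n, hn⟩ := (orbitFun_ne_zero_iff w).mp ((exists_torusAct_ne_iff w).mp ⟨u, hg⟩)
  obtain ⟨z, hz, h1, h2⟩ := (zirred_iff.mp hV).2 _ _ ⟨x, hx, hm⟩ ⟨y, hy, hn⟩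
  obtain ⟨v, h3, h4⟩ := exists_torusAct_ne_and_ne w ((orbitFun_ne_zero_iff w).mpr ⟨m, h1⟩)
    ((orbitFun_ne_zero_iff w).mpr ⟨n, h2⟩)
  exact ⟨_, ⟨v, z, hz, rfl⟩, h3, h4⟩

/-- The closure over `k` of a torus invariant set is torus invariant. -/
theorem torusAct_mem_closure [Infinite K] {V : Set (σ → K)} (hV : torusSat w V ⊆ V) {x : σ → K}
    (hx : x ∈ zeroLocus K (vanishingIdeal k V)) (t : ι → Kˣ) :
    torusAct w t x ∈ zeroLocus K (vanishingIdeal k V) := by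
  intro f hf
  by_contra h
  obtain ⟨m, hm⟩ := (orbitFun_ne_zero_iff w).mp ((exists_torusAct_ne_iff w).mp ⟨t, h⟩)
  exact hm (hx _ ((mem_vanishingIdeal_torusSat w).mp (vanishingIdeal_anti_mono hV hf) m))

/-- Saturation under a torus of rank `r` adds at least `r` to the dimension of the projection to
the coordinates of weight zero, if the torus acts freely at some point. -/
theorem zdim_torusSat_ge [IsAlgClosed K] [Finite σ] [Finite τ] [DecidableEq ι] {V : Set (σ → K)}
    (hV : ZIrred K V) {j : τ → σ} (hj : ∀ t, w (j t) = 0) {s : ι → σ}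
    (hs : ∀ i, w (s i) = Pi.single i 1) (hx : ∃ x ∈ V, ∀ i, x (s i) ≠ 0) :
    Fintype.card ι + zdim K (polyMap (fun t => (X (j t) : MvPolynomial σ K)) '' V) ≤
      zdim K (torusSat w V) := by
  classical
  let p : τ → MvPolynomial σ K := fun t => X (j t)
  let f : MvPolynomial σ K := ∏ i, X (s i)
  have hf : ∀ x : σ → K, aeval x f ≠ 0 ↔ ∀ i, x (s i) ≠ 0 := fun x => by
    simp [f, map_prod, Finset.prod_ne_zero_iff]
  -- the coordinates of weight zero and the `s i`, which the torus moves independently, map the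
  -- saturation onto a set that contains `(Kˣ)^ι` times the projection of a dense open part of `V`
  let V' := {x ∈ V | aeval x f ≠ 0}
  have hIV' : vanishingIdeal K V' = vanishingIdeal K V := by
    obtain ⟨x, hx, hxs⟩ := hx
    exact hV.vanishingIdeal_inter ⟨x, hx, (hf x).mpr hxs⟩
  have hV' : ZIrred K V' := hV.of_vanishingIdeal_eq hIV'
  have hIp : vanishingIdeal K (polyMap p '' V') = vanishingIdeal K (polyMap p '' V) := by
    rw [vanishingIdeal_image, vanishingIdeal_image, hIV']
  let g : MvPolynomial ι K := ∏ i, X i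
  have hg : ∀ x : ι → K, aeval x g ≠ 0 ↔ ∀ i, x i ≠ 0 := fun x => by
    simp [g, map_prod, Finset.prod_ne_zero_iff]
  let O : Set (ι → K) := {x ∈ Set.univ | aeval x g ≠ 0}
  have hI_open : vanishingIdeal K O = vanishingIdeal K (Set.univ : Set (ι → K)) :=
    (zirred_univ (k := K)).vanishingIdeal_inter ⟨1, trivial, (hg 1).mpr fun i => one_ne_zero⟩
  have hO : ZIrred K O := (zirred_univ (k := K)).of_vanishingIdeal_eq hI_open
  have hOd : zdim K O = Fintype.card ι := by rw [zdim_congr hI_open, zdim_univ]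
  rw [← zdim_congr hIp, ← hOd]
  refine (zdim_prod_ge hO (hV'.image p)).trans ?_
  let q : ι ⊕ τ → MvPolynomial σ K := Sum.elim (fun i => X (s i)) p
  refine (zdim_mono (hO.prod (hV'.image p)) ((hV.torusSat w).image q) ?_).trans
    (zdim_image_le (hV.torusSat w) q)
  rintro z ⟨hz, x, hx', hxz⟩
  have hxs := (hf x).mp hx'.2
  have hzs := (hg _).mp hz.2
  refine ⟨torusAct w (fun i => Units.mk0 (z (Sum.inl i)) (hzs i) / Units.mk0 _ (hxs i)) x,
    ⟨_, x, hx'.1, rfl⟩, ?_⟩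
  ext c
  rcases c with i | t
  · have h1 := hxs i
    simp only [polyMap, q, Sum.elim_inl, aeval_X, torusAct_apply_of_single w (hs i)]
    rw [Units.val_div_eq_div_val, Units.val_mk0, Units.val_mk0, div_mul_cancel₀ _ h1]
  · simp only [polyMap, q, Sum.elim_inr, p, aeval_X, torusAct_apply_of_zero w (hj t)]
    have := congrFun hxz t
    simpa [polyMap, p] using this

end Torus

/-! ### Quotients by torus actions and their Krull dimension -/

section Quotient

open MvPolynomial Topology

set_option linter.unusedSectionVars false

variable {k K : Type*} [Field k] [Field K] [Algebra k K] {ι σ τ : Type} [Fintype ι] [DecidableEq ι]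
  {H X : Type*} [TopologicalSpace X]

/-- The space `X` is the quotient of a torus invariant set of coordinate vectors in `K^σ`
by a torus that acts freely, with the quotient Zariski topology over `k`. Freeness is expressed by
coordinates on which the torus acts through each of its factors. -/
structure TorusQuotient (k : Type*) [Field k] [Algebra k K] (w : σ → ι → ℤ) (coord : H → σ → K)
    (q : H → X) : Prop where
  surj : Function.Surjective q
  eq_iff : ∀ a b, q a = q b ↔ ∃ t, coord b = torusAct w t (coord a)
  act_mem : ∀ a t, ∃ b, coord b = torusAct w t (coord a)
  free : ∀ a i, ∃ s, w s = Pi.single i 1 ∧ coord a s ≠ 0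
  top_eq : (inferInstance : TopologicalSpace X) = quotientZariski k K coord q

/-- The set of coordinate vectors of the points of a set `S`. -/
def liftSet (coord : H → σ → K) (q : H → X) (S : Set X) : Set (σ → K) := coord '' (q ⁻¹' S)

theorem isOpen_affineZariski_iff {U : Set (σ → K)} :
    IsOpen[affineZariski k K σ] U ↔
      ∀ x ∈ U, ∃ f : MvPolynomial σ k, aeval x f ≠ 0 ∧ ∀ y, aeval y f ≠ 0 → y ∈ U := by
  constructor
  · intro hU
    induction hU with
    | basic U h =>
      obtain ⟨f, rfl⟩ := h
      exact fun x hx => ⟨f, hx, fun y hy => hy⟩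
    | univ => exact fun x _ => ⟨1, by simp, fun y _ => trivial⟩
    | inter U V _ _ hU hV =>
      rintro x ⟨h1, h2⟩
      obtain ⟨f, hf, hf'⟩ := hU x h1
      obtain ⟨g, hg, hg'⟩ := hV x h2
      refine ⟨f * g, by rw [map_mul]; exact mul_ne_zero hf hg, fun y hy => ?_⟩
      rw [map_mul] at hy
      exact ⟨hf' y (left_ne_zero_of_mul hy), hg' y (right_ne_zero_of_mul hy)⟩
    | sUnion S _ ih =>
      rintro x ⟨U, hU, hx⟩
      obtain ⟨f, hf, hf'⟩ := ih U hU x hx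
      exact ⟨f, hf, fun y hy => ⟨U, hU, hf' y hy⟩⟩
  · intro h
    let _ := affineZariski k K σ
    refine isOpen_iff_forall_mem_open.mpr fun x hx => ?_
    obtain ⟨f, hf, hf'⟩ := h x hx
    exact ⟨{y | aeval y f ≠ 0}, hf', TopologicalSpace.GenerateOpen.basic _ ⟨f, rfl⟩, hf⟩

namespace TorusQuotient

variable {w : σ → ι → ℤ} {coord : H → σ → K} {q : H → X} (h : TorusQuotient k w coord q)

include h

theorem mem_liftSet {S : Set X} {a : H} : coord a ∈ liftSet coord q S ↔ q a ∈ S := by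
  constructor
  · rintro ⟨b, hb, he⟩
    have : q b = q a := (h.eq_iff b a).mpr ⟨1, by rw [torusAct_one, he]⟩
    exact this ▸ hb
  · exact fun ha => ⟨a, ha, rfl⟩

theorem torusAct_mem_liftSet {S : Set X} {x : σ → K} (hx : x ∈ liftSet coord q S) (t : ι → Kˣ) :
    torusAct w t x ∈ liftSet coord q S := by
  obtain ⟨a, ha, rfl⟩ := hx
  obtain ⟨b, hb⟩ := h.act_mem a t
  rw [← hb, h.mem_liftSet, ← (h.eq_iff a b).mpr ⟨t, hb⟩]
  exact ha

/-- The principal sets `f ≠ 0` detect open subsets of the quotient, although `f` is not assumed to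
be homogeneous. -/
theorem isOpen_iff {U : Set X} : IsOpen U ↔ ∀ a, q a ∈ U → ∃ f : MvPolynomial σ k,
    aeval (coord a) f ≠ 0 ∧ ∀ b, aeval (coord b) f ≠ 0 → q b ∈ U := by
  have h1 : IsOpen U ↔ ∃ V, IsOpen[affineZariski k K σ] V ∧ coord ⁻¹' V = q ⁻¹' U := by
    have := h.top_eq
    change (‹TopologicalSpace X› : TopologicalSpace X) = _ at this
    rw [this]
    rfl
  rw [h1]
  constructor
  · rintro ⟨V, hV, he⟩ a ha
    have ha' : a ∈ coord ⁻¹' V := he ▸ ha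
    obtain ⟨f, hf, hf'⟩ := isOpen_affineZariski_iff.mp hV _ ha'
    refine ⟨f, hf, fun b hb => ?_⟩
    have : b ∈ coord ⁻¹' V := hf' _ hb
    rwa [he] at this
  · intro hU
    refine ⟨{x | ∃ f : MvPolynomial σ k, aeval x f ≠ 0 ∧ ∀ b, aeval (coord b) f ≠ 0 → q b ∈ U},
      isOpen_affineZariski_iff.mpr ?_, ?_⟩
    · rintro x ⟨f, hf, hf'⟩
      exact ⟨f, hf, fun y hy => ⟨f, hy, hf'⟩⟩
    · ext a
      exact ⟨fun ⟨f, hf, hf'⟩ => hf' a hf, fun ha => hU a ha⟩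

section Infinite

variable [Infinite K]

theorem isOpen_basic (f : MvPolynomial σ k) : IsOpen {x | ∃ a, q a = x ∧ aeval (coord a) f ≠ 0} := by
  rw [h.isOpen_iff]
  rintro a ⟨b, hb, hf⟩
  obtain ⟨t, ht⟩ := (h.eq_iff a b).mp hb.symm
  obtain ⟨m, hm⟩ := (orbitFun_ne_zero_iff w).mp ((exists_torusAct_ne_iff w).mp ⟨t, ht ▸ hf⟩)
  refine ⟨weightPart w m f, hm, fun c hc => ?_⟩
  obtain ⟨u, hu⟩ := (exists_torusAct_ne_iff w).mpr ((orbitFun_ne_zero_iff w).mpr ⟨m, hc⟩)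
  obtain ⟨d, hd⟩ := h.act_mem c u
  exact ⟨d, ((h.eq_iff c d).mpr ⟨u, hd⟩).symm, hd ▸ hu⟩

theorem isIrreducible_iff {S : Set X} : IsIrreducible S ↔ ZIrred k (liftSet coord q S) := by
  rw [zirred_iff]
  constructor
  · rintro ⟨⟨x, hx⟩, hS⟩
    obtain ⟨a, rfl⟩ := h.surj x
    refine ⟨⟨_, a, hx, rfl⟩, ?_⟩
    rintro f g ⟨_, ⟨b, hb, rfl⟩, hf⟩ ⟨_, ⟨c, hc, rfl⟩, hg⟩
    obtain ⟨_, hz, ⟨d, rfl, hd⟩, e, he, he'⟩ := hS _ _ (h.isOpen_basic f) (h.isOpen_basic g)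
      ⟨q b, hb, b, rfl, hf⟩ ⟨q c, hc, c, rfl, hg⟩
    obtain ⟨t, ht⟩ := (h.eq_iff d e).mp he.symm
    obtain ⟨u, h1, h2⟩ := exists_torusAct_ne_and_ne w
      ((exists_torusAct_ne_iff w).mp ⟨1, by rwa [torusAct_one]⟩)
      ((exists_torusAct_ne_iff w).mp ⟨t, ht ▸ he'⟩)
    exact ⟨_, h.torusAct_mem_liftSet ⟨d, hz, rfl⟩ u, h1, h2⟩
  · rintro ⟨⟨_, a, ha, rfl⟩, hS⟩
    refine ⟨⟨q a, ha⟩, ?_⟩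
    rintro U V hU hV ⟨x, hxS, hx⟩ ⟨y, hyS, hy⟩
    obtain ⟨b, rfl⟩ := h.surj x
    obtain ⟨c, rfl⟩ := h.surj y
    obtain ⟨f, hf, hf'⟩ := h.isOpen_iff.mp hU b hx
    obtain ⟨g, hg, hg'⟩ := h.isOpen_iff.mp hV c hy
    obtain ⟨_, ⟨d, hd, rfl⟩, h1, h2⟩ := hS f g ⟨_, ⟨b, hxS, rfl⟩, hf⟩ ⟨_, ⟨c, hyS, rfl⟩, hg⟩
    exact ⟨q d, hd, hf' d h1, hg' d h2⟩

/-- The closure of a set in the quotient is computed by the ideal over `k` of its set of coordinate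
vectors. -/
theorem mem_closure_iff {S : Set X} {a : H} :
    q a ∈ closure S ↔ coord a ∈ zeroLocus K (vanishingIdeal k (liftSet coord q S)) := by
  rw [_root_.mem_closure_iff]
  constructor
  · intro hS f hf
    by_contra hne
    obtain ⟨_, ⟨b, rfl, hb⟩, hbS⟩ := hS _ (h.isOpen_basic f) ⟨a, rfl, hne⟩
    exact hb (hf _ ⟨b, hbS, rfl⟩)
  · intro ha U hU haU
    obtain ⟨f, hf, hf'⟩ := h.isOpen_iff.mp hU a haU
    by_contra hc
    refine hf (ha f ?_)
    rintro _ ⟨b, hb, rfl⟩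
    by_contra hne
    exact hc ⟨q b, hf' b hne, hb⟩

theorem isIrreducible_val_image {Y : Set X} {T : Set Y} :
    IsIrreducible T ↔ ZIrred k (liftSet coord q (Subtype.val '' T)) := by
  rw [← h.isIrreducible_iff]
  constructor
  · exact fun hT => hT.image _ continuous_subtype_val.continuousOn
  · rintro ⟨hne, hT⟩
    refine ⟨Set.image_nonempty.mp hne, ?_⟩
    rintro _ _ ⟨U, hU, rfl⟩ ⟨V, hV, rfl⟩ ⟨x, hx, hxU⟩ ⟨y, hy, hyV⟩
    obtain ⟨_, ⟨z, hz, rfl⟩, hzU, hzV⟩ := hT U V hU hV ⟨x, ⟨x, hx, rfl⟩, hxU⟩ ⟨y, ⟨y, hy, rfl⟩, hyV⟩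
    exact ⟨z, hz, hzU, hzV⟩

end Infinite

/-- Distinct torus orbits are separated by the zero set of a semi-invariant polynomial. -/
theorem exists_semiinvariant {a b : H} (hab : q a ≠ q b) : ∃ f : MvPolynomial σ K,
    (∀ (t : ι → Kˣ) (x : σ → K), aeval x f = 0 → aeval (torusAct w t x) f = 0) ∧
      aeval (coord a) f = 0 ∧ aeval (coord b) f ≠ 0 := by
  choose s hs hsb using h.free b
  by_cases ha : ∀ i, coord a (s i) ≠ 0
  · -- the functions `x_c ∏ x_{s i} ^ (- w c i)` are invariant and separate the two orbits
    obtain ⟨c, hc⟩ : ∃ c, coord a c * ∏ i, coord a (s i) ^ (- w c i) ≠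
        coord b c * ∏ i, coord b (s i) ^ (- w c i) := by
      by_contra! hall
      refine hab ((h.eq_iff a b).mpr
        ⟨fun i => Units.mk0 _ (hsb i) / Units.mk0 _ (ha i), funext fun c => ?_⟩)
      have h1 := hall c
      have hA : ∏ i, coord a (s i) ^ (w c i) ≠ 0 :=
        Finset.prod_ne_zero_iff.mpr fun i _ => zpow_ne_zero _ (ha i)
      have hB : ∏ i, coord b (s i) ^ (w c i) ≠ 0 :=
        Finset.prod_ne_zero_iff.mpr fun i _ => zpow_ne_zero _ (hsb i)
      simp only [zpow_neg, Finset.prod_inv_distrib] at h1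
      simp only [torusAct, Units.coe_prod, Units.val_zpow_eq_zpow_val, Units.val_div_eq_div_val,
        Units.val_mk0, div_zpow, Finset.prod_div_distrib]
      field_simp at h1 ⊢
      linear_combination -h1
    let P := fun i => (w c i).toNat
    let N := fun i => (- w c i).toNat
    let C0 := coord a c * ∏ i, coord a (s i) ^ (- w c i)
    have hPN : ∀ {y : ι → K} (_ : ∀ i, y i ≠ 0),
        ∏ i, y i ^ N i = (∏ i, y i ^ P i) * ∏ i, y i ^ (- w c i) := by
      intro y hy
      rw [← Finset.prod_mul_distrib]
      refine Finset.prod_congr rfl fun i _ => ?_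
      rw [← zpow_natCast, ← zpow_natCast, ← zpow_add₀ (hy i)]
      congr 1
      simp only [N, P]
      omega
    let f : MvPolynomial σ K :=
      MvPolynomial.X c * ∏ i, MvPolynomial.X (s i) ^ N i - C C0 * ∏ i, MvPolynomial.X (s i) ^ P i
    have hf : ∀ x, aeval x f = x c * ∏ i, x (s i) ^ N i - C0 * ∏ i, x (s i) ^ P i := by
      intro x
      simp [f, map_prod]
    have hf' : ∀ x : σ → K, (∀ i, x (s i) ≠ 0) → aeval x f =
        (∏ i, x (s i) ^ P i) * (x c * ∏ i, x (s i) ^ (- w c i) - C0) := by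
      intro x hx
      rw [hf, hPN hx]
      ring
    refine ⟨f, fun t x hx => ?_, ?_, ?_⟩
    · have h1 : aeval (torusAct w t x) f = (∏ i, (t i : K) ^ P i) * aeval x f := by
        rw [hf, hf]
        simp only [torusAct_apply_of_single w (hs _), mul_pow, Finset.prod_mul_distrib]
        rw [hPN (y := fun i => (t i : K)) fun i => (t i).ne_zero]
        simp only [torusAct, Units.coe_prod, Units.val_zpow_eq_zpow_val, zpow_neg,
          Finset.prod_inv_distrib]
        have hA : ∏ i, (t i : K) ^ (w c i) ≠ 0 :=
          Finset.prod_ne_zero_iff.mpr fun i _ => zpow_ne_zero _ (t i).ne_zero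
        field_simp
      rw [h1, hx, mul_zero]
    · rw [hf' _ ha, sub_self, mul_zero]
    · rw [hf' _ hsb]
      exact mul_ne_zero (Finset.prod_ne_zero_iff.mpr fun i _ => pow_ne_zero _ (hsb i))
        (sub_ne_zero.mpr hc.symm)
  · push Not at ha
    obtain ⟨i, hi⟩ := ha
    refine ⟨MvPolynomial.X (s i), fun t x hx => ?_, by simpa using hi, by simpa using hsb i⟩
    rw [aeval_X] at hx
    rw [aeval_X, torusAct_apply_of_single w (hs i), hx, mul_zero]

section Dimension

variable [IsAlgClosed K] [Algebra.IsAlgebraic k K] [Finite σ] [Finite τ]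

theorem card_le_zdim_torusSat {a : H} {V : Set (σ → K)} (hV : ZIrred K V) (ha : coord a ∈ V) :
    Fintype.card ι ≤ zdim K (torusSat w V) := by
  choose s hs hsa using h.free a
  refine le_trans (Nat.le_add_right _ _)
    (zdim_torusSat_ge w hV (τ := Empty) (j := fun t => t.elim) (fun t => t.elim) hs ⟨_, ha, hsa⟩)

/-- An upper bound for the Krull dimension of a subset of a torus quotient, in terms of a
parametrization of the set of its coordinate vectors. -/
theorem topologicalKrullDim_le {E : Set (τ → K)} {p : σ → MvPolynomial τ K}
    {Y : Set X} (hY : liftSet coord q Y ⊆ polyMap p '' E) {m : ℕ}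
    (hE : ∀ W ⊆ E, ZIrred K W → zdim K W ≤ Fintype.card ι + m) :
    topologicalKrullDim Y ≤ m := by
  -- along a chain of irreducible closed subsets, the dimensions of the sets of coordinate vectors
  -- increase strictly; they are at least the rank of the torus since these sets contain an orbit
  let L : TopologicalSpace.IrreducibleCloseds Y → Set (σ → K) := fun T =>
    liftSet coord q (Subtype.val '' (T : Set Y))
  have hL : ∀ T, ZIrred k (L T) := fun T => h.isIrreducible_val_image.mp T.isIrreducible
  have hmono : StrictMono fun T => zdim k (L T) := by
    intro T T' hT
    have hsub : L T ⊆ L T' := Set.image_mono (Set.preimage_mono (Set.image_mono hT.le))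
    refine zdim_strictAnti (hL T') (hL T) (lt_of_le_of_ne (vanishingIdeal_anti_mono hsub) ?_)
    intro he
    refine hT.not_ge fun y hy => ?_
    have hcl : y ∈ closure (T : Set Y) := by
      rw [closure_subtype]
      obtain ⟨a, ha⟩ := h.surj y.1
      rw [← ha, h.mem_closure_iff]
      change _ ∈ zeroLocus K (vanishingIdeal k (L T))
      rw [← he]
      exact zeroLocus_vanishingIdeal_le _ (h.mem_liftSet.mpr (ha ▸ ⟨y, hy, rfl⟩))
    rwa [T.isClosed.closure_eq] at hcl
  have hlow : ∀ T, Fintype.card ι ≤ zdim k (L T) := by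
    intro T
    obtain ⟨_, a, ha, rfl⟩ := (hL T).nonempty
    have hx : ZIrred K {coord a} := zirred_iff.mpr ⟨⟨_, rfl⟩, by
      rintro f g ⟨x, rfl, hf⟩ ⟨y, rfl, hg⟩
      exact ⟨_, rfl, hf, hg⟩⟩
    have h1 := hx.torusSat w
    refine (h.card_le_zdim_torusSat hx rfl).trans ((zdim_base (k := k) h1).symm.le.trans
      (zdim_mono h1.base (hL T) ?_))
    rintro _ ⟨t, _, rfl, rfl⟩
    exact h.torusAct_mem_liftSet ⟨a, ha, rfl⟩ t
  have hup : ∀ T, zdim k (L T) ≤ Fintype.card ι + m := by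
    intro T
    have : (vanishingIdeal k (L T)).IsPrime := hL T
    obtain ⟨W, hWE, hW, hWT⟩ := exists_zirred_subset_image_dense
      {e ∈ E | polyMap p e ∈ L T} (polyMap p) (vanishingIdeal k (L T))
      (vanishingIdeal_anti_mono fun x hx => by
        obtain ⟨e, he, rfl⟩ := hY (Set.image_mono (Set.preimage_mono (by simp)) hx)
        exact ⟨e, ⟨he, hx⟩, rfl⟩)
    refine (zdim_anti (hW.image p).base (hL T) hWT).trans ((zdim_base (hW.image p)).le.trans
      ((zdim_image_le hW p).trans (hE W (fun x hx => (hWE hx).1) hW)))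
  refine iSup_le fun l => ?_
  have h1 := (l.map _ hmono).head_add_length_le_nat
  have h2 := hlow l.head
  have h3 := hup l.last
  simp only [LTSeries.head_map, LTSeries.last_map, LTSeries.map_length] at h1
  exact_mod_cast (show l.length ≤ m by omega)

/-- A lower bound for the Krull dimension of a subset of a torus quotient, in terms of a
parametrization with finite fibres of the set of its coordinate vectors. -/
theorem le_topologicalKrullDim {E : Set (τ → K)} (hE : LocClosed E) {p : σ → MvPolynomial τ K}
    {Y : Set X} (hEY : ∀ e ∈ E, polyMap p e ∈ liftSet coord q Y)
    (hfin : ∀ x ∈ E, {y ∈ E | polyMap p y = polyMap p x}.Finite) {S : Set (τ → K)} (hSE : S ⊆ E)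
    (hS : ZIrred K S) {m : ℕ} (hm : Fintype.card ι + m ≤ zdim K S) :
    m ≤ topologicalKrullDim Y := by
  let T : Set (τ → K) → Set Y := fun S => {y | ∃ e ∈ S, ∃ a, coord a = polyMap p e ∧ q a = y}
  have hT : ∀ {S}, S ⊆ E → liftSet coord q (Subtype.val '' T S) = torusSat w (polyMap p '' S) := by
    intro S hSE
    ext x
    constructor
    · rintro ⟨b, ⟨y, ⟨e, he, a, ha, hay⟩, hyb⟩, rfl⟩
      obtain ⟨t, ht⟩ := (h.eq_iff a b).mp (hay.trans hyb)
      exact ⟨t, _, ⟨e, he, ha.symm⟩, ht⟩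
    · rintro ⟨t, _, ⟨e, he, rfl⟩, rfl⟩
      obtain ⟨a, ha, hae⟩ := hEY e (hSE he)
      rw [← hae]
      exact h.torusAct_mem_liftSet (h.mem_liftSet.mpr
        (show q a ∈ Subtype.val '' T S from ⟨⟨q a, ha⟩, ⟨e, he, a, hae, rfl⟩, rfl⟩)) t
  have hirr : ∀ {S}, S ⊆ E → ZIrred K S → ZIrred K (torusSat w (polyMap p '' S)) :=
    fun _ hS => (hS.image p).torusSat w
  have hTirr : ∀ {S}, S ⊆ E → ZIrred K S → IsIrreducible (T S) := fun hSE hS =>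
    h.isIrreducible_val_image.mpr (by rw [hT hSE]; exact (hirr hSE hS).base)
  -- two points of a large irreducible set lie over different points of the quotient
  have hsep : ∀ {S}, S ⊆ E → ZIrred K S → Fintype.card ι + 1 ≤ zdim K S →
      ∃ x ∈ S, ∃ y ∈ S, ∃ f : MvPolynomial σ K,
        (∀ (t : ι → Kˣ) (x : σ → K), aeval x f = 0 → aeval (torusAct w t x) f = 0) ∧
        aeval (polyMap p x) f = 0 ∧ aeval (polyMap p y) f ≠ 0 := by
    intro S hSE hS hd
    by_contra! hc
    obtain ⟨x, hx⟩ := hS.nonempty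
    obtain ⟨a, -, ha⟩ := hEY x (hSE hx)
    choose s hs hsa using h.free a
    obtain ⟨W, hWE, hxW, hW, hIW, hWc, hWd⟩ := exists_fibre hE (fun i => p (s i)) hSE hS hx
    have hfinW : W.Finite := by
      refine (hfin x (hSE hx)).subset fun z hz => ⟨hWE hz, ?_⟩
      obtain ⟨b, -, hb⟩ := hEY z (hWE hz)
      have hq : q a = q b := by
        by_contra hne
        obtain ⟨f, hf1, hf2, hf3⟩ := h.exists_semiinvariant hne
        refine hf3 ?_
        rw [hb, aeval_polyMap]
        refine hIW (fun y hy => ?_) z hz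
        rw [← aeval_polyMap]
        exact hc x hx y hy f hf1 (by rw [← ha, hf2])
      obtain ⟨t, ht⟩ := (h.eq_iff a b).mp hq
      have ht1 : t = 1 := by
        ext i
        have h1 := congrFun (hWc z hz) i
        change polyMap p z (s i) = polyMap p x (s i) at h1
        rw [← ha, ← hb, ht, torusAct_apply_of_single w (hs i)] at h1
        simpa using mul_right_cancel₀ (hsa i) (h1.trans (one_mul _).symm)
      rw [← ha, ← hb, ht, ht1, torusAct_one]
    have h1 := zdim_eq_zero_of_finite hW hfinW
    have h2 := zdim_le_card (k := K) (V := polyMap (fun i => p (s i)) '' S)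
    omega
  -- the chain is built downwards from `S` by hypersurface sections with semi-invariant polynomials,
  -- which lower the dimension by at most one and have a smaller closure in the quotient
  suffices hl : ∀ (m : ℕ) {S : Set (τ → K)}, S ⊆ E → ZIrred K S → Fintype.card ι + m ≤ zdim K S →
      ∃ l : LTSeries (TopologicalSpace.IrreducibleCloseds Y), l.length = m ∧
        (l.last : Set Y) = closure (T S) by
    obtain ⟨l, rfl, -⟩ := hl m hSE hS hm
    exact le_iSup (fun l : LTSeries (TopologicalSpace.IrreducibleCloseds Y) =>
      (l.length : WithBot ℕ∞)) l
  intro m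
  induction m with
  | zero =>
    intro S hSE hS _
    exact ⟨RelSeries.singleton _ ⟨_, (hTirr hSE hS).closure, isClosed_closure⟩, rfl, rfl⟩
  | succ m ih =>
    intro S hSE hS hd
    obtain ⟨x, hx, y, hy, f, hf, hfx, hfy⟩ := hsep hSE hS (by omega)
    obtain ⟨S', hSE', hxS', hS', hI, hfS', hd'⟩ := exists_hypersurface_section hE hSE hS hx
      (f := aeval p f) (by rw [← aeval_polyMap, hfx])
    obtain ⟨l, hl, hlast⟩ := ih hSE' hS' (by omega)
    have hlt : vanishingIdeal K (torusSat w (polyMap p '' S)) <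
        vanishingIdeal K (torusSat w (polyMap p '' S')) := by
      refine lt_of_le_of_ne (fun g hg => ?_) fun he => ?_
      · rw [mem_vanishingIdeal_torusSat] at hg ⊢
        exact fun m => vanishingIdeal_image_anti p hI (hg m)
      · have : f ∈ vanishingIdeal K (torusSat w (polyMap p '' S)) := by
          rw [he]
          rintro _ ⟨t, _, ⟨e, he, rfl⟩, rfl⟩
          exact hf t _ (by rw [aeval_polyMap]; exact hfS' e he)
        exact hfy (this _ (subset_torusSat w _ ⟨y, hy, rfl⟩))
    have hlt' := zdim_strictAnti (hirr hSE hS) (hirr hSE' hS') hlt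
    let c : TopologicalSpace.IrreducibleCloseds Y :=
      ⟨_, (hTirr hSE hS).closure, isClosed_closure⟩
    have hcl : ∀ {y : Y} {S}, S ⊆ E → (y ∈ closure (T S) ↔ ∀ a, q a = y →
        coord a ∈ zeroLocus K (vanishingIdeal k (torusSat w (polyMap p '' S)))) := by
      intro y S hSE
      rw [closure_subtype]
      constructor
      · intro hy a ha
        rwa [← ha, h.mem_closure_iff, hT hSE] at hy
      · intro hy
        obtain ⟨a, ha⟩ := h.surj y.1
        rw [← ha, h.mem_closure_iff, hT hSE]
        exact hy a ha
    have hlc : l.last < c := by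
      refine lt_of_le_not_ge ?_ fun hle => ?_
      · change (l.last : Set Y) ⊆ closure (T S)
        rw [hlast]
        intro y hy
        rw [hcl hSE]
        exact fun a ha => zeroLocus_anti_mono (vanishingIdeal_mono_base hlt.le)
          ((hcl hSE').mp hy a ha)
      · change closure (T S) ⊆ (l.last : Set Y) at hle
        rw [hlast] at hle
        have h1 : torusSat w (polyMap p '' S) ⊆
            zeroLocus K (vanishingIdeal k (torusSat w (polyMap p '' S'))) := by
          rw [← hT hSE]
          rintro _ ⟨a, ⟨y, hy, hya⟩, rfl⟩
          exact (hcl hSE').mp (hle (subset_closure hy)) a hya.symm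
        have h2 := zdim_anti (hirr hSE' hS').base (hirr hSE hS).base
          (le_zeroLocus_iff_le_vanishingIdeal.mp h1)
        rw [zdim_base (hirr hSE' hS'), zdim_base (hirr hSE hS)] at h2
        omega
    refine ⟨l.snoc c hlc, by simp [hl], ?_⟩
    rw [RelSeries.last_snoc]
    rfl

end Dimension

end TorusQuotient

end Quotient

/-! ### The spaces of the statement as torus quotients -/

section Instances

open MvPolynomial

set_option linter.unusedSectionVars false

variable {k K : Type*} [Field k] [Field K] [Algebra k K] {κ : Type} [Fintype κ]

theorem torusAct_apply_of_single_int {ι σ : Type} [Fintype ι] [DecidableEq ι] {w : σ → ι → ℤ}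
    {s : σ} {i : ι} {m : ℤ} (h : w s = Pi.single i m) (t : ι → Kˣ) (x : σ → K) :
    torusAct w t x s = ((t i ^ m : Kˣ) : K) * x s := by
  unfold torusAct
  rw [h, Finset.prod_eq_single i]
  · simp
  · intro j _ hj; simp [Pi.single_eq_of_ne hj]
  · simp

theorem exists_unit_smul_iff_mk_eq {v w : κ → K} (hv : v ≠ 0) (hw : w ≠ 0) :
    Projectivization.mk K v hv = Projectivization.mk K w hw ↔ ∃ t : Kˣ, w = t • v := by
  rw [eq_comm, Projectivization.mk_eq_mk_iff]
  exact ⟨fun ⟨t, ht⟩ => ⟨t, ht.symm⟩, fun ⟨t, ht⟩ => ⟨t, ht.symm⟩⟩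

theorem unit_smul_ne_zero {v : κ → K} (hv : v ≠ 0) (t : Kˣ) : t • v ≠ 0 :=
  (smul_ne_zero_iff_ne t).mpr hv

/-- The weights of the homogeneous coordinates on projective space. -/
def projWeight (κ : Type) : κ → Unit → ℤ := fun _ => Pi.single () 1

/-- The weights of the homogeneous coordinates on the cotangent bundle of projective space. -/
def cotangentWeight (κ : Type) : κ ⊕ κ → Unit → ℤ :=
  Sum.elim (fun _ => Pi.single () 1) (fun _ => Pi.single () (-1))

/-- The weights of the homogeneous coordinates on the incidence variety. -/
def incidenceWeight (κ : Type) : κ ⊕ κ → Fin 2 → ℤ :=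
  Sum.elim (fun _ => Pi.single 0 1) (fun _ => Pi.single 1 1)

/-- The weights of the homogeneous coordinates on the fibre square of the incidence variety. -/
def pairWeight (κ : Type) : κ ⊕ κ ⊕ κ → Fin 3 → ℤ :=
  Sum.elim (fun _ => Pi.single 0 1) (Sum.elim (fun _ => Pi.single 1 1) (fun _ => Pi.single 2 1))

theorem torusAct_projWeight (t : Unit → Kˣ) (v : κ → K) :
    torusAct (projWeight κ) t v = t () • v := by
  ext s
  rw [torusAct_apply_of_single_int (show projWeight κ s = Pi.single () 1 from rfl)]
  simp [Units.smul_def]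

theorem torusAct_cotangentWeight (t : Unit → Kˣ) (v ξ : κ → K) :
    torusAct (cotangentWeight κ) t (Sum.elim v ξ) = Sum.elim (t () • v) ((t ())⁻¹ • ξ) := by
  ext s
  rcases s with s | s
  · rw [torusAct_apply_of_single_int (show cotangentWeight κ (Sum.inl s) = Pi.single () 1 from rfl)]
    simp [Units.smul_def]
  · rw [torusAct_apply_of_single_int (show cotangentWeight κ (Sum.inr s) = Pi.single () (-1) from rfl)]
    simp [Units.smul_def]

theorem torusAct_incidenceWeight (t : Fin 2 → Kˣ) (v ξ : κ → K) :
    torusAct (incidenceWeight κ) t (Sum.elim v ξ) = Sum.elim (t 0 • v) (t 1 • ξ) := by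
  ext s
  rcases s with s | s
  · rw [torusAct_apply_of_single_int (show incidenceWeight κ (Sum.inl s) = Pi.single 0 1 from rfl)]
    simp [Units.smul_def]
  · rw [torusAct_apply_of_single_int (show incidenceWeight κ (Sum.inr s) = Pi.single 1 1 from rfl)]
    simp [Units.smul_def]

theorem torusAct_pairWeight (t : Fin 3 → Kˣ) (v₁ v₂ ξ : κ → K) :
    torusAct (pairWeight κ) t (Sum.elim v₁ (Sum.elim v₂ ξ)) =
      Sum.elim (t 0 • v₁) (Sum.elim (t 1 • v₂) (t 2 • ξ)) := by
  ext s
  rcases s with s | s | s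
  · rw [torusAct_apply_of_single_int (show pairWeight κ (Sum.inl s) = Pi.single 0 1 from rfl)]
    simp [Units.smul_def]
  · rw [torusAct_apply_of_single_int (show pairWeight κ (Sum.inr (Sum.inl s)) = Pi.single 1 1 from rfl)]
    simp [Units.smul_def]
  · rw [torusAct_apply_of_single_int (show pairWeight κ (Sum.inr (Sum.inr s)) = Pi.single 2 1 from rfl)]
    simp [Units.smul_def]

theorem sum_elim_inj {α β γ : Type*} {f f' : α → γ} {g g' : β → γ} :
    Sum.elim f g = Sum.elim f' g' ↔ f = f' ∧ g = g' := by
  constructor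
  · intro h
    exact ⟨funext fun a => congrFun h (Sum.inl a), funext fun b => congrFun h (Sum.inr b)⟩
  · rintro ⟨rfl, rfl⟩
    rfl

theorem torusQuotient_projSpace : TorusQuotient (X := ProjSpace k K κ) k (projWeight κ)
    (fun v : {v : κ → K // v ≠ 0} => v.1)
    (fun v => (Projectivization.mk K v.1 v.2 : ProjSpace k K κ)) where
  surj x := by
    induction x using Projectivization.ind with
    | h v hv => exact ⟨⟨v, hv⟩, rfl⟩
  eq_iff a b := by
    refine (exists_unit_smul_iff_mk_eq a.2 b.2).trans ?_
    constructor
    · rintro ⟨t, ht⟩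
      exact ⟨fun _ => t, by rw [torusAct_projWeight, ht]⟩
    · rintro ⟨t, ht⟩
      exact ⟨t (), by rw [ht, torusAct_projWeight]⟩
  act_mem a t := ⟨⟨t () • a.1, (smul_ne_zero_iff_ne _).mpr a.2⟩, (torusAct_projWeight t a.1).symm⟩
  free a i := by
    obtain ⟨s, hs⟩ := Function.ne_iff.mp a.2
    exact ⟨s, rfl, hs⟩
  top_eq := rfl

theorem torusQuotient_cotangent : TorusQuotient k (cotangentWeight κ)
    (fun w : CotangentCoord K κ => Sum.elim w.vec w.form) (fun w => Cotangent.mk k w) where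
  surj x := by
    obtain ⟨w, rfl⟩ := Quotient.exists_rep x
    exact ⟨w, rfl⟩
  eq_iff a b := by
    have h : Cotangent.mk k a = Cotangent.mk k b ↔
        ∃ t : Kˣ, b.vec = t • a.vec ∧ b.form = t⁻¹ • a.form := Quotient.eq
    rw [h]
    constructor
    · rintro ⟨t, h1, h2⟩
      exact ⟨fun _ => t, by rw [torusAct_cotangentWeight, h1, h2]⟩
    · rintro ⟨t, ht⟩
      rw [torusAct_cotangentWeight, sum_elim_inj] at ht
      exact ⟨t (), ht⟩
  act_mem a t := by
    refine ⟨⟨t () • a.vec, (t ())⁻¹ • a.form, unit_smul_ne_zero a.vec_ne_zero _, ?_⟩,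
      (torusAct_cotangentWeight t a.vec a.form).symm⟩
    rw [smul_dotProduct, dotProduct_smul, a.form_vec, smul_zero, smul_zero]
  free a i := by
    obtain ⟨s, hs⟩ := Function.ne_iff.mp a.vec_ne_zero
    exact ⟨Sum.inl s, rfl, hs⟩
  top_eq := rfl

theorem incidence_ofCoord_eq_iff {a b : CotangentCoord K κ} (ha : a.form ≠ 0) (hb : b.form ≠ 0) :
    Incidence.ofCoord k a ha = Incidence.ofCoord k b hb ↔
      (∃ t : Kˣ, b.vec = t • a.vec) ∧ ∃ t : Kˣ, b.form = t • a.form := by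
  rw [Incidence.ext_iff]
  exact and_congr (exists_unit_smul_iff_mk_eq a.vec_ne_zero b.vec_ne_zero)
    (exists_unit_smul_iff_mk_eq ha hb)

theorem exists_incidence_ofCoord (z : Incidence k K κ) :
    ∃ (a : CotangentCoord K κ) (ha : a.form ≠ 0), Incidence.ofCoord k a ha = z := by
  obtain ⟨x, y, hxy⟩ := z
  induction x using Projectivization.ind with
  | h v hv =>
    induction y using Projectivization.ind with
    | h ξ hξ =>
      refine ⟨⟨v, ξ, hv, ?_⟩, hξ, rfl⟩
      rwa [Projectivization.orthogonal_mk, dotProduct_comm] at hxy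

theorem torusQuotient_incidence : TorusQuotient k (incidenceWeight κ)
    (fun w : {w : CotangentCoord K κ // w.form ≠ 0} => Sum.elim w.1.vec w.1.form)
    (fun w => Incidence.ofCoord k w.1 w.2) where
  surj x := by
    obtain ⟨a, ha, rfl⟩ := exists_incidence_ofCoord x
    exact ⟨⟨a, ha⟩, rfl⟩
  eq_iff a b := by
    rw [incidence_ofCoord_eq_iff]
    constructor
    · rintro ⟨⟨t, h1⟩, u, h2⟩
      exact ⟨![t, u], by rw [torusAct_incidenceWeight, h1, h2]; rfl⟩
    · rintro ⟨t, ht⟩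
      rw [torusAct_incidenceWeight, sum_elim_inj] at ht
      exact ⟨⟨_, ht.1⟩, _, ht.2⟩
  act_mem a t := by
    refine ⟨⟨⟨t 0 • a.1.vec, t 1 • a.1.form, unit_smul_ne_zero a.1.vec_ne_zero _, ?_⟩,
      unit_smul_ne_zero a.2 _⟩, (torusAct_incidenceWeight t a.1.vec a.1.form).symm⟩
    rw [smul_dotProduct, dotProduct_smul, a.1.form_vec, smul_zero, smul_zero]
  free a i := by
    obtain ⟨s, hs⟩ := Function.ne_iff.mp a.1.vec_ne_zero
    obtain ⟨s', hs'⟩ := Function.ne_iff.mp a.2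
    fin_cases i
    · exact ⟨Sum.inl s, rfl, hs⟩
    · exact ⟨Sum.inr s', rfl, hs'⟩
  top_eq := rfl

/-- The fibre square of the incidence variety is the quotient of its coordinate vectors by a torus
of rank three. -/
theorem torusQuotient_incidencePair : TorusQuotient k (pairWeight κ)
    (fun w : PairCoord K κ => Sum.elim w.vec₁ (Sum.elim w.vec₂ w.form))
    (fun w => IncidencePair.ofCoord k w) where
  surj x := by
    obtain ⟨x, y, hxy⟩ := x
    obtain ⟨a, ha, rfl⟩ := exists_incidence_ofCoord x
    obtain ⟨b, hb, rfl⟩ := exists_incidence_ofCoord y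
    obtain ⟨t, ht⟩ := (exists_unit_smul_iff_mk_eq ha hb).mp hxy
    refine ⟨⟨a.vec, b.vec, a.form, a.vec_ne_zero, b.vec_ne_zero, ha, a.form_vec, ?_⟩, ?_⟩
    · have := b.form_vec
      rw [ht, smul_dotProduct, smul_eq_zero_iff_eq] at this
      exact this
    · refine IncidencePair.ext rfl ?_
      exact (incidence_ofCoord_eq_iff _ _).mpr ⟨⟨1, (one_smul _ _).symm⟩, t, ht⟩
  eq_iff a b := by
    rw [IncidencePair.ext_iff]
    simp only [IncidencePair.ofCoord, incidence_ofCoord_eq_iff]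
    constructor
    · rintro ⟨⟨⟨t, h1⟩, u, h2⟩, ⟨t', h3⟩, -⟩
      exact ⟨![t, t', u], by rw [torusAct_pairWeight, h1, h2, h3]; rfl⟩
    · rintro ⟨t, ht⟩
      rw [torusAct_pairWeight, sum_elim_inj, sum_elim_inj] at ht
      exact ⟨⟨⟨_, ht.1⟩, _, ht.2.2⟩, ⟨_, ht.2.1⟩, _, ht.2.2⟩
  act_mem a t := by
    refine ⟨⟨t 0 • a.vec₁, t 1 • a.vec₂, t 2 • a.form, unit_smul_ne_zero a.vec₁_ne_zero _,
      unit_smul_ne_zero a.vec₂_ne_zero _, unit_smul_ne_zero a.form_ne_zero _, ?_, ?_⟩,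
      (torusAct_pairWeight t a.vec₁ a.vec₂ a.form).symm⟩
    · rw [smul_dotProduct, dotProduct_smul, a.form_vec₁, smul_zero, smul_zero]
    · rw [smul_dotProduct, dotProduct_smul, a.form_vec₂, smul_zero, smul_zero]
  free a i := by
    obtain ⟨s, hs⟩ := Function.ne_iff.mp a.vec₁_ne_zero
    obtain ⟨s', hs'⟩ := Function.ne_iff.mp a.vec₂_ne_zero
    obtain ⟨s'', hs''⟩ := Function.ne_iff.mp a.form_ne_zero
    fin_cases i
    · exact ⟨Sum.inl s, rfl, hs⟩
    · exact ⟨Sum.inr (Sum.inl s'), rfl, hs'⟩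
    · exact ⟨Sum.inr (Sum.inr s''), rfl, hs''⟩
  top_eq := rfl

end Instances

/-! ### Quadratic forms and their differentials -/

section Quadrics

open MvPolynomial Module

set_option linter.unusedSectionVars false

variable {K : Type*} [Field K] {ι : Type} [Fintype ι] [DecidableEq ι]

theorem veronese_mk (v : ι → K) (a b : ι) : veronese v s(a, b) = v a * v b := by
  simp [veronese, quadMonomial, Sym2.mul]

/-- The polarization of the Veronese map. -/
def polarVeronese (u v : ι → K) : Sym2 ι → K :=
  Sym2.lift ⟨fun a b => u a * v b + u b * v a, fun _ _ => add_comm _ _⟩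

theorem polarVeronese_mk (u v : ι → K) (a b : ι) :
    polarVeronese u v s(a, b) = u a * v b + u b * v a := rfl

theorem polarVeronese_comm (u v : ι → K) : polarVeronese u v = polarVeronese v u := by
  ext s
  induction s with
  | _ a b => rw [polarVeronese_mk, polarVeronese_mk]; ring

theorem codiff_apply (v : ι → K) (η : Sym2 ι → K) (j : ι) :
    codiff v η j = η ⬝ᵥ polarVeronese v (Pi.single j 1) := by
  refine Finset.sum_congr rfl fun s _ => ?_
  congr 1
  induction s with
  | _ a b =>
    simp only [quadMonomial, Sym2.map_mk, Sym2.mul, polarVeronese_mk]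
    simp only [Sym2.lift_mk, Derivation.leibniz, pderiv_X, smul_eq_mul, map_add, map_mul, eval_X]
    by_cases ha : a = j <;> by_cases hb : b = j <;> simp [ha, hb]

theorem codiff_dot (v u : ι → K) (η : Sym2 ι → K) :
    codiff v η ⬝ᵥ u = η ⬝ᵥ polarVeronese v u := by
  have h : polarVeronese v u = ∑ j, u j • polarVeronese v (Pi.single j 1) := by
    ext s
    induction s with
    | _ a b =>
      simp only [Finset.sum_apply, Pi.smul_apply, polarVeronese_mk, smul_eq_mul, mul_add,
        Finset.sum_add_distrib, Pi.single_apply]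
      simp [mul_comm]
  rw [h, dotProduct_sum]
  refine Finset.sum_congr rfl fun j _ => ?_
  rw [codiff_apply, dotProduct_smul, smul_eq_mul, mul_comm]

theorem codiff_dot_comm (v u : ι → K) (η : Sym2 ι → K) : codiff v η ⬝ᵥ u = codiff u η ⬝ᵥ v := by
  rw [codiff_dot, codiff_dot, polarVeronese_comm]

theorem codiff_add (v : ι → K) (η η' : Sym2 ι → K) :
    codiff v (η + η') = codiff v η + codiff v η' := by
  ext j
  simp [codiff_apply, add_dotProduct]

theorem codiff_smul (v : ι → K) (c : K) (η : Sym2 ι → K) :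
    codiff v (c • η) = c • codiff v η := by
  ext j
  simp [codiff_apply, smul_dotProduct]

theorem codiff_sub (v : ι → K) (η η' : Sym2 ι → K) :
    codiff v (η - η') = codiff v η - codiff v η' := by
  ext j
  simp [codiff_apply, sub_dotProduct]

theorem codiff_add_vec (v v' : ι → K) (η : Sym2 ι → K) :
    codiff (v + v') η = codiff v η + codiff v' η := by
  refine dotProduct_eq _ _ fun u => ?_
  rw [add_dotProduct]
  simp only [codiff_dot_comm _ u, dotProduct_add]

theorem codiff_smul_vec (v : ι → K) (c : K) (η : Sym2 ι → K) :
    codiff (c • v) η = c • codiff v η := by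
  refine dotProduct_eq _ _ fun u => ?_
  rw [smul_dotProduct]
  simp only [codiff_dot_comm _ u, dotProduct_smul]

theorem veronese_smul (c : K) (v : ι → K) : veronese (c • v) = c ^ 2 • veronese v := by
  ext s
  induction s with
  | _ a b => simp only [veronese_mk, Pi.smul_apply, smul_eq_mul]; ring

theorem veronese_add (u v : ι → K) :
    veronese (u + v) = veronese u + veronese v + polarVeronese u v := by
  ext s
  induction s with
  | _ a b => simp only [veronese_mk, polarVeronese_mk, Pi.add_apply]; ring

theorem dot_veronese_add (η : Sym2 ι → K) (u v : ι → K) :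
    η ⬝ᵥ veronese (u + v) = η ⬝ᵥ veronese u + η ⬝ᵥ veronese v + codiff u η ⬝ᵥ v := by
  rw [veronese_add, dotProduct_add, dotProduct_add, codiff_dot]

theorem dot_veronese_smul (η : Sym2 ι → K) (c : K) (v : ι → K) :
    η ⬝ᵥ veronese (c • v) = c ^ 2 * (η ⬝ᵥ veronese v) := by
  rw [veronese_smul, dotProduct_smul, smul_eq_mul]

/-- A quadratic form is determined by its values. -/
theorem eq_of_dot_veronese {η η' : Sym2 ι → K} (h : ∀ v, η ⬝ᵥ veronese v = η' ⬝ᵥ veronese v) :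
    η = η' := by
  have h1 : ∀ (η : Sym2 ι → K) (s : Sym2 ι), η s = η ⬝ᵥ Pi.single s 1 := fun η s => by simp
  ext s
  rw [h1 η, h1 η']
  induction s with
  | _ a b =>
    have hd : ∀ c : ι, veronese (Pi.single c (1 : K)) = Pi.single s(c, c) 1 := by
      intro c
      ext s
      induction s with
      | _ x y =>
        rw [veronese_mk]
        by_cases hx : x = c <;> by_cases hy : y = c <;> simp [hx, hy]
    rcases eq_or_ne a b with rfl | hab
    · rw [← hd, h]
    · have hp : (Pi.single s(a, b) 1 : Sym2 ι → K) =
          veronese (Pi.single a 1 + Pi.single b 1) - veronese (Pi.single a 1) -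
            veronese (Pi.single b 1) := by
        rw [veronese_add, add_sub_right_comm, add_sub_cancel_left, add_sub_cancel_left]
        ext s
        induction s with
        | _ x y =>
          rw [polarVeronese_mk]
          by_cases hx : x = a <;> by_cases hy : y = b <;> by_cases hx' : x = b <;>
            by_cases hy' : y = a <;> simp_all [Pi.single_apply]
      rw [hp, dotProduct_sub, dotProduct_sub, dotProduct_sub, dotProduct_sub, h, h, h]

/-- The product of two linear forms, as a quadratic form. -/
def prodForm (l m : ι → K) : Sym2 ι → K :=
  fun s => ∑ p : ι × ι, if s(p.1, p.2) = s then l p.1 * m p.2 else 0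

theorem prodForm_dot (l m : ι → K) (F : Sym2 ι → K) :
    prodForm l m ⬝ᵥ F = ∑ a, ∑ b, l a * m b * F s(a, b) := by
  simp only [dotProduct, prodForm, Finset.sum_mul]
  rw [Finset.sum_comm, Fintype.sum_prod_type]
  exact Finset.sum_congr rfl fun a _ => Finset.sum_congr rfl fun b _ => by simp [ite_mul]

theorem prodForm_dot_veronese (l m v : ι → K) :
    prodForm l m ⬝ᵥ veronese v = (l ⬝ᵥ v) * (m ⬝ᵥ v) := by
  rw [prodForm_dot]
  simp only [dotProduct, Finset.sum_mul_sum, veronese_mk]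
  exact Finset.sum_congr rfl fun a _ => Finset.sum_congr rfl fun b _ => by ring

theorem prodForm_dot_polar (l m u v : ι → K) :
    prodForm l m ⬝ᵥ polarVeronese u v = (l ⬝ᵥ u) * (m ⬝ᵥ v) + (l ⬝ᵥ v) * (m ⬝ᵥ u) := by
  rw [prodForm_dot]
  simp only [dotProduct, Finset.sum_mul_sum, polarVeronese_mk, ← Finset.sum_add_distrib]
  exact Finset.sum_congr rfl fun a _ => Finset.sum_congr rfl fun b _ => by ring

theorem codiff_prodForm (l m v : ι → K) :
    codiff v (prodForm l m) = (l ⬝ᵥ v) • m + (m ⬝ᵥ v) • l := by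
  refine dotProduct_eq _ _ fun u => ?_
  rw [codiff_dot, prodForm_dot_polar, add_dotProduct, smul_dotProduct, smul_dotProduct,
    smul_eq_mul, smul_eq_mul]
  ring

/-- Multiplication by a linear form, as a linear map from linear to quadratic forms. -/
def mulForm (l : ι → K) : (ι → K) →ₗ[K] (Sym2 ι → K) where
  toFun := prodForm l
  map_add' m m' := eq_of_dot_veronese fun v => by
    simp only [prodForm_dot_veronese, add_dotProduct, mul_add]
  map_smul' c m := eq_of_dot_veronese fun v => by
    simp only [prodForm_dot_veronese, smul_dotProduct, smul_eq_mul, RingHom.id_apply]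
    ring

theorem mulForm_apply (l m : ι → K) : mulForm l m = prodForm l m := rfl

/-- The orthogonal complement of a subspace of `K^ι` for the dot product. -/
def perp (U : Submodule K (ι → K)) : Submodule K (ι → K) where
  carrier := {ξ | ∀ u ∈ U, ξ ⬝ᵥ u = 0}
  add_mem' h h' u hu := by rw [add_dotProduct, h u hu, h' u hu, add_zero]
  zero_mem' u _ := zero_dotProduct u
  smul_mem' c ξ h u hu := by rw [smul_dotProduct, h u hu, smul_zero]

theorem finrank_perp (U : Submodule K (ι → K)) :
    finrank K (perp U) + finrank K U = Fintype.card ι := by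
  let e : (ι → K) ≃ₗ[K] Module.Dual K (ι → K) := dotProductEquiv K ι
  have h : perp U = U.dualAnnihilator.comap e.toLinearMap := by
    ext ξ
    rw [Submodule.mem_comap, Submodule.mem_dualAnnihilator]
    exact Iff.rfl
  rw [h, LinearEquiv.finrank_eq (e.ofSubmodule' _), add_comm,
    Subspace.finrank_add_finrank_dualAnnihilator_eq, Module.finrank_fintype_fun_eq_card]

theorem mem_of_perp_le {U : Submodule K (ι → K)} {v : ι → K} (h : ∀ ξ ∈ perp U, ξ ⬝ᵥ v = 0) :
    v ∈ U := by
  have h1 : U ≤ perp (perp U) := fun u hu ξ hξ => by rw [dotProduct_comm]; exact hξ u hu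
  have h2 := finrank_perp U
  have h3 := finrank_perp (perp U)
  have h4 : U = perp (perp U) := Submodule.eq_of_le_of_finrank_eq h1 (by omega)
  rw [h4]
  exact fun ξ hξ => by rw [dotProduct_comm]; exact h ξ hξ

theorem exists_dot_eq_one {v : ι → K} (hv : v ≠ 0) : ∃ l : ι → K, l ⬝ᵥ v = 1 := by
  obtain ⟨a, ha⟩ := Function.ne_iff.mp hv
  exact ⟨Pi.single a (v a)⁻¹, by simpa using inv_mul_cancel₀ ha⟩

theorem exists_dual_pair {v₁ v₂ : ι → K} {a b : ι} (h : v₁ a * v₂ b - v₁ b * v₂ a ≠ 0) :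
    ∃ l₁ l₂ : ι → K, l₁ ⬝ᵥ v₁ = 1 ∧ l₁ ⬝ᵥ v₂ = 0 ∧ l₂ ⬝ᵥ v₁ = 0 ∧ l₂ ⬝ᵥ v₂ = 1 := by
  refine ⟨(v₁ a * v₂ b - v₁ b * v₂ a)⁻¹ • (Pi.single a (v₂ b) - Pi.single b (v₂ a)),
    (v₁ a * v₂ b - v₁ b * v₂ a)⁻¹ • (Pi.single b (v₁ a) - Pi.single a (v₁ b)), ?_, ?_, ?_, ?_⟩ <;>
  simp only [smul_dotProduct, sub_dotProduct, single_dotProduct, smul_eq_mul]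
  · rw [inv_mul_eq_one₀ h]; ring
  · ring
  · ring
  · rw [inv_mul_eq_one₀ h]

theorem finrank_add_finrank_le_of_map {D L : Type*} [AddCommGroup D] [Module K D]
    [AddCommGroup L] [Module K L] [FiniteDimensional K D] [FiniteDimensional K L]
    (F : D →ₗ[K] L) (P : Submodule K L) (h : ∀ d, F d ∈ P → d = 0) :
    finrank K P + finrank K D ≤ finrank K L := by
  have hF : Function.Injective F :=
    (injective_iff_map_eq_zero F).mpr fun d hd => h d (hd ▸ P.zero_mem)
  rw [← LinearMap.finrank_range_of_inj hF]
  refine Submodule.finrank_add_finrank_le_of_disjoint (disjoint_iff_inf_le.mpr ?_)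
  rintro _ ⟨hx, d, rfl⟩
  rw [h d hx, map_zero]
  exact Submodule.zero_mem _

/-- The quadratic forms that are singular at `v` along `U`: they vanish at `v`, and their
differential at `v` vanishes on `U`. -/
def singularForms (v : ι → K) (U : Submodule K (ι → K)) : Submodule K (Sym2 ι → K) where
  carrier := {η | η ⬝ᵥ veronese v = 0 ∧ codiff v η ∈ perp U}
  add_mem' h h' := ⟨by rw [add_dotProduct, h.1, h'.1, add_zero], by
    rw [codiff_add]; exact add_mem h.2 h'.2⟩
  zero_mem' := ⟨zero_dotProduct _, by
    have := codiff_smul v 0 (0 : Sym2 ι → K)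
    rw [zero_smul, zero_smul] at this
    rw [this]; exact zero_mem _⟩
  smul_mem' c η h := ⟨by rw [smul_dotProduct, h.1, smul_zero], by
    rw [codiff_smul]; exact Submodule.smul_mem _ _ h.2⟩

theorem mem_singularForms {v : ι → K} {U : Submodule K (ι → K)} {η : Sym2 ι → K} :
    η ∈ singularForms v U ↔ η ⬝ᵥ veronese v = 0 ∧ codiff v η ∈ perp U := Iff.rfl

/-- The conditions to be singular at `v` along `U` are independent: they can be tested on the forms
`l m` with a fixed linear form `l` such that `l v = 1`. -/
theorem finrank_singularForms_le {v : ι → K} (hv : v ≠ 0) {U : Submodule K (ι → K)} :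
    finrank K (singularForms v U) + finrank K U ≤ Fintype.card (Sym2 ι) := by
  obtain ⟨l, hl⟩ := exists_dot_eq_one hv
  obtain ⟨D, hD⟩ := Submodule.exists_isCompl (perp U)
  have h1 := Submodule.finrank_add_eq_of_isCompl hD
  have h2 := finrank_perp U
  rw [Module.finrank_fintype_fun_eq_card] at h1
  have h3 := finrank_add_finrank_le_of_map ((mulForm l).comp D.subtype) (singularForms v U) <| by
    rintro ⟨m, hm⟩ ⟨h4, h5⟩
    simp only [LinearMap.comp_apply, Submodule.subtype_apply, mulForm_apply,
      prodForm_dot_veronese, hl, one_mul] at h4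
    simp only [LinearMap.comp_apply, Submodule.subtype_apply, mulForm_apply, codiff_prodForm,
      hl, h4, one_smul, zero_smul, add_zero] at h5
    have := (Submodule.disjoint_def.mp hD.disjoint) m h5 hm
    simpa using this
  rw [Module.finrank_fintype_fun_eq_card] at h3
  omega

theorem perp_top : perp (⊤ : Submodule K (ι → K)) = ⊥ := by
  rw [eq_bot_iff]
  intro ξ hξ
  exact dotProduct_eq_zero _ fun u => hξ u trivial

/-- The conditions to be singular at two independent vectors satisfy only one linear relation,
which comes from the symmetry of the polar form. -/
theorem finrank_singularForms_inf_le {v₁ v₂ : ι → K} {a b : ι}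
    (h : v₁ a * v₂ b - v₁ b * v₂ a ≠ 0) :
    finrank K (singularForms v₁ ⊤ ⊓ singularForms v₂ ⊤ : Submodule K (Sym2 ι → K)) +
      2 * Fintype.card ι ≤ Fintype.card (Sym2 ι) + 1 := by
  obtain ⟨l₁, l₂, h11, h12, h21, h22⟩ := exists_dual_pair h
  let D := perp (Submodule.span K {v₁})
  have hD : Fintype.card ι ≤ finrank K D + 1 := by
    have h1 : finrank K D + _ = _ := finrank_perp (Submodule.span K {v₁})
    have h2 := finrank_span_le_card (R := K) ({v₁} : Set (ι → K))
    rw [Set.toFinset_singleton, Finset.card_singleton] at h2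
    omega
  have h3 := finrank_add_finrank_le_of_map
    (((mulForm l₁).comp (LinearMap.fst K (ι → K) D)) +
      (((mulForm l₂).comp D.subtype).comp (LinearMap.snd K (ι → K) D)))
    (singularForms v₁ ⊤ ⊓ singularForms v₂ ⊤) <| by
    rintro ⟨m, m', hm'⟩ ⟨⟨h4, h5⟩, ⟨h6, h7⟩⟩
    have hm1 : m' ⬝ᵥ v₁ = 0 := hm' v₁ (Submodule.mem_span_singleton_self v₁)
    rw [perp_top, Submodule.mem_bot] at h5 h7
    simp only [LinearMap.add_apply, LinearMap.comp_apply, Submodule.subtype_apply, mulForm_apply,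
      LinearMap.fst_apply, LinearMap.snd_apply, codiff_add, add_dotProduct, prodForm_dot_veronese,
      codiff_prodForm, h11, h12, h21, h22, hm1, one_mul, zero_mul, zero_smul, one_smul,
      add_zero, zero_add] at h4 h5 h6 h7
    rw [h4, zero_smul, add_zero] at h5
    rw [h5, h6, zero_smul, zero_dotProduct, zero_smul, add_zero, zero_add] at h7
    simp [h5, h7]
  rw [Module.finrank_prod, Module.finrank_fintype_fun_eq_card,
    Module.finrank_fintype_fun_eq_card] at h3
  omega

end Quadrics

section Linear

open MvPolynomial Module

set_option linter.unusedSectionVars false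

variable {K : Type*} [Field K] {ι : Type} [Fintype ι] [DecidableEq ι]

/-- A quadratic form with a unique singular point on a given linear subspace `U`, at a prescribed
point `v₀`. In coordinates `y₁, …, yᵣ` on `U / v₀` it is the sum of the `yᵢ yⱼ` for `i ≤ j` and
`i + j = r + 1`; including the middle square makes this work in characteristic two. -/
theorem exists_form_singular_at_point {U : Submodule K (ι → K)} {v₀ : ι → K} (hv₀ : v₀ ∈ U) :
    ∃ η, η ∈ singularForms v₀ U ∧ ∀ v ∈ U, η ∈ singularForms v U → ∃ c : K, v = c • v₀ := by
  let v₀' : U := ⟨v₀, hv₀⟩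
  let Q := U ⧸ Submodule.span K {v₀'}
  let c := Module.finBasis K Q
  let r := finrank K Q
  have hl : ∀ i, ∃ l : ι → K, ∀ u : U, l ⬝ᵥ u.1 = c.coord i (Submodule.Quotient.mk u) := by
    intro i
    obtain ⟨g, hg⟩ := LinearMap.exists_extend
      ((c.coord i).comp (Submodule.mkQ (Submodule.span K {v₀'})))
    refine ⟨(dotProductEquiv K ι).symm g, fun u => ?_⟩
    have h1 := LinearMap.congr_fun hg u
    have h2 := LinearMap.congr_fun ((dotProductEquiv K ι).apply_symm_apply g) u.1
    rw [dotProductEquiv_apply_apply] at h2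
    rw [h2]
    exact h1
  choose l hl using hl
  have hb : ∀ j, ∃ b : U, ∀ i, l i ⬝ᵥ b.1 = if i = j then 1 else 0 := by
    intro j
    obtain ⟨b, hb⟩ := Submodule.Quotient.mk_surjective _ (c j)
    refine ⟨b, fun i => ?_⟩
    rw [hl, hb, Basis.coord_apply, Basis.repr_self, Finsupp.single_apply]
    simp [eq_comm]
  choose b hb using hb
  have hl0 : ∀ i, l i ⬝ᵥ v₀ = 0 := by
    intro i
    rw [hl i v₀', (Submodule.Quotient.mk_eq_zero _).mpr (Submodule.mem_span_singleton_self _),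
      map_zero]
  let η : Sym2 ι → K := ∑ i : Fin r, if i ≤ i.rev then prodForm (l i) (l i.rev) else 0
  have hq : ∀ v, η ⬝ᵥ veronese v =
      ∑ i : Fin r, if i ≤ i.rev then (l i ⬝ᵥ v) * (l i.rev ⬝ᵥ v) else 0 := by
    intro v
    rw [sum_dotProduct]
    refine Finset.sum_congr rfl fun i _ => ?_
    split_ifs
    · exact prodForm_dot_veronese _ _ _
    · exact zero_dotProduct _
  have hB : ∀ v u, codiff v η ⬝ᵥ u = ∑ i : Fin r, if i ≤ i.rev then
      (l i ⬝ᵥ v) * (l i.rev ⬝ᵥ u) + (l i ⬝ᵥ u) * (l i.rev ⬝ᵥ v) else 0 := by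
    intro v u
    rw [codiff_dot, sum_dotProduct]
    refine Finset.sum_congr rfl fun i _ => ?_
    split_ifs
    · exact prodForm_dot_polar _ _ _ _
    · exact zero_dotProduct _
  refine ⟨η, ⟨?_, fun u hu => ?_⟩, fun v hv hη => ?_⟩
  · rw [hq]; simp [hl0]
  · rw [hB]; simp [hl0]
  have h1 : ∀ j : Fin r, j ≠ j.rev → l j ⬝ᵥ v = 0 := by
    intro j hj
    have h2 := hη.2 _ (b j.rev).2
    rw [hB, Finset.sum_congr rfl (g := fun i => (if i = j then
      if j ≤ j.rev then l j ⬝ᵥ v else 0 else 0) +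
      if i = j.rev then (if j.rev ≤ j then l j ⬝ᵥ v else 0) else 0)] at h2
    · rw [Finset.sum_add_distrib, Finset.sum_ite_eq', Finset.sum_ite_eq',
        if_pos (Finset.mem_univ _), if_pos (Finset.mem_univ _)] at h2
      rcases lt_or_gt_of_ne hj with h | h
      · rwa [if_pos h.le, if_neg h.not_ge, add_zero] at h2
      · rwa [if_neg h.not_ge, if_pos h.le, zero_add] at h2
    · intro i _
      rw [hb, hb]
      by_cases h3 : i = j
      · subst h3
        rw [if_pos rfl, if_neg hj, if_pos rfl, if_neg hj]
        simp
      · by_cases h4 : i = j.rev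
        · subst h4
          rw [if_neg h3, Fin.rev_rev, if_neg hj, if_pos rfl, if_pos rfl]
          simp
        · have h5 : i.rev ≠ j.rev := fun h => h3 (Fin.rev_injective h)
          simp [h3, h4]
  have h2 : ∀ j : Fin r, l j ⬝ᵥ v = 0 := by
    intro j
    by_cases hj : j = j.rev
    · have h3 := hη.1
      rw [hq, Finset.sum_eq_single j] at h3
      · rw [← hj, if_pos le_rfl] at h3
        exact mul_self_eq_zero.mp h3
      · intro i _ hi
        split_ifs with h4
        · rw [h1 i, zero_mul]
          intro h5
          apply hi
          have h6 := congrArg Fin.val hj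
          have h7 := congrArg Fin.val h5
          rw [Fin.val_rev] at h6 h7
          ext
          omega
        · rfl
      · simp
    · exact h1 j hj
  have h3 : (Submodule.Quotient.mk ⟨v, hv⟩ : Q) = 0 := by
    refine c.ext_elem fun i => ?_
    rw [map_zero, Finsupp.zero_apply, ← Basis.coord_apply, ← hl i ⟨v, hv⟩, h2]
  rw [Submodule.Quotient.mk_eq_zero, Submodule.mem_span_singleton] at h3
  obtain ⟨a, ha⟩ := h3
  exact ⟨a, (congrArg Subtype.val ha).symm⟩

/-! ### Dimensions of linear subspaces -/

variable [IsAlgClosed K] {σ : Type} [Fintype σ]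

/-- A linear combination of fixed vectors with variable coefficients, as a polynomial map. -/
def affinePoly {d : ℕ} (x₀ : σ → K) (b : Fin d → σ → K) : σ → MvPolynomial (Fin d) K :=
  fun s => C (x₀ s) + ∑ i, C (b i s) * X i

theorem polyMap_affinePoly {d : ℕ} (x₀ : σ → K) (b : Fin d → σ → K) (y : Fin d → K) :
    polyMap (affinePoly x₀ b) y = x₀ + ∑ i, y i • b i := by
  ext s
  simp [polyMap, affinePoly, mul_comm]

theorem exists_affinePoly_eq (L : Submodule K (σ → K)) (x₀ : σ → K) :
    ∃ b : Fin (finrank K L) → σ → K,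
      polyMap (affinePoly x₀ b) '' Set.univ = {x | x - x₀ ∈ L} := by
  let c := Module.finBasis K L
  refine ⟨fun i => (c i : σ → K), ?_⟩
  ext x
  constructor
  · rintro ⟨y, -, rfl⟩
    rw [polyMap_affinePoly]
    change _ - _ ∈ L
    rw [add_sub_cancel_left]
    exact Submodule.sum_mem _ fun i _ => L.smul_mem _ (c i).2
  · intro hx
    refine ⟨c.repr ⟨_, hx⟩, trivial, ?_⟩
    rw [polyMap_affinePoly]
    have := congrArg Subtype.val (c.sum_repr ⟨_, hx⟩)
    simp only [Submodule.coe_sum, Submodule.coe_smul] at this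
    rw [this, add_sub_cancel]

/-- An irreducible subset of an affine subspace has at most the dimension of the subspace. -/
theorem zdim_le_finrank {L : Submodule K (σ → K)} (x₀ : σ → K) {W : Set (σ → K)}
    (hW : ZIrred K W) (h : ∀ x ∈ W, x - x₀ ∈ L) : zdim K W ≤ finrank K L := by
  obtain ⟨b, hb⟩ := exists_affinePoly_eq L x₀
  have h1 : ZIrred K (polyMap (affinePoly x₀ b) '' (Set.univ : Set (_ → K))) :=
    zirred_univ.image _
  refine (zdim_mono hW h1 (by rw [hb]; exact h)).trans ((zdim_image_le zirred_univ _).trans ?_)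
  exact zdim_le_card.trans (by simp)

theorem zirred_submodule (L : Submodule K (σ → K)) : ZIrred K (L : Set (σ → K)) := by
  obtain ⟨b, hb⟩ := exists_affinePoly_eq L 0
  have h1 : ZIrred K (polyMap (affinePoly 0 b) '' (Set.univ : Set (_ → K))) :=
    zirred_univ.image _
  rw [hb] at h1
  simpa using h1

theorem zdim_submodule (L : Submodule K (σ → K)) : zdim K (L : Set (σ → K)) = finrank K L := by
  classical
  have hL := zirred_submodule L
  refine le_antisymm (zdim_le_finrank 0 hL fun x hx => by simpa using hx) ?_
  let c := Module.finBasis K L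
  have hg : ∀ i, ∃ g : (σ → K) →ₗ[K] K, g.comp L.subtype = c.coord i := fun i =>
    LinearMap.exists_extend _
  choose g hg using hg
  let p : Fin (finrank K L) → MvPolynomial σ K := fun i => ∑ s, C (g i (Pi.single s 1)) * X s
  have hp : ∀ x, polyMap p x = fun i => g i x := by
    intro x
    ext i
    rw [LinearMap.pi_apply_eq_sum_univ (g i) x]
    simp only [polyMap, p, map_sum, map_mul, aeval_C, aeval_X, Algebra.algebraMap_self,
      RingHom.id_apply, smul_eq_mul]
    refine Finset.sum_congr rfl fun s _ => ?_
    rw [mul_comm]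
    congr 2
    ext t
    simp [Pi.single_apply, eq_comm]
  have h1 : polyMap p '' (L : Set (σ → K)) = Set.univ := by
    refine Set.eq_univ_of_forall fun y => ⟨∑ i, y i • (c i : σ → K),
      Submodule.sum_mem _ fun i _ => L.smul_mem _ (c i).2, ?_⟩
    rw [hp]
    ext j
    have h2 : ∀ i, g j (c i : σ → K) = if i = j then 1 else 0 := fun i => by
      have := LinearMap.congr_fun (hg j) (c i)
      simp only [LinearMap.comp_apply, Submodule.subtype_apply, Basis.coord_apply,
        Basis.repr_self, Finsupp.single_apply] at this
      exact this
    simp [h2]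
  have h2 := zdim_image_le hL p
  rwa [h1, zdim_univ, Fintype.card_fin] at h2

end Linear

/-! ### Quadrics with prescribed conormal vectors: lower bounds for dimensions -/

section Cones

open MvPolynomial Module

set_option linter.unusedSectionVars false

variable {k K : Type*} [Field k] [Field K] [Algebra k K] {ι : Type} [Fintype ι] [DecidableEq ι]

/-- The set of homogeneous coordinate vectors `(v, ξ)` of the points of a closed irreducible
conical subset of the cotangent bundle of projective space. -/
structure IsConicalSet (k : Type*) [Field k] [Algebra k K] (T : Set (ι ⊕ ι → K)) : Prop where
  mem_iff : ∀ v ξ : ι → K, Sum.elim v ξ ∈ T ↔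
    v ≠ 0 ∧ ξ ⬝ᵥ v = 0 ∧ Sum.elim v ξ ∈ zeroLocus K (vanishingIdeal k T)
  irred : ZIrred k T
  smul_mem : ∀ {s t : K}, s ≠ 0 → t ≠ 0 → ∀ {v ξ : ι → K}, Sum.elim v ξ ∈ T →
    Sum.elim (s • v) (t • ξ) ∈ T

/-- The set of homogeneous coordinate vectors `(v, ξ)` of the points of a closed irreducible
conical subset, of the same dimension as the base, of the cotangent bundle of projective space. -/
structure IsCone (k : Type*) [Field k] [Algebra k K] (T : Set (ι ⊕ ι → K)) : Prop
    extends IsConicalSet k T where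
  dim : zdim k T = Fintype.card ι

/-- The pairing of covectors and vectors as a polynomial. -/
def pairingPoly (k : Type*) [Field k] (ι : Type) [Fintype ι] : MvPolynomial (ι ⊕ ι) k :=
  ∑ i, X (Sum.inr i) * X (Sum.inl i)

theorem aeval_pairingPoly (v ξ : ι → K) : aeval (Sum.elim v ξ) (pairingPoly k ι) = ξ ⬝ᵥ v := by
  simp [pairingPoly, dotProduct]

section ConeLemmas

variable [IsAlgClosed K] [Algebra.IsAlgebraic k K] {T : Set (ι ⊕ ι → K)}

theorem IsConicalSet.vec_ne_zero (hT : IsConicalSet k T) {v ξ : ι → K} (h : Sum.elim v ξ ∈ T) : v ≠ 0 :=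
  ((hT.mem_iff v ξ).mp h).1

theorem IsConicalSet.form_vec (hT : IsConicalSet k T) {v ξ : ι → K} (h : Sum.elim v ξ ∈ T) : ξ ⬝ᵥ v = 0 :=
  ((hT.mem_iff v ξ).mp h).2.1

theorem IsConicalSet.pairingPoly_mem (hT : IsConicalSet k T) : pairingPoly k ι ∈ vanishingIdeal k T := by
  intro x hx
  obtain ⟨v, ξ, rfl⟩ := exists_elim_eq x
  rw [aeval_pairingPoly]
  exact hT.form_vec hx

theorem IsConicalSet.mem_of_closure (hT : IsConicalSet k T) {x : ι ⊕ ι → K}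
    (hx : x ∈ zeroLocus K (vanishingIdeal k T)) {a : ι} (ha : x (Sum.inl a) ≠ 0) : x ∈ T := by
  obtain ⟨v, ξ, rfl⟩ := exists_elim_eq x
  refine (hT.mem_iff v ξ).mpr ⟨fun h => ha (by simp [h]), ?_, hx⟩
  rw [← aeval_pairingPoly (k := k)]
  exact hx _ hT.pairingPoly_mem

theorem vanishingIdeal_le_of_base {σ : Type} {V W : Set (σ → K)}
    (h : vanishingIdeal k V ≤ vanishingIdeal k W) :
    W ⊆ zeroLocus K (vanishingIdeal k V) :=
  fun _ hx _ hf => h hf _ hx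

theorem IsConicalSet.locClosed (hT : IsConicalSet k T) : LocClosed T := by
  intro x hx
  obtain ⟨v, ξ, rfl⟩ := exists_elim_eq x
  obtain ⟨a, ha⟩ := Function.ne_iff.mp (hT.vec_ne_zero hx)
  refine ⟨X (Sum.inl a), by simpa using ha, fun y hy hya => ?_⟩
  rw [aeval_X] at hya
  refine hT.mem_of_closure ?_ hya
  exact vanishingIdeal_le_of_base (vanishingIdeal_mono_base (vanishingIdeal_closure (k := K) T).ge) hy

theorem IsCone.zdim_le (hT : IsCone k T) {W : Set (ι ⊕ ι → K)} (hWT : W ⊆ T) (hW : ZIrred K W) :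
    zdim K W ≤ Fintype.card ι := by
  rw [← hT.dim, ← zdim_base (k := k) hW]
  exact zdim_mono hW.base hT.irred hWT

theorem IsCone.vanishingIdeal_eq (hT : IsCone k T) {W : Set (ι ⊕ ι → K)} (hWT : W ⊆ T)
    (hW : ZIrred K W) (hd : Fintype.card ι ≤ zdim K W) :
    vanishingIdeal k W = vanishingIdeal k T := by
  refine (vanishingIdeal_eq_of_zdim_le hT.irred hW.base (vanishingIdeal_anti_mono hWT) ?_).symm
  rw [hT.dim, zdim_base hW]
  exact hd

/-- Through every point of a conical set over `k` there passes an irreducible subset over `K` of the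
same dimension. -/
theorem IsConicalSet.exists_component (hT : IsConicalSet k T) {c : ι ⊕ ι → K} (hc : c ∈ T) :
    ∃ W ⊆ T, c ∈ W ∧ ZIrred K W ∧ zdim K W = zdim k T := by
  obtain ⟨W, hW, hcW, -, hI, hd⟩ := exists_irreducible_through_point hT.irred
    (zeroLocus_vanishingIdeal_le T hc)
  obtain ⟨v, ξ, rfl⟩ := exists_elim_eq c
  obtain ⟨a, ha⟩ := Function.ne_iff.mp (hT.vec_ne_zero hc)
  have hne : aeval (Sum.elim v ξ) (X (Sum.inl a) : MvPolynomial (ι ⊕ ι) K) ≠ 0 := by simpa using ha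
  have hI' := hW.vanishingIdeal_inter ⟨_, hcW, hne⟩
  refine ⟨{x ∈ W | aeval x (X (Sum.inl a) : MvPolynomial (ι ⊕ ι) K) ≠ 0}, fun x hx => ?_,
    ⟨hcW, hne⟩, hW.of_vanishingIdeal_eq hI', ?_⟩
  · exact hT.mem_of_closure (vanishingIdeal_le_of_base hI.ge hx.1) (by simpa using hx.2)
  · rw [zdim_congr hI', hd]

theorem IsCone.exists_component (hT : IsCone k T) {c : ι ⊕ ι → K} (hc : c ∈ T) :
    ∃ W ⊆ T, c ∈ W ∧ ZIrred K W ∧ zdim K W = Fintype.card ι := by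
  rw [← hT.dim]
  exact hT.toIsConicalSet.exists_component hc

end ConeLemmas

section Polynomials

variable {τ : Type}

theorem aeval_quadMonomial (v : ι → K) (s : Sym2 ι) :
    aeval v (quadMonomial k s) = veronese v s := by
  induction s with
  | _ a b => simp [quadMonomial, Sym2.mul, veronese_mk]

/-- The value of a quadratic form at a vector, as a polynomial in coordinates that contain those
of the vector and of the form. -/
def quadPoly (k : Type*) [Field k] (a : ι → τ) (b : Sym2 ι → τ) : MvPolynomial τ k :=
  ∑ s, X (b s) * rename a (quadMonomial k s)

theorem aeval_quadPoly (a : ι → τ) (b : Sym2 ι → τ) (x : τ → K) :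
    aeval x (quadPoly k a b) = (x ∘ b) ⬝ᵥ veronese (x ∘ a) := by
  simp [quadPoly, aeval_rename, aeval_quadMonomial, dotProduct]

/-- The differential of a quadratic form at a vector, as a family of polynomials in coordinates
that contain those of the vector and of the form. -/
def codiffPoly (k : Type*) [Field k] (a : ι → τ) (b : Sym2 ι → τ) (j : ι) : MvPolynomial τ k :=
  ∑ s, X (b s) * rename a (pderiv j (quadMonomial k s))

theorem aeval_codiffPoly (a : ι → τ) (b : Sym2 ι → τ) (j : ι) (x : τ → K) :
    aeval x (codiffPoly k a b j) = codiff (x ∘ a) (x ∘ b) j := by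
  simp only [codiffPoly, map_sum, map_mul, aeval_X, aeval_rename, codiff]
  refine Finset.sum_congr rfl fun s _ => ?_
  congr 1
  induction s with
  | _ p q =>
    by_cases hp : p = j <;> by_cases hq : q = j <;>
      simp [quadMonomial, Sym2.mul, Derivation.leibniz, pderiv_X, hp, hq]

/-- The vector `v` and the differential at `v` of a quadratic form, as a polynomial map. -/
def pointPoly (k : Type*) [Field k] (a : ι → τ) (b : Sym2 ι → τ) : ι ⊕ ι → MvPolynomial τ k :=
  Sum.elim (fun i => X (a i)) (codiffPoly k a b)

theorem polyMap_pointPoly (a : ι → τ) (b : Sym2 ι → τ) (x : τ → K) :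
    polyMap (pointPoly k a b) x = Sum.elim (x ∘ a) (codiff (x ∘ a) (x ∘ b)) := by
  ext i
  rcases i with i | i
  · simp [polyMap, pointPoly]
  · exact aeval_codiffPoly a b i x

/-- Inside a locally closed set of triples of a vector `v`, a covector `ξ` with `ξ v = 0` and a
quadratic form, the condition that the form vanishes at `v` and has differential `ξ` there is
given by as many equations as there are coordinates of `v`: by Euler's formula, one component of
the differential is redundant. -/
theorem exists_conormal_section [IsAlgClosed K] [Finite τ] {F S : Set (τ → K)} (hF : LocClosed F)
    (a c : ι → τ) (b : Sym2 ι → τ) {i₀ : ι} (hpair : ∀ y ∈ F, (y ∘ c) ⬝ᵥ (y ∘ a) = 0)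
    (hne : ∀ y ∈ F, y (a i₀) ≠ 0) (hSF : S ⊆ F) (hS : ZIrred K S) {x : τ → K} (hx : x ∈ S)
    (hquad : (x ∘ b) ⬝ᵥ veronese (x ∘ a) = 0) (hcod : codiff (x ∘ a) (x ∘ b) = x ∘ c) :
    ∃ W ⊆ F, x ∈ W ∧ ZIrred K W ∧ vanishingIdeal K S ≤ vanishingIdeal K W ∧
      (∀ y ∈ W, (y ∘ b) ⬝ᵥ veronese (y ∘ a) = 0 ∧ codiff (y ∘ a) (y ∘ b) = y ∘ c) ∧
      zdim K S ≤ zdim K W + Fintype.card ι := by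
  let f : ι → MvPolynomial τ K := fun j =>
    if j = i₀ then quadPoly K a b else codiffPoly K a b j - X (c j)
  have hf0 : ∀ y : τ → K, aeval y (f i₀) = (y ∘ b) ⬝ᵥ veronese (y ∘ a) := fun y => by
    simp only [f, if_pos, aeval_quadPoly]
  have hf : ∀ (y : τ → K) j, j ≠ i₀ → aeval y (f j) = codiff (y ∘ a) (y ∘ b) j - (y ∘ c) j := by
    intro y j hj
    simp only [f, if_neg hj, map_sub, aeval_codiffPoly, aeval_X, Function.comp_apply]
  obtain ⟨W, h1, h2, h3, h4, h5, h6⟩ := exists_section hF hSF hS hx (f := f) fun j => by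
    by_cases hj : j = i₀
    · rw [hj, hf0, hquad]
    · rw [hf x j hj, hcod, sub_self]
  refine ⟨W, h1, h2, h3, h4, fun y hy => ?_, h6⟩
  have hq : (y ∘ b) ⬝ᵥ veronese (y ∘ a) = 0 := by rw [← hf0]; exact h5 i₀ y hy
  have hj : ∀ j, j ≠ i₀ → codiff (y ∘ a) (y ∘ b) j - (y ∘ c) j = 0 := fun j hj => by
    rw [← hf y j hj]; exact h5 j y hy
  refine ⟨hq, funext fun j => ?_⟩
  by_cases hj' : j = i₀
  · have h7 : (codiff (y ∘ a) (y ∘ b) - y ∘ c) ⬝ᵥ (y ∘ a) = 0 := by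
      rw [sub_dotProduct, codiff_dotProduct, hq, hpair y (h1 hy), mul_zero, sub_zero]
    rw [dotProduct, Finset.sum_eq_single i₀] at h7
    · rw [hj']
      exact sub_eq_zero.mp ((mul_eq_zero.mp h7).resolve_right (hne y (h1 hy)))
    · intro i _ hi
      rw [Pi.sub_apply, hj i hi, zero_mul]
    · simp
  · exact sub_eq_zero.mp (hj j hj')

end Polynomials

end Cones

section ConormalQuadrics

open MvPolynomial Module

set_option linter.unusedSectionVars false

variable {k K : Type*} [Field k] [Field K] [Algebra k K] {ι : Type} [Fintype ι] [DecidableEq ι]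

/-- The pairs `(v, η)` of a vector and a nonzero quadratic form that vanishes at `v`, such that
`(v, dη(v))` belongs to `T`. -/
def conormalQuadrics (T : Set (ι ⊕ ι → K)) : Set (ι ⊕ Sym2 ι → K) :=
  {x | x ∘ Sum.inr ≠ 0 ∧ (x ∘ Sum.inr) ⬝ᵥ veronese (x ∘ Sum.inl) = 0 ∧
    Sum.elim (x ∘ Sum.inl) (codiff (x ∘ Sum.inl) (x ∘ Sum.inr)) ∈ T}

theorem mem_conormalQuadrics {T : Set (ι ⊕ ι → K)} {v : ι → K} {η : Sym2 ι → K} :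
    Sum.elim v η ∈ conormalQuadrics T ↔
      η ≠ 0 ∧ η ⬝ᵥ veronese v = 0 ∧ Sum.elim v (codiff v η) ∈ T := Iff.rfl

/-- The triples `(v₁, v₂, η)` of two independent vectors and a nonzero quadratic form that vanishes
at both of them, such that `(vᵢ, dη(vᵢ))` belongs to `Tᵢ`. -/
def conormalQuadricPairs (T₁ T₂ : Set (ι ⊕ ι → K)) : Set (ι ⊕ ι ⊕ Sym2 ι → K) :=
  {x | (∃ a b, x (Sum.inl a) * x (Sum.inr (Sum.inl b)) -
      x (Sum.inl b) * x (Sum.inr (Sum.inl a)) ≠ 0) ∧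
    Sum.elim (x ∘ Sum.inl) (x ∘ Sum.inr ∘ Sum.inr) ∈ conormalQuadrics T₁ ∧
    Sum.elim (x ∘ Sum.inr ∘ Sum.inl) (x ∘ Sum.inr ∘ Sum.inr) ∈ conormalQuadrics T₂}

theorem mem_conormalQuadricPairs {T₁ T₂ : Set (ι ⊕ ι → K)} {v₁ v₂ : ι → K} {η : Sym2 ι → K} :
    Sum.elim v₁ (Sum.elim v₂ η) ∈ conormalQuadricPairs T₁ T₂ ↔
      (∃ a b, v₁ a * v₂ b - v₁ b * v₂ a ≠ 0) ∧ Sum.elim v₁ η ∈ conormalQuadrics T₁ ∧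
        Sum.elim v₂ η ∈ conormalQuadrics T₂ := Iff.rfl

variable [IsAlgClosed K] [Algebra.IsAlgebraic k K] {T T₁ T₂ : Set (ι ⊕ ι → K)}

theorem LocClosed.principal {σ : Type} (g : MvPolynomial σ K) : LocClosed {x : σ → K | aeval x g ≠ 0} :=
  LocClosed.of_forall ∅ {g} fun x => by simp

theorem locClosed_conormalQuadrics (hT : LocClosed T) : LocClosed (conormalQuadrics T) := by
  have h1 : LocClosed {x : ι ⊕ Sym2 ι → K | x ∘ Sum.inr ≠ 0 ∧
      (x ∘ Sum.inr) ⬝ᵥ veronese (x ∘ Sum.inl) = 0} :=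
    LocClosed.of_forall {quadPoly K Sum.inl Sum.inr} (Set.range fun s => X (Sum.inr s)) fun x => by
      simp only [Set.mem_singleton_iff, forall_eq, aeval_quadPoly, Set.exists_range_iff, aeval_X]
      exact and_comm.trans (and_congr_right fun _ => Function.ne_iff)
  convert h1.inter (hT.preimage (pointPoly K Sum.inl Sum.inr)) using 1
  ext x
  simp only [Set.mem_inter_iff, Set.mem_preimage, polyMap_pointPoly]
  exact and_assoc.symm

theorem locClosed_conormalQuadricPairs (hT₁ : LocClosed T₁) (hT₂ : LocClosed T₂) :
    LocClosed (conormalQuadricPairs T₁ T₂) := by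
  have h0 : LocClosed {x : ι ⊕ ι ⊕ Sym2 ι → K | ∃ a b, x (Sum.inl a) * x (Sum.inr (Sum.inl b)) -
      x (Sum.inl b) * x (Sum.inr (Sum.inl a)) ≠ 0} :=
    LocClosed.of_forall ∅ (Set.range fun p : ι × ι => X (Sum.inl p.1) * X (Sum.inr (Sum.inl p.2)) -
      X (Sum.inl p.2) * X (Sum.inr (Sum.inl p.1))) fun x => by simp
  have h1 := (locClosed_conormalQuadrics hT₁).preimage
    (fun i => X (Sum.elim Sum.inl (Sum.inr ∘ Sum.inr) i) :
      ι ⊕ Sym2 ι → MvPolynomial (ι ⊕ ι ⊕ Sym2 ι) K)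
  have h2 := (locClosed_conormalQuadrics hT₂).preimage
    (fun i => X (Sum.elim (Sum.inr ∘ Sum.inl) (Sum.inr ∘ Sum.inr) i) :
      ι ⊕ Sym2 ι → MvPolynomial (ι ⊕ ι ⊕ Sym2 ι) K)
  convert h0.inter (h1.inter h2) using 1
  ext x
  have e1 : polyMap (fun i => X (Sum.elim Sum.inl (Sum.inr ∘ Sum.inr) i) :
      ι ⊕ Sym2 ι → MvPolynomial (ι ⊕ ι ⊕ Sym2 ι) K) x =
      Sum.elim (x ∘ Sum.inl) (x ∘ Sum.inr ∘ Sum.inr) := by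
    ext i; rcases i with i | i <;> simp [polyMap]
  have e2 : polyMap (fun i => X (Sum.elim (Sum.inr ∘ Sum.inl) (Sum.inr ∘ Sum.inr) i) :
      ι ⊕ Sym2 ι → MvPolynomial (ι ⊕ ι ⊕ Sym2 ι) K) x =
      Sum.elim (x ∘ Sum.inr ∘ Sum.inl) (x ∘ Sum.inr ∘ Sum.inr) := by
    ext i; rcases i with i | i <;> simp [polyMap]
  simp only [Set.mem_inter_iff, Set.mem_preimage, e1, e2]
  rfl

theorem zdim_univ_sym2 : zdim K (Set.univ : Set (Sym2 ι → K)) = Fintype.card (Sym2 ι) := zdim_univ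

/-- Every component of `conormalQuadrics T` has at least the dimension of the space of quadratic
forms: in the product of `T` with that space it is given by as many equations as the dimension
of `T`. -/
theorem exists_large_subset_conormalQuadrics (hT : IsCone k T) {x : ι ⊕ Sym2 ι → K}
    (hx : x ∈ conormalQuadrics T) : ∃ W ⊆ conormalQuadrics T, x ∈ W ∧ ZIrred K W ∧
      Fintype.card (Sym2 ι) ≤ zdim K W := by
  obtain ⟨v, η, rfl⟩ := exists_elim_eq x
  obtain ⟨hη, hquad, hvT⟩ := mem_conormalQuadrics.mp hx
  obtain ⟨W₁, hW₁T, hvW₁, hW₁, hd₁⟩ := hT.exists_component hvT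
  obtain ⟨i₀, hi₀⟩ := Function.ne_iff.mp (hT.vec_ne_zero hvT)
  obtain ⟨s₀, hs₀⟩ := Function.ne_iff.mp hη
  let τ := (ι ⊕ ι) ⊕ Sym2 ι
  let a : ι → τ := fun i => Sum.inl (Sum.inl i)
  let c : ι → τ := fun i => Sum.inl (Sum.inr i)
  let b : Sym2 ι → τ := Sum.inr
  let g : MvPolynomial τ K := X (a i₀) * X (b s₀)
  let pr : ι ⊕ ι → MvPolynomial τ K := fun i => X (Sum.inl i)
  have hpr : ∀ y : τ → K, polyMap pr y = Sum.elim (y ∘ a) (y ∘ c) := fun y => by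
    ext i; rcases i with i | i <;> simp [pr, polyMap, a, c]
  let F : Set (τ → K) := polyMap pr ⁻¹' T ∩ {y | aeval y g ≠ 0}
  have hF : LocClosed F := (hT.locClosed.preimage pr).inter (LocClosed.principal g)
  have hFne : ∀ y ∈ F, y (a i₀) ≠ 0 ∧ y (b s₀) ≠ 0 := fun y hy => by
    have := hy.2
    simpa [g] using this
  have hFT : ∀ y ∈ F, Sum.elim (y ∘ a) (y ∘ c) ∈ T := fun y hy => by
    rw [← hpr]; exact hy.1
  have hS₀ := hW₁.prod (zirred_univ (k := K) (K := K) (σ := Sym2 ι))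
  have hdS₀ := zdim_prod_ge hW₁ (zirred_univ (k := K) (K := K) (σ := Sym2 ι))
  let e : τ → K := Sum.elim (Sum.elim v (codiff v η)) η
  have he : e ∈ prodSet W₁ (Set.univ : Set (Sym2 ι → K)) :=
    elim_mem_prodSet.mpr ⟨hvW₁, trivial⟩
  have hge : aeval e g ≠ 0 := by
    simp only [g, map_mul, aeval_X]
    exact mul_ne_zero hi₀ hs₀
  have hI := hS₀.vanishingIdeal_inter ⟨e, he, hge⟩
  obtain ⟨W, hWF, heW, hW, -, hWeq, hWd⟩ := exists_conormal_section hF a c b (i₀ := i₀)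
    (fun y hy => hT.form_vec (hFT y hy)) (fun y hy => (hFne y hy).1)
    (S := {y ∈ prodSet W₁ (Set.univ : Set (Sym2 ι → K)) | aeval y g ≠ 0})
    (fun y hy => ⟨hW₁T (by
      have := hy.1.1
      rw [hpr]
      convert this using 1
      ext i; rcases i with i | i <;> rfl), hy.2⟩) (hS₀.of_vanishingIdeal_eq hI) ⟨he, hge⟩ hquad rfl
  let p : ι ⊕ Sym2 ι → MvPolynomial τ K := fun i => X (Sum.elim a b i)
  have hp : ∀ y : τ → K, polyMap p y = Sum.elim (y ∘ a) (y ∘ b) := fun y => by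
    ext i; rcases i with i | i <;> simp [p, polyMap]
  refine ⟨polyMap p '' W, ?_, ⟨e, heW, hp e⟩, hW.image p, ?_⟩
  · rintro _ ⟨y, hy, rfl⟩
    rw [hp, mem_conormalQuadrics]
    refine ⟨Function.ne_iff.mpr ⟨s₀, (hFne y (hWF hy)).2⟩, (hWeq y hy).1, ?_⟩
    rw [(hWeq y hy).2]
    exact hFT y (hWF hy)
  · -- the projection is injective on `W`
    let q : τ → MvPolynomial (ι ⊕ Sym2 ι) K :=
      Sum.elim (pointPoly K Sum.inl Sum.inr) (fun s => X (Sum.inr s))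
    have hq : ∀ y ∈ W, polyMap q (polyMap p y) = y := by
      intro y hy
      have h1 := polyMap_pointPoly (k := K) (Sum.inl : ι → ι ⊕ Sym2 ι) Sum.inr (polyMap p y)
      have h2 := (hWeq y hy).2
      rw [hp] at h1 ⊢
      ext i
      rcases i with i | i
      · refine (congrFun h1 i).trans ?_
        rcases i with i | i
        · rfl
        · exact congrFun h2 i
      · simp [q, polyMap, b]
    have hWq : polyMap q '' (polyMap p '' W) = W := by
      rw [Set.image_image]
      exact (Set.image_congr hq).trans (Set.image_id' W)
    have h3 := zdim_image_le (hW.image p) q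
    rw [hWq] at h3
    rw [zdim_congr hI] at hWd
    rw [hd₁, zdim_univ_sym2] at hdS₀
    omega

/-- Every component of `conormalQuadricPairs T₁ T₂` has at least the dimension of the space of
quadratic forms. -/
theorem exists_large_subset_conormalQuadricPairs (hT₁ : IsCone k T₁) (hT₂ : IsCone k T₂)
    {x : ι ⊕ ι ⊕ Sym2 ι → K} (hx : x ∈ conormalQuadricPairs T₁ T₂) :
    ∃ W ⊆ conormalQuadricPairs T₁ T₂, x ∈ W ∧ ZIrred K W ∧ Fintype.card (Sym2 ι) ≤ zdim K W := by
  obtain ⟨v₁, x, rfl⟩ := exists_elim_eq x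
  obtain ⟨v₂, η, rfl⟩ := exists_elim_eq x
  obtain ⟨⟨p₀, q₀, hpq⟩, ⟨hη, hquad₁, hvT₁⟩, -, hquad₂, hvT₂⟩ := mem_conormalQuadricPairs.mp hx
  obtain ⟨W₁, hW₁T, hvW₁, hW₁, hd₁⟩ := hT₁.exists_component hvT₁
  obtain ⟨W₂, hW₂T, hvW₂, hW₂, hd₂⟩ := hT₂.exists_component hvT₂
  obtain ⟨i₁, hi₁⟩ := Function.ne_iff.mp (hT₁.vec_ne_zero hvT₁)
  obtain ⟨i₂, hi₂⟩ := Function.ne_iff.mp (hT₂.vec_ne_zero hvT₂)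
  obtain ⟨s₀, hs₀⟩ := Function.ne_iff.mp hη
  let τ := (ι ⊕ ι) ⊕ (ι ⊕ ι) ⊕ Sym2 ι
  let a₁ : ι → τ := fun i => Sum.inl (Sum.inl i)
  let c₁ : ι → τ := fun i => Sum.inl (Sum.inr i)
  let a₂ : ι → τ := fun i => Sum.inr (Sum.inl (Sum.inl i))
  let c₂ : ι → τ := fun i => Sum.inr (Sum.inl (Sum.inr i))
  let b : Sym2 ι → τ := fun s => Sum.inr (Sum.inr s)
  let g : MvPolynomial τ K := (X (a₁ p₀) * X (a₂ q₀) - X (a₁ q₀) * X (a₂ p₀)) *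
    (X (a₁ i₁) * X (a₂ i₂) * X (b s₀))
  let pr₁ : ι ⊕ ι → MvPolynomial τ K := fun i => X (Sum.inl i)
  let pr₂ : ι ⊕ ι → MvPolynomial τ K := fun i => X (Sum.inr (Sum.inl i))
  have hpr₁ : ∀ y : τ → K, polyMap pr₁ y = Sum.elim (y ∘ a₁) (y ∘ c₁) := fun y => by
    ext i; rcases i with i | i <;> simp [pr₁, polyMap, a₁, c₁]
  have hpr₂ : ∀ y : τ → K, polyMap pr₂ y = Sum.elim (y ∘ a₂) (y ∘ c₂) := fun y => by
    ext i; rcases i with i | i <;> simp [pr₂, polyMap, a₂, c₂]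
  let F : Set (τ → K) := (polyMap pr₁ ⁻¹' T₁ ∩ polyMap pr₂ ⁻¹' T₂) ∩ {y | aeval y g ≠ 0}
  have hF : LocClosed F := ((hT₁.locClosed.preimage pr₁).inter
    (hT₂.locClosed.preimage pr₂)).inter (LocClosed.principal g)
  have hFne : ∀ y ∈ F, y (a₁ p₀) * y (a₂ q₀) - y (a₁ q₀) * y (a₂ p₀) ≠ 0 ∧
      (y (a₁ i₁) ≠ 0 ∧ y (a₂ i₂) ≠ 0) ∧ y (b s₀) ≠ 0 := fun y hy => by
    have := hy.2
    simpa only [g, ne_eq, map_mul, map_sub, aeval_X, mul_eq_zero, not_or, Set.mem_ofPred_eq]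
      using this
  have hFT₁ : ∀ y ∈ F, Sum.elim (y ∘ a₁) (y ∘ c₁) ∈ T₁ := fun y hy => by
    rw [← hpr₁]; exact hy.1.1
  have hFT₂ : ∀ y ∈ F, Sum.elim (y ∘ a₂) (y ∘ c₂) ∈ T₂ := fun y hy => by
    rw [← hpr₂]; exact hy.1.2
  have hS₁ := hW₂.prod (zirred_univ (k := K) (K := K) (σ := Sym2 ι))
  have hdS₁ := zdim_prod_ge hW₂ (zirred_univ (k := K) (K := K) (σ := Sym2 ι))
  have hS₀ := hW₁.prod hS₁
  have hdS₀ := zdim_prod_ge hW₁ hS₁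
  let S₀ : Set (τ → K) := prodSet W₁ (prodSet W₂ Set.univ)
  let e : τ → K := Sum.elim (Sum.elim v₁ (codiff v₁ η)) (Sum.elim (Sum.elim v₂ (codiff v₂ η)) η)
  have he : e ∈ S₀ := elim_mem_prodSet.mpr ⟨hvW₁, elim_mem_prodSet.mpr ⟨hvW₂, trivial⟩⟩
  have hge : aeval e g ≠ 0 := by
    simp only [g, map_mul, map_sub, aeval_X]
    exact mul_ne_zero hpq (mul_ne_zero (mul_ne_zero hi₁ hi₂) hs₀)
  have hI := hS₀.vanishingIdeal_inter ⟨e, he, hge⟩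
  have hSF : {y ∈ S₀ | aeval y g ≠ 0} ⊆ F := by
    intro y hy
    refine ⟨⟨hW₁T ?_, hW₂T ?_⟩, hy.2⟩
    · have := hy.1.1
      rw [hpr₁]
      convert this using 1
      ext i; rcases i with i | i <;> rfl
    · have := hy.1.2.1
      rw [hpr₂]
      convert this using 1
      ext i; rcases i with i | i <;> rfl
  obtain ⟨W, hWF, heW, hW, -, hWeq, hWd⟩ := exists_conormal_section hF a₁ c₁ b (i₀ := i₁)
    (fun y hy => hT₁.form_vec (hFT₁ y hy)) (fun y hy => (hFne y hy).2.1.1) hSF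
    (hS₀.of_vanishingIdeal_eq hI) ⟨he, hge⟩ hquad₁ rfl
  obtain ⟨W', hWF', heW', hW', hII', hWeq₂, hWd'⟩ := exists_conormal_section hF a₂ c₂ b (i₀ := i₂)
    (fun y hy => hT₂.form_vec (hFT₂ y hy)) (fun y hy => (hFne y hy).2.1.2) hWF hW heW hquad₂ rfl
  have hWeq₁ : ∀ y ∈ W', (y ∘ b) ⬝ᵥ veronese (y ∘ a₁) = 0 ∧
      codiff (y ∘ a₁) (y ∘ b) = y ∘ c₁ := by
    intro y hy
    constructor
    · rw [← aeval_quadPoly (k := K)]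
      refine hII' (fun z hz => ?_) y hy
      rw [aeval_quadPoly]
      exact (hWeq z hz).1
    · ext j
      rw [← aeval_codiffPoly (k := K), ← sub_eq_zero]
      have hmem : codiffPoly K a₁ b j - X (c₁ j) ∈ vanishingIdeal K W := fun z hz => by
        rw [map_sub, aeval_codiffPoly, (hWeq z hz).2, aeval_X]
        exact sub_self _
      have := hII' hmem y hy
      rwa [map_sub, aeval_X] at this
  let p : ι ⊕ ι ⊕ Sym2 ι → MvPolynomial τ K := fun i => X (Sum.elim a₁ (Sum.elim a₂ b) i)
  have hp : ∀ y : τ → K, polyMap p y = Sum.elim (y ∘ a₁) (Sum.elim (y ∘ a₂) (y ∘ b)) := fun y => by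
    ext i; rcases i with i | i | i <;> simp [p, polyMap]
  refine ⟨polyMap p '' W', ?_, ⟨e, heW', hp e⟩, hW'.image p, ?_⟩
  · rintro _ ⟨y, hy, rfl⟩
    have hyF := hWF' hy
    have hη' : y ∘ b ≠ 0 := Function.ne_iff.mpr ⟨s₀, (hFne y hyF).2.2⟩
    rw [hp, mem_conormalQuadricPairs, mem_conormalQuadrics, mem_conormalQuadrics]
    refine ⟨⟨p₀, q₀, (hFne y hyF).1⟩, ⟨hη', (hWeq₁ y hy).1, ?_⟩, hη', (hWeq₂ y hy).1, ?_⟩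
    · rw [(hWeq₁ y hy).2]
      exact hFT₁ y hyF
    · rw [(hWeq₂ y hy).2]
      exact hFT₂ y hyF
  · let q : τ → MvPolynomial (ι ⊕ ι ⊕ Sym2 ι) K :=
      Sum.elim (pointPoly K Sum.inl (fun s => Sum.inr (Sum.inr s)))
        (Sum.elim (pointPoly K (fun i => Sum.inr (Sum.inl i)) (fun s => Sum.inr (Sum.inr s)))
          (fun s => X (Sum.inr (Sum.inr s))))
    have hq : ∀ y ∈ W', polyMap q (polyMap p y) = y := by
      intro y hy
      have h1 := polyMap_pointPoly (k := K) (Sum.inl : ι → ι ⊕ ι ⊕ Sym2 ι)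
        (fun s => Sum.inr (Sum.inr s)) (polyMap p y)
      have h2 := polyMap_pointPoly (k := K) (fun i => Sum.inr (Sum.inl i) : ι → ι ⊕ ι ⊕ Sym2 ι)
        (fun s => Sum.inr (Sum.inr s)) (polyMap p y)
      rw [hp] at h1 h2 ⊢
      ext i
      rcases i with i | i | i
      · refine (congrFun h1 i).trans ?_
        rcases i with i | i
        · rfl
        · exact congrFun (hWeq₁ y hy).2 i
      · refine (congrFun h2 i).trans ?_
        rcases i with i | i
        · rfl
        · exact congrFun (hWeq₂ y hy).2 i
      · simp [q, polyMap, b]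
    have hWq : polyMap q '' (polyMap p '' W') = W' := by
      rw [Set.image_image]
      exact (Set.image_congr hq).trans (Set.image_id' W')
    have h3 := zdim_image_le (hW'.image p) q
    rw [hWq] at h3
    rw [zdim_congr hI] at hWd
    rw [hd₂, zdim_univ_sym2] at hdS₁
    rw [hd₁] at hdS₀
    change _ ≤ zdim K S₀ at hdS₀
    change zdim K S₀ ≤ _ at hWd
    omega

end ConormalQuadrics

/-! ### Upper bounds for dimensions and the exceptional case -/

section UpperBounds

open MvPolynomial Module

set_option linter.unusedSectionVars false

variable {k K : Type*} [Field k] [Field K] [Algebra k K] {ι σ τ : Type} [Fintype ι] [DecidableEq ι]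

theorem polyMap_X_comp (e : τ → σ) (x : σ → K) :
    polyMap (fun t => (X (e t) : MvPolynomial σ k)) x = x ∘ e := by
  ext t; simp [polyMap]

/-- The product of two linear subspaces, in coordinates. -/
def prodSubmodule (U V : Submodule K (ι → K)) : Submodule K (ι ⊕ ι → K) where
  carrier := prodSet (U : Set (ι → K)) V
  add_mem' h h' := ⟨U.add_mem h.1 h'.1, V.add_mem h.2 h'.2⟩
  zero_mem' := ⟨U.zero_mem, V.zero_mem⟩
  smul_mem' c _ h := ⟨U.smul_mem c h.1, V.smul_mem c h.2⟩

theorem mem_prodSubmodule {U V : Submodule K (ι → K)} {v ξ : ι → K} :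
    Sum.elim v ξ ∈ prodSubmodule U V ↔ v ∈ U ∧ ξ ∈ V := elim_mem_prodSet

/-- The coordinate vectors of the conormal bundle of the linear projective subspace of `U`. -/
def conormalVectors (U : Submodule K (ι → K)) : Set (ι ⊕ ι → K) :=
  {x | x ∘ Sum.inl ≠ 0 ∧ x ∈ prodSubmodule U (perp U)}

theorem mem_conormalVectors {U : Submodule K (ι → K)} {v ξ : ι → K} :
    Sum.elim v ξ ∈ conormalVectors U ↔ v ≠ 0 ∧ v ∈ U ∧ ξ ∈ perp U :=
  and_congr_right fun _ => mem_prodSubmodule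

variable [IsAlgClosed K]

theorem finrank_prodSubmodule (U V : Submodule K (ι → K)) :
    finrank K (prodSubmodule U V) = finrank K U + finrank K V := by
  rw [← zdim_submodule, ← zdim_submodule, ← zdim_submodule]
  exact zdim_prod (zirred_submodule U) (zirred_submodule V)

/-- Forgetting coordinates that are constant on a set does not lower its dimension. -/
theorem zdim_le_zdim_image_inr [Finite σ] [Finite τ] {W : Set (σ ⊕ τ → K)} (hW : ZIrred K W)
    (hc : ∀ x ∈ W, ∀ y ∈ W, x ∘ Sum.inl = y ∘ Sum.inl) :
    zdim K W ≤ zdim K (polyMap (fun t => (X (Sum.inr t) : MvPolynomial (σ ⊕ τ) K)) '' W) := by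
  obtain ⟨x₀, hx₀⟩ := hW.nonempty
  let q : σ ⊕ τ → MvPolynomial τ K := Sum.elim (fun s => C (x₀ (Sum.inl s))) X
  refine le_trans (le_of_eq ?_) (zdim_image_le (hW.image _) q)
  congr 1
  rw [Set.image_image]
  refine ((Set.image_congr fun x hx => ?_).trans (Set.image_id' W)).symm
  rw [polyMap_X_comp]
  ext i
  rcases i with i | i
  · have := congrFun (hc _ hx₀ _ hx) i
    simpa [q, polyMap] using this
  · simp [q, polyMap]

variable [Algebra.IsAlgebraic k K] {T T₁ T₂ : Set (ι ⊕ ι → K)}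

/-- The dimension of `conormalQuadrics T` is at most that of the space of quadratic forms. -/
theorem zdim_le_of_subset_conormalQuadrics (hT : IsCone k T) {S : Set (ι ⊕ Sym2 ι → K)}
    (hST : S ⊆ conormalQuadrics T) (hS : ZIrred K S) : zdim K S ≤ Fintype.card (Sym2 ι) := by
  let p : ι ⊕ ι → MvPolynomial (ι ⊕ Sym2 ι) K := pointPoly K Sum.inl Sum.inr
  have hpT : polyMap p '' S ⊆ T := by
    rintro _ ⟨x, hx, rfl⟩
    rw [polyMap_pointPoly]
    exact (hST hx).2.2
  have h1 := hT.zdim_le hpT (hS.image p)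
  have hNM : Fintype.card ι ≤ Fintype.card (Sym2 ι) :=
    Fintype.card_le_of_injective Sym2.diag Sym2.diag_injective
  have h2 := zdim_le_of_fibre_le (locClosed_conormalQuadrics hT.locClosed) p
    (c := Fintype.card (Sym2 ι) - Fintype.card ι) (fun W hWT hW hc => by
      have hc1 : ∀ x ∈ W, ∀ y ∈ W, x ∘ Sum.inl = y ∘ Sum.inl ∧
          codiff (x ∘ Sum.inl) (x ∘ Sum.inr) = codiff (y ∘ Sum.inl) (y ∘ Sum.inr) := by
        intro x hx y hy
        have := hc x hx y hy
        rwa [polyMap_pointPoly, polyMap_pointPoly, sum_elim_inj] at this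
      obtain ⟨x₀, hx₀⟩ := hW.nonempty
      obtain ⟨v, η, rfl⟩ := exists_elim_eq x₀
      have hv : v ≠ 0 := hT.vec_ne_zero (hWT hx₀).2.2
      refine (zdim_le_zdim_image_inr hW fun x hx y hy => (hc1 x hx y hy).1).trans ?_
      refine (zdim_le_finrank (L := singularForms v ⊤) η (hW.image _) ?_).trans ?_
      · rintro _ ⟨x, hx, rfl⟩
        obtain ⟨h3, h4⟩ := hc1 x hx _ hx₀
        have h5 := (hWT hx).2.1
        rw [h3] at h4 h5
        rw [polyMap_X_comp, mem_singularForms, perp_top, Submodule.mem_bot, sub_dotProduct,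
          codiff_sub]
        exact ⟨sub_eq_zero.mpr (h5.trans (hWT hx₀).2.1.symm), sub_eq_zero.mpr h4⟩
      · have := finrank_singularForms_le hv (U := ⊤)
        rw [finrank_top, Module.finrank_fintype_fun_eq_card] at this
        omega) hST hS
  omega

/-- If the products of two irreducible sets of covectors, both of maximal dimension, contains a
dense set of pairs `(v₁, ξ₁), (v₂, ξ₂)` with `ξ₁ v₂ = ξ₂ v₁`, then both are dense in the conormal
bundle of the same linear subspace. -/
theorem exists_eq_conormalVectors (hT₁ : IsCone k T₁) (hT₂ : IsCone k T₂)
    {B : Set ((ι ⊕ ι) ⊕ (ι ⊕ ι) → K)} (hB : ZIrred K B)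
    (hBT : ∀ x ∈ B, x ∘ Sum.inl ∈ T₁ ∧ x ∘ Sum.inr ∈ T₂)
    (hsymm : ∀ v₁ ξ₁ v₂ ξ₂, Sum.elim (Sum.elim v₁ ξ₁) (Sum.elim v₂ ξ₂) ∈ B → ξ₁ ⬝ᵥ v₂ = ξ₂ ⬝ᵥ v₁)
    (hd : 2 * Fintype.card ι ≤ zdim K B) :
    ∃ U : Submodule K (ι → K), (∀ x ∈ B, x ∘ Sum.inl ∈ conormalVectors U ∧
      x ∘ Sum.inr ∈ conormalVectors U) ∧ vanishingIdeal k T₁ = vanishingIdeal k (conormalVectors U)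
      ∧ vanishingIdeal k T₂ = vanishingIdeal k (conormalVectors U) := by
  -- saturate the two projections of `B` under the torus of bihomogeneous scalings
  let A₁ := torusSat (incidenceWeight ι)
    (polyMap (fun i => (X (Sum.inl i) : MvPolynomial ((ι ⊕ ι) ⊕ (ι ⊕ ι)) K)) '' B)
  let A₂ := torusSat (incidenceWeight ι)
    (polyMap (fun i => (X (Sum.inr i) : MvPolynomial ((ι ⊕ ι) ⊕ (ι ⊕ ι)) K)) '' B)
  have hA₁ : ZIrred K A₁ := (hB.image _).torusSat _
  have hA₂ : ZIrred K A₂ := (hB.image _).torusSat _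
  have hsat : ∀ {T : Set (ι ⊕ ι → K)}, IsCone k T → ∀ x ∈ T, ∀ t,
      torusAct (incidenceWeight ι) t x ∈ T := by
    intro T hT x hx t
    obtain ⟨v, ξ, rfl⟩ := exists_elim_eq x
    rw [torusAct_incidenceWeight]
    exact hT.smul_mem (t 0).ne_zero (t 1).ne_zero hx
  have hAT₁ : A₁ ⊆ T₁ := by
    rintro _ ⟨t, _, ⟨x, hx, rfl⟩, rfl⟩
    rw [polyMap_X_comp]
    exact hsat hT₁ _ (hBT x hx).1 t
  have hAT₂ : A₂ ⊆ T₂ := by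
    rintro _ ⟨t, _, ⟨x, hx, rfl⟩, rfl⟩
    rw [polyMap_X_comp]
    exact hsat hT₂ _ (hBT x hx).2 t
  have hBA₁ : ∀ x ∈ B, x ∘ Sum.inl ∈ A₁ := fun x hx =>
    subset_torusSat _ _ ⟨x, hx, polyMap_X_comp _ _⟩
  have hBA₂ : ∀ x ∈ B, x ∘ Sum.inr ∈ A₂ := fun x hx =>
    subset_torusSat _ _ ⟨x, hx, polyMap_X_comp _ _⟩
  have hd₁ := hT₁.zdim_le hAT₁ hA₁
  have hd₂ := hT₂.zdim_le hAT₂ hA₂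
  have hprod := zdim_prod hA₁ hA₂
  have hBA : B ⊆ prodSet A₁ A₂ := fun x hx => ⟨hBA₁ x hx, hBA₂ x hx⟩
  have hle := zdim_mono hB (hA₁.prod hA₂) hBA
  have hI := vanishingIdeal_eq_of_zdim_le (hA₁.prod hA₂) hB (vanishingIdeal_anti_mono hBA)
    (by omega)
  have hsymm' : ∀ v₁ ξ₁ v₂ ξ₂, Sum.elim v₁ ξ₁ ∈ A₁ → Sum.elim v₂ ξ₂ ∈ A₂ →
      ξ₁ ⬝ᵥ v₂ = ξ₂ ⬝ᵥ v₁ := by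
    intro v₁ ξ₁ v₂ ξ₂ h₁ h₂
    let f : MvPolynomial ((ι ⊕ ι) ⊕ (ι ⊕ ι)) K :=
      ∑ i, X (Sum.inl (Sum.inr i)) * X (Sum.inr (Sum.inl i)) -
        ∑ i, X (Sum.inr (Sum.inr i)) * X (Sum.inl (Sum.inl i))
    have hf : ∀ v₁ ξ₁ v₂ ξ₂ : ι → K, aeval (Sum.elim (Sum.elim v₁ ξ₁) (Sum.elim v₂ ξ₂)) f =
        ξ₁ ⬝ᵥ v₂ - ξ₂ ⬝ᵥ v₁ := by
      intro v₁ ξ₁ v₂ ξ₂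
      simp [f, dotProduct]
    have hfB : f ∈ vanishingIdeal K B := by
      intro x hx
      obtain ⟨x, y, rfl⟩ := exists_elim_eq x
      obtain ⟨v₁, ξ₁, rfl⟩ := exists_elim_eq x
      obtain ⟨v₂, ξ₂, rfl⟩ := exists_elim_eq y
      rw [hf, hsymm _ _ _ _ hx, sub_self]
    rw [← hI] at hfB
    rw [← sub_eq_zero, ← hf]
    exact hfB _ (elim_mem_prodSet.mpr ⟨h₁, h₂⟩)
  -- scaling `ξ₁` alone shows that both sides vanish
  have hzero : ∀ v₁ ξ₁ v₂ ξ₂, Sum.elim v₁ ξ₁ ∈ A₁ → Sum.elim v₂ ξ₂ ∈ A₂ →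
      ξ₁ ⬝ᵥ v₂ = 0 ∧ ξ₂ ⬝ᵥ v₁ = 0 := by
    intro v₁ ξ₁ v₂ ξ₂ h₁ h₂
    obtain ⟨t, ht⟩ := (Set.toFinite ({0, 1} : Set K)).exists_notMem
    simp only [Set.mem_insert_iff, Set.mem_singleton_iff, not_or] at ht
    have h₃ : Sum.elim v₁ (t • ξ₁) ∈ A₁ := by
      obtain ⟨u, x, hx, hux⟩ := h₁
      refine ⟨![1, Units.mk0 t ht.1] * u, x, hx, ?_⟩
      rw [torusAct_mul, ← hux, torusAct_incidenceWeight]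
      simp [Units.smul_def]
    have h4 := hsymm' _ _ _ _ h₁ h₂
    have h5 := hsymm' _ _ _ _ h₃ h₂
    rw [smul_dotProduct, smul_eq_mul, ← h4] at h5
    have h6 : (t - 1) * (ξ₁ ⬝ᵥ v₂) = 0 := by linear_combination h5
    have h7 := (mul_eq_zero.mp h6).resolve_left (sub_ne_zero.mpr ht.2)
    exact ⟨h7, h4 ▸ h7⟩
  let U₁ := Submodule.span K {v | ∃ ξ, Sum.elim v ξ ∈ A₁}
  let U₂ := Submodule.span K {v | ∃ ξ, Sum.elim v ξ ∈ A₂}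
  have hsub : ∀ {A A' : Set (ι ⊕ ι → K)}, (∀ v ξ v' ξ', Sum.elim v ξ ∈ A → Sum.elim v' ξ' ∈ A' →
      ξ ⬝ᵥ v' = 0) → A ⊆ prodSubmodule (Submodule.span K {v | ∃ ξ, Sum.elim v ξ ∈ A})
        (perp (Submodule.span K {v | ∃ ξ, Sum.elim v ξ ∈ A'})) := by
    intro A A' h x hx
    obtain ⟨v, ξ, rfl⟩ := exists_elim_eq x
    refine mem_prodSubmodule.mpr ⟨Submodule.subset_span ⟨ξ, hx⟩, fun u hu => ?_⟩
    induction hu using Submodule.span_induction with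
    | mem u hu => obtain ⟨ξ', hu⟩ := hu; exact h _ _ _ _ hx hu
    | zero => exact dotProduct_zero _
    | add a b _ _ ha hb => rw [dotProduct_add, ha, hb, add_zero]
    | smul c a _ ha => rw [dotProduct_smul, ha, smul_zero]
  have hA₁U : A₁ ⊆ prodSubmodule U₁ (perp U₂) :=
    hsub fun v ξ v' ξ' h h' => (hzero v ξ v' ξ' h h').1
  have hA₂U : A₂ ⊆ prodSubmodule U₂ (perp U₁) :=
    hsub fun v ξ v' ξ' h h' => (hzero v' ξ' v ξ h' h).2
  have hL₁ := zdim_mono hA₁ (zirred_submodule _) hA₁U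
  have hL₂ := zdim_mono hA₂ (zirred_submodule _) hA₂U
  rw [zdim_submodule, finrank_prodSubmodule] at hL₁ hL₂
  have hp₁ := finrank_perp U₁
  have hp₂ := finrank_perp U₂
  have hI₁ := vanishingIdeal_eq_of_zdim_le (zirred_submodule _) hA₁ (vanishingIdeal_anti_mono hA₁U)
    (by rw [zdim_submodule, finrank_prodSubmodule]; omega)
  have hI₂ := vanishingIdeal_eq_of_zdim_le (zirred_submodule _) hA₂ (vanishingIdeal_anti_mono hA₂U)
    (by rw [zdim_submodule, finrank_prodSubmodule]; omega)
  have hU : U₁ = U₂ := by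
    refine Submodule.eq_of_le_of_finrank_eq (fun v hv => mem_of_perp_le fun ξ hξ => ?_) (by omega)
    have h1 : pairingPoly K ι ∈ vanishingIdeal K A₁ := by
      intro x hx
      obtain ⟨v, ξ, rfl⟩ := exists_elim_eq x
      rw [aeval_pairingPoly]
      exact hT₁.form_vec (hAT₁ hx)
    rw [← hI₁] at h1
    rw [← aeval_pairingPoly (k := K)]
    exact h1 _ (mem_prodSubmodule.mpr ⟨hv, hξ⟩)
  rw [← hU] at hA₁U hA₂U hI₁ hI₂
  have hcon : ∀ {T A : Set (ι ⊕ ι → K)}, IsCone k T → A ⊆ T →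
      A ⊆ prodSubmodule U₁ (perp U₁) → A ⊆ conormalVectors U₁ := by
    intro T A hT hAT hAU x hx
    obtain ⟨v, ξ, rfl⟩ := exists_elim_eq x
    exact ⟨hT.vec_ne_zero (hAT hx), hAU hx⟩
  have hideal : ∀ {T A : Set (ι ⊕ ι → K)}, IsCone k T → A ⊆ T → ZIrred K A →
      A ⊆ prodSubmodule U₁ (perp U₁) → Fintype.card ι ≤ zdim K A →
      vanishingIdeal K (prodSubmodule U₁ (perp U₁) : Set (ι ⊕ ι → K)) = vanishingIdeal K A →
      vanishingIdeal k T = vanishingIdeal k (conormalVectors U₁) := by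
    intro T A hT hAT hA hAU hdA hIA
    rw [← hT.vanishingIdeal_eq hAT hA hdA]
    refine le_antisymm ?_ (vanishingIdeal_anti_mono (hcon hT hAT hAU))
    exact (vanishingIdeal_mono_base hIA.ge).trans (vanishingIdeal_anti_mono fun x hx => hx.2)
  refine ⟨U₁, fun x hx => ⟨hcon hT₁ hAT₁ hA₁U (hBA₁ x hx), hcon hT₂ hAT₂ hA₂U (hBA₂ x hx)⟩,
    hideal hT₁ hAT₁ hA₁ hA₁U (by omega) hI₁, hideal hT₂ hAT₂ hA₂ hA₂U (by omega) hI₂⟩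

/-- The dimension of an irreducible subset of `conormalQuadricPairs T₁ T₂` is at most that of the
space of quadratic forms, unless both sets of covectors are conormal to the same linear
subspace. -/
theorem zdim_le_or_exists_eq_conormalVectors (hT₁ : IsCone k T₁) (hT₂ : IsCone k T₂)
    {S : Set (ι ⊕ ι ⊕ Sym2 ι → K)} (hST : S ⊆ conormalQuadricPairs T₁ T₂) (hS : ZIrred K S) :
    zdim K S ≤ Fintype.card (Sym2 ι) ∨ ∃ U : Submodule K (ι → K), 2 ≤ finrank K U ∧
      (∀ v₁ v₂ η, Sum.elim v₁ (Sum.elim v₂ η) ∈ S → Sum.elim v₁ (codiff v₁ η) ∈ conormalVectors U ∧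
        Sum.elim v₂ (codiff v₂ η) ∈ conormalVectors U) ∧
      vanishingIdeal k T₁ = vanishingIdeal k (conormalVectors U) ∧
      vanishingIdeal k T₂ = vanishingIdeal k (conormalVectors U) := by
  let τ := ι ⊕ ι ⊕ Sym2 ι
  let a₁ : ι → τ := Sum.inl
  let a₂ : ι → τ := fun i => Sum.inr (Sum.inl i)
  let b : Sym2 ι → τ := fun s => Sum.inr (Sum.inr s)
  let p : (ι ⊕ ι) ⊕ (ι ⊕ ι) → MvPolynomial τ K := Sum.elim (pointPoly K a₁ b) (pointPoly K a₂ b)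
  have hp : ∀ (v₁ v₂ : ι → K) (η : Sym2 ι → K), polyMap p (Sum.elim v₁ (Sum.elim v₂ η)) =
      Sum.elim (Sum.elim v₁ (codiff v₁ η)) (Sum.elim v₂ (codiff v₂ η)) := by
    intro v₁ v₂ η
    ext i
    rcases i with i | i
    · exact congrFun (polyMap_pointPoly a₁ b (Sum.elim v₁ (Sum.elim v₂ η))) i
    · exact congrFun (polyMap_pointPoly a₂ b (Sum.elim v₁ (Sum.elim v₂ η))) i
  have hSe : ∀ x ∈ S, ∃ v₁ v₂ η, x = Sum.elim v₁ (Sum.elim v₂ η) := by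
    intro x _
    obtain ⟨v₁, y, rfl⟩ := exists_elim_eq x
    obtain ⟨v₂, η, rfl⟩ := exists_elim_eq y
    exact ⟨v₁, v₂, η, rfl⟩
  obtain ⟨x₀, hx₀⟩ := hS.nonempty
  have hfib : zdim K S + 2 * Fintype.card ι ≤ zdim K (polyMap p '' S) + Fintype.card (Sym2 ι) + 1 := by
    obtain ⟨W, hWE, hxW, hW, -, hWc, hWd⟩ := exists_fibre
      (locClosed_conormalQuadricPairs hT₁.locClosed hT₂.locClosed) p hST hS hx₀
    obtain ⟨v₁, v₂, η, rfl⟩ := hSe x₀ hx₀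
    obtain ⟨⟨i, j, hij⟩, h1, h2⟩ := mem_conormalQuadricPairs.mp (hST hx₀)
    have hc : ∀ x ∈ W, ∃ η', x = Sum.elim v₁ (Sum.elim v₂ η') ∧ codiff v₁ η' = codiff v₁ η ∧
        codiff v₂ η' = codiff v₂ η := by
      intro x hx
      obtain ⟨u₁, y, rfl⟩ := exists_elim_eq x
      obtain ⟨u₂, η', rfl⟩ := exists_elim_eq y
      have := hWc _ hx
      rw [hp, hp, sum_elim_inj, sum_elim_inj, sum_elim_inj] at this
      obtain ⟨⟨rfl, h3⟩, rfl, h4⟩ := this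
      exact ⟨η', rfl, h3, h4⟩
    have h3 := zdim_le_zdim_image_inr hW fun x hx y hy => by
      obtain ⟨η₁, rfl, -⟩ := hc x hx
      obtain ⟨η₂, rfl, -⟩ := hc y hy
      rfl
    let π₁ : ι ⊕ Sym2 ι → MvPolynomial τ K := fun t => X (Sum.inr t)
    let π₂ : Sym2 ι → MvPolynomial (ι ⊕ Sym2 ι) K := fun t => X (Sum.inr t)
    have h4 := zdim_le_zdim_image_inr (hW.image π₁) (by
      rintro _ ⟨x, hx, rfl⟩ _ ⟨y, hy, rfl⟩
      rw [polyMap_X_comp, polyMap_X_comp]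
      obtain ⟨η₁, rfl, -⟩ := hc x hx
      obtain ⟨η₂, rfl, -⟩ := hc y hy
      rfl)
    have h5 := zdim_le_finrank (L := singularForms v₁ ⊤ ⊓ singularForms v₂ ⊤) η
      ((hW.image π₁).image π₂) (by
        rintro _ ⟨_, ⟨x, hx, rfl⟩, rfl⟩
        rw [polyMap_X_comp, polyMap_X_comp]
        have hx' := hWE hx
        obtain ⟨η', rfl, h5, h6⟩ := hc x hx
        obtain ⟨-, h7, h8⟩ := mem_conormalQuadricPairs.mp hx'
        change η' - η ∈ _
        rw [Submodule.mem_inf, mem_singularForms, mem_singularForms, perp_top, Submodule.mem_bot,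
          Submodule.mem_bot, sub_dotProduct, sub_dotProduct, codiff_sub, codiff_sub, h5, h6]
        refine ⟨⟨sub_eq_zero.mpr ?_, sub_self _⟩, sub_eq_zero.mpr ?_, sub_self _⟩
        · exact h7.2.1.trans h1.2.1.symm
        · exact h8.2.1.trans h2.2.1.symm)
    have h6 := finrank_singularForms_inf_le hij
    change _ ≤ zdim K (polyMap π₁ '' W) at h3
    change _ ≤ zdim K (polyMap π₂ '' (polyMap π₁ '' W)) at h4
    omega
  by_cases hd : 2 * Fintype.card ι ≤ zdim K (polyMap p '' S)
  · right
    obtain ⟨U, hU, hI₁, hI₂⟩ := exists_eq_conormalVectors hT₁ hT₂ (hS.image p)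
      (by
        rintro _ ⟨x, hx, rfl⟩
        obtain ⟨v₁, v₂, η, rfl⟩ := hSe x hx
        rw [hp]
        exact ⟨(hST hx).2.1.2.2, (hST hx).2.2.2.2⟩)
      (by
        rintro v₁ ξ₁ v₂ ξ₂ ⟨x, hx, he⟩
        obtain ⟨u₁, u₂, η, rfl⟩ := hSe x hx
        rw [hp, sum_elim_inj, sum_elim_inj, sum_elim_inj] at he
        obtain ⟨⟨rfl, rfl⟩, rfl, rfl⟩ := he
        exact codiff_dot_comm _ _ _) hd
    have hU' : ∀ v₁ v₂ η, Sum.elim v₁ (Sum.elim v₂ η) ∈ S →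
        Sum.elim v₁ (codiff v₁ η) ∈ conormalVectors U ∧
        Sum.elim v₂ (codiff v₂ η) ∈ conormalVectors U := fun v₁ v₂ η h => by
      have := hU _ ⟨_, h, rfl⟩
      rwa [hp] at this
    refine ⟨U, ?_, hU', hI₁, hI₂⟩
    obtain ⟨v₁, v₂, η, rfl⟩ := hSe x₀ hx₀
    obtain ⟨⟨i, j, hij⟩, -, -⟩ := mem_conormalQuadricPairs.mp (hST hx₀)
    obtain ⟨l₁, l₂, h11, h12, h21, h22⟩ := exists_dual_pair hij
    have h1 := (mem_conormalVectors.mp (hU' _ _ _ hx₀).1).2.1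
    have h2 := (mem_conormalVectors.mp (hU' _ _ _ hx₀).2).2.1
    have hli : LinearIndependent K ![(⟨v₁, h1⟩ : U), ⟨v₂, h2⟩] := by
      rw [LinearIndependent.pair_iff]
      intro s t hst
      have hst' : s • v₁ + t • v₂ = 0 := congrArg Subtype.val hst
      have h3 := congrArg (fun x => l₁ ⬝ᵥ x) hst'
      have h4 := congrArg (fun x => l₂ ⬝ᵥ x) hst'
      simp only [dotProduct_add, dotProduct_smul, h11, h12, h21, h22, dotProduct_zero,
        smul_eq_mul, mul_one, mul_zero, add_zero, zero_add] at h3 h4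
      exact ⟨h3, h4⟩
    simpa using hli.fintype_card_le_finrank
  · left
    omega

end UpperBounds

/-! ### Dimensions of irreducible components of torus quotients -/

section Components

open MvPolynomial Module TopologicalSpace

set_option linter.unusedSectionVars false

namespace TorusQuotient

variable {k K : Type*} [Field k] [Field K] [Algebra k K] {ι σ τ : Type} [Fintype ι] [DecidableEq ι]
  {H X : Type*} [TopologicalSpace X] [IsAlgClosed K] [Algebra.IsAlgebraic k K] [Finite σ] [Finite τ]
  {w : σ → ι → ℤ} {coord : H → σ → K} {q : H → X}

theorem noetherianSpace (h : TorusQuotient k w coord q) : NoetherianSpace X := by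
  refine ((noetherianSpace_TFAE X).out 0 1).mpr ?_
  have hanti : StrictAnti fun Z : Closeds X => vanishingIdeal k (liftSet coord q (Z : Set X)) := by
    intro Z Z' hZ
    refine lt_of_le_of_ne (vanishingIdeal_anti_mono (Set.image_mono (Set.preimage_mono hZ.le))) ?_
    intro he
    change vanishingIdeal k _ = vanishingIdeal k _ at he
    refine hZ.not_ge fun x hx => ?_
    obtain ⟨a, rfl⟩ := h.surj x
    have : q a ∈ closure (Z : Set X) := by
      rw [h.mem_closure_iff, ← he]
      exact zeroLocus_vanishingIdeal_le _ (h.mem_liftSet.mpr hx)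
    rwa [Z.isClosed.closure_eq] at this
  exact hanti.wellFoundedLT

variable {E : Set (τ → K)} {p : σ → MvPolynomial τ K} {Y : Set X} {d : ℕ}

/-- If the coordinate vectors of the points of `Y` are parametrized, with finite fibres, by a
set all of whose components have the same dimension, then all irreducible components of `Y` have
the corresponding dimension. -/
theorem topologicalKrullDim_irreducibleComponent (h : TorusQuotient k w coord q) (hE : LocClosed E)
    (hY : liftSet coord q Y = polyMap p '' E)
    (hfin : ∀ x ∈ E, {y ∈ E | polyMap p y = polyMap p x}.Finite)
    (hup : ∀ W ⊆ E, ZIrred K W → zdim K W ≤ Fintype.card ι + d)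
    (hlow : ∀ e ∈ E, ∃ W ⊆ E, e ∈ W ∧ ZIrred K W ∧ Fintype.card ι + d ≤ zdim K W)
    {S : Set Y} (hS : S ∈ irreducibleComponents Y) : topologicalKrullDim S = d := by
  have := h.noetherianSpace
  rw [IsHomeomorph.topologicalKrullDim_eq _
    (Topology.IsEmbedding.subtypeVal.homeomorphImage S).isHomeomorph]
  refine le_antisymm (h.topologicalKrullDim_le (E := E) (p := p) ?_ hup) ?_
  · rw [← hY]
    exact Set.image_mono (Set.preimage_mono (by simp))
  obtain ⟨_, ⟨U, hU, rfl⟩, ⟨y, hy⟩, hUS⟩ :=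
    NoetherianSpace.exists_isOpen_nonempty_subset_irreducibleComponent S hS
  obtain ⟨a, ha⟩ := h.surj y.1
  obtain ⟨f, hfa, hf⟩ := h.isOpen_iff.mp hU a (ha ▸ hy)
  have haY : coord a ∈ liftSet coord q Y := h.mem_liftSet.mpr (ha ▸ y.2)
  rw [hY] at haY
  obtain ⟨e, he, hea⟩ := haY
  let g : MvPolynomial τ K := aeval p (MvPolynomial.map (algebraMap k K) f)
  have hg : ∀ x : τ → K, aeval x g = aeval (polyMap p x) f := fun x => by
    simp only [g]
    rw [← aeval_polyMap, aeval_map_algebraMap]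
  obtain ⟨W, hWE, heW, hW, hd⟩ := hlow e he
  have hge : aeval e g ≠ 0 := by rwa [hg, hea]
  have hI := hW.vanishingIdeal_inter ⟨e, heW, hge⟩
  refine h.le_topologicalKrullDim (hE.inter (LocClosed.principal g)) (p := p) ?_
    (fun x hx => (hfin x hx.1).subset fun y hy => ⟨hy.1.1, hy.2⟩)
    (S := {x ∈ W | aeval x g ≠ 0}) (fun x hx => ⟨hWE hx.1, hx.2⟩) (hW.of_vanishingIdeal_eq hI)
    (by rwa [zdim_congr hI])
  rintro x ⟨hx, hgx⟩
  have hxY : polyMap p x ∈ liftSet coord q Y := hY ▸ ⟨x, hx, rfl⟩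
  obtain ⟨b, hb, hbx⟩ := hxY
  refine ⟨b, ⟨⟨q b, hb⟩, hUS (hf b ?_), rfl⟩, hbx⟩
  rw [hbx, ← hg]
  exact hgx

/-- If the coordinate vectors of the points of `Y` are parametrized with finite fibres, the
dimension of `Y` is that of the parameter space minus the rank of the torus. -/
theorem topologicalKrullDim_eq (h : TorusQuotient k w coord q) (hE : LocClosed E)
    (hY : liftSet coord q Y = polyMap p '' E)
    (hfin : ∀ x ∈ E, {y ∈ E | polyMap p y = polyMap p x}.Finite)
    (hup : ∀ W ⊆ E, ZIrred K W → zdim K W ≤ Fintype.card ι + d)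
    (hlow : ∃ W ⊆ E, ZIrred K W ∧ Fintype.card ι + d ≤ zdim K W) : topologicalKrullDim Y = d := by
  obtain ⟨W, hWE, hW, hd⟩ := hlow
  exact le_antisymm (h.topologicalKrullDim_le hY.le hup) (h.le_topologicalKrullDim hE
    (fun e he => hY ▸ ⟨e, he, rfl⟩) hfin hWE hW hd)

end TorusQuotient

theorem topologicalKrullDim_projSpace (k : Type*) {K : Type*} [Field k] [Field K] [Algebra k K]
    [IsAlgClosed K] [Algebra.IsAlgebraic k K] (κ : Type) [Fintype κ] {d : ℕ}
    (hd : Fintype.card κ = 1 + d) : topologicalKrullDim (ProjSpace k K κ) = d := by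
  have hκ : Nonempty κ := Fintype.card_pos_iff.mp (by omega)
  have h := torusQuotient_projSpace (k := k) (K := K) (κ := κ)
  rw [← IsHomeomorph.topologicalKrullDim_eq _ (Homeomorph.Set.univ (ProjSpace k K κ)).isHomeomorph]
  let E : Set (κ → K) := {x | x ≠ 0}
  have hI : ∀ s : κ, ZIrred K {x ∈ (Set.univ : Set (κ → K)) | aeval x (X s : MvPolynomial κ K) ≠ 0} ∧
      zdim K {x ∈ (Set.univ : Set (κ → K)) | aeval x (X s : MvPolynomial κ K) ≠ 0} =
        Fintype.card κ := by
    intro s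
    have h1 := (zirred_univ (k := K) (K := K) (σ := κ)).vanishingIdeal_inter (f := X s)
      ⟨1, trivial, by simp⟩
    exact ⟨zirred_univ.of_vanishingIdeal_eq h1, (zdim_congr h1).trans zdim_univ⟩
  refine h.topologicalKrullDim_eq (E := E) (p := X) ?_ ?_ ?_ ?_ ?_
  · exact LocClosed.of_forall ∅ (Set.range X) fun x => by simp [E, Function.ne_iff]
  · rw [polyMap_X_image]
    ext x
    exact ⟨fun ⟨a, _, ha⟩ => ha ▸ a.2, fun hx => ⟨⟨x, hx⟩, trivial, rfl⟩⟩
  · intro x _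
    refine (Set.finite_singleton x).subset fun y hy => ?_
    have := hy.2
    rwa [polyMap_X, polyMap_X] at this
  · intro W _ _
    exact zdim_le_card.trans (by rw [hd, Fintype.card_unit])
  · obtain ⟨s⟩ := hκ
    refine ⟨_, fun x hx hx0 => hx.2 (by simp [hx0]), (hI s).1, ?_⟩
    rw [(hI s).2, hd, Fintype.card_unit]

end Components

/-! ### Coordinate vectors of the sets of the statement -/

section Coordinates

open MvPolynomial Module

set_option linter.unusedSectionVars false

variable {k K : Type*} [Field k] [Field K] [Algebra k K] {ι : Type} [Fintype ι] [DecidableEq ι]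

/-- The set of homogeneous coordinate vectors of a set of cotangent vectors. -/
def cotangentLift (C : Set (Cotangent k K ι)) : Set (ι ⊕ ι → K) :=
  liftSet (fun w : CotangentCoord K ι => Sum.elim w.vec w.form) (fun w => Cotangent.mk k w) C

theorem mem_cotangentLift {C : Set (Cotangent k K ι)} (w : CotangentCoord K ι) :
    Sum.elim w.vec w.form ∈ cotangentLift C ↔ Cotangent.mk k w ∈ C :=
  torusQuotient_cotangent.mem_liftSet

theorem exists_of_mem_cotangentLift {C : Set (Cotangent k K ι)} {v ξ : ι → K}
    (h : Sum.elim v ξ ∈ cotangentLift C) :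
    ∃ w : CotangentCoord K ι, w.vec = v ∧ w.form = ξ ∧ Cotangent.mk k w ∈ C := by
  obtain ⟨w, hw, he⟩ := h
  exact ⟨w, (sum_elim_inj.mp he).1, (sum_elim_inj.mp he).2, hw⟩

variable [IsAlgClosed K] [Algebra.IsAlgebraic k K]

theorem isConicalSet_cotangentLift {C : Set (Cotangent k K ι)} (hC : IsClosed C)
    (hirr : IsIrreducible C) (hcon : IsConical C) : IsConicalSet k (cotangentLift C) where
  mem_iff v ξ := by
    constructor
    · intro h
      obtain ⟨w, rfl, rfl, -⟩ := exists_of_mem_cotangentLift h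
      exact ⟨w.vec_ne_zero, w.form_vec, zeroLocus_vanishingIdeal_le _ h⟩
    · rintro ⟨hv, hξ, h⟩
      let w : CotangentCoord K ι := ⟨v, ξ, hv, hξ⟩
      have h1 := (torusQuotient_cotangent (k := k)).mem_closure_iff (S := C) (a := w)
      rw [hC.closure_eq] at h1
      exact (mem_cotangentLift w).mpr (h1.mpr h)
  irred := torusQuotient_cotangent.isIrreducible_iff.mp hirr
  smul_mem := by
    intro s t hs ht v ξ h
    obtain ⟨w, rfl, rfl, hw⟩ := exists_of_mem_cotangentLift h
    have h1 := hcon (Units.mk0 s hs * Units.mk0 t ht) w hw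
    rw [← mem_cotangentLift] at h1
    have h2 := (torusQuotient_cotangent (k := k)).torusAct_mem_liftSet h1
      (fun _ => Units.mk0 s hs)
    rw [torusAct_cotangentWeight] at h2
    have h3 : t • w.form = (Units.mk0 s hs)⁻¹ • (Units.mk0 s hs * Units.mk0 t ht) • w.form := by
      rw [smul_smul, inv_mul_cancel_left]
      rfl
    rw [h3]
    exact h2

/-- The scaling of coordinates makes the set of coordinate vectors one dimension larger than `C`. -/
theorem isCone_cotangentLift {C : Set (Cotangent k K ι)} (hC : IsClosed C)
    (hirr : IsIrreducible C) (hcon : IsConical C) {n : ℕ} (hn : 1 ≤ n)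
    (hι : Fintype.card ι = n + 1) (hdim : topologicalKrullDim C = n) :
    IsCone k (cotangentLift C) where
  toIsConicalSet := isConicalSet_cotangentLift hC hirr hcon
  dim := by
    have hT := isConicalSet_cotangentLift hC hirr hcon
    have h := torusQuotient_cotangent (k := k) (K := K) (κ := ι)
    obtain ⟨c, hc⟩ := hT.irred.nonempty
    obtain ⟨W, hWT, -, hW, hd⟩ := hT.exists_component hc
    have h1 : ∀ m, 1 + m ≤ zdim k (cotangentLift C) → m ≤ n := by
      intro m hm
      have := h.le_topologicalKrullDim hT.locClosed (p := X) (Y := C)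
        (fun e he => by rw [polyMap_X]; exact he)
        (fun x _ => (Set.finite_singleton x).subset fun y hy => by
          have := hy.2
          rwa [polyMap_X, polyMap_X] at this) hWT hW (m := m) (by rwa [hd, Fintype.card_unit])
      rw [hdim] at this
      exact_mod_cast this
    have h2 := h.topologicalKrullDim_le (E := cotangentLift C) (p := X) (Y := C)
      (by rw [polyMap_X_image]; exact subset_rfl) (m := zdim k (cotangentLift C) - 1)
      fun W' hW'T hW' => by
        have := zdim_mono hW'.base hT.irred hW'T
        rw [zdim_base hW'] at this
        rw [Fintype.card_unit]
        omega
    rw [hdim] at h2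
    have h3 : n ≤ zdim k (cotangentLift C) - 1 := by exact_mod_cast h2
    have h4 := h1 (zdim k (cotangentLift C) - 1) (by omega)
    omega

theorem veronese_eq_iff {v v' : ι → K} : veronese v = veronese v' ↔ v = v' ∨ v = -v' := by
  constructor
  · intro h
    have h1 : ∀ a b, v a * v b = v' a * v' b := fun a b => by
      rw [← veronese_mk, ← veronese_mk, h]
    by_cases hv : v = 0
    · left
      rw [hv]
      ext a
      have := h1 a a
      rw [hv, Pi.zero_apply, zero_mul] at this
      exact (mul_self_eq_zero.mp this.symm).symm
    obtain ⟨a, ha⟩ := Function.ne_iff.mp hv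
    rcases mul_self_eq_mul_self_iff.mp (h1 a a) with h2 | h2
    · left
      ext b
      have := h1 a b
      rw [← h2] at this
      exact mul_left_cancel₀ ha this
    · right
      ext b
      have := h1 a b
      rw [← neg_eq_iff_eq_neg.mpr h2, neg_mul, ← mul_neg] at this
      exact mul_left_cancel₀ ha this
  · rintro (rfl | rfl)
    · rfl
    · ext s
      induction s with
      | _ a b => simp [veronese_mk]

/-- A nonzero multiple of a point of the Veronese cone is again in the Veronese cone. -/
theorem exists_veronese_eq_smul {s : K} (hs : s ≠ 0) (v : ι → K) :
    ∃ r : K, r ≠ 0 ∧ veronese (r • v) = s • veronese v := by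
  obtain ⟨r, hr⟩ := IsAlgClosed.exists_pow_nat_eq s (n := 2) two_pos
  exact ⟨r, fun h => hs (by rw [← hr, h]; simp), by rw [veronese_smul, hr]⟩

/-- The points of `P(i_∘ C)`, in terms of the parametrization of the incidence variety by pairs of a
vector `v` and a quadratic form. -/
theorem ofCoord_mem_projectivization_iff {C : Set (Cotangent k K ι)}
    (hT : IsConicalSet k (cotangentLift C)) (a : CotangentCoord K (Sym2 ι)) (ha : a.form ≠ 0) :
    Incidence.ofCoord k a ha ∈ projectivization (veronesePush C) ↔
      ∃ v, veronese v = a.vec ∧ Sum.elim v a.form ∈ conormalQuadrics (cotangentLift C) := by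
  constructor
  · rintro ⟨b, hb, ⟨u, huC, hbu⟩, hab⟩
    obtain ⟨⟨s, hs⟩, t, ht⟩ := (incidence_ofCoord_eq_iff _ _).mp hab
    obtain ⟨r, hr1, hr2⟩ := Quotient.exact hbu
    obtain ⟨c, hc, hcv⟩ := exists_veronese_eq_smul (s := ((s⁻¹ * r⁻¹ : Kˣ) : K))
      (Units.ne_zero _) u.vec
    have h1 : a.vec = s⁻¹ • r⁻¹ • veronese u.vec := by
      change veronese u.vec = r • b.vec at hr1
      rw [hr1, inv_smul_smul, hs, inv_smul_smul]
    have h2 : a.form = (t⁻¹ * r) • u.form := by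
      change u.form = r⁻¹ • b.form at hr2
      rw [hr2, mul_smul, smul_inv_smul, ht, inv_smul_smul]
    have h3 : veronese (c • u.vec) = a.vec := by
      rw [hcv, h1, smul_smul, Units.smul_def]
    refine ⟨c • u.vec, h3, mem_conormalQuadrics.mpr ⟨ha, ?_, ?_⟩⟩
    · rw [h3]; exact a.form_vec
    · rw [← mem_cotangentLift] at huC
      rw [h2, Units.smul_def, codiff_smul, codiff_smul_vec, smul_smul]
      exact hT.smul_mem hc (mul_ne_zero (Units.ne_zero _) hc) huC
  · rintro ⟨v, hv, h⟩
    obtain ⟨-, hquad, hvC⟩ := mem_conormalQuadrics.mp h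
    let u : VeroneseCoord K ι := ⟨v, a.form, hT.vec_ne_zero hvC, hquad⟩
    have hau : a = u.target := CotangentCoord.ext hv.symm rfl
    exact ⟨a, ha, ⟨u, (mem_cotangentLift u.source).mp hvC, by rw [hau]⟩, rfl⟩

end Coordinates

/-! ### Dimensions of the intersections -/

section Intersection

open MvPolynomial Module

set_option linter.unusedSectionVars false

variable {k K : Type*} [Field k] [Field K] [Algebra k K] {ι : Type} [Fintype ι] [DecidableEq ι]

/-- The Veronese map as a family of polynomials. -/
def veronesePoly (K : Type*) [Field K] {τ : Type} (a : ι → τ) : Sym2 ι → MvPolynomial τ K :=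
  fun s => rename a (quadMonomial K s)

theorem aeval_veronesePoly {τ : Type} (a : ι → τ) (s : Sym2 ι) (x : τ → K) :
    aeval x (veronesePoly K a s) = veronese (x ∘ a) s := by
  rw [veronesePoly, aeval_rename, aeval_quadMonomial]

/-- The pair of the Veronese image of a vector and a quadratic form, as a polynomial map. -/
def incidencePoly (K : Type*) [Field K] (ι : Type) :
    Sym2 ι ⊕ Sym2 ι → MvPolynomial (ι ⊕ Sym2 ι) K :=
  Sum.elim (veronesePoly K Sum.inl) (fun s => X (Sum.inr s))

theorem polyMap_incidencePoly (v : ι → K) (η : Sym2 ι → K) :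
    polyMap (incidencePoly K ι) (Sum.elim v η) = Sum.elim (veronese v) η := by
  ext i
  rcases i with i | i
  · exact aeval_veronesePoly _ _ _
  · simp [polyMap, incidencePoly]

/-- The triple of the Veronese images of two vectors and a quadratic form, as a polynomial map. -/
def incidencePairPoly (K : Type*) [Field K] (ι : Type) :
    Sym2 ι ⊕ Sym2 ι ⊕ Sym2 ι → MvPolynomial (ι ⊕ ι ⊕ Sym2 ι) K :=
  Sum.elim (veronesePoly K Sum.inl)
    (Sum.elim (veronesePoly K fun i => Sum.inr (Sum.inl i)) fun s => X (Sum.inr (Sum.inr s)))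

theorem polyMap_incidencePairPoly (v₁ v₂ : ι → K) (η : Sym2 ι → K) :
    polyMap (incidencePairPoly K ι) (Sum.elim v₁ (Sum.elim v₂ η)) =
      Sum.elim (veronese v₁) (Sum.elim (veronese v₂) η) := by
  ext i
  rcases i with i | i | i
  · exact aeval_veronesePoly _ _ _
  · exact aeval_veronesePoly _ _ _
  · simp [polyMap, incidencePairPoly]

variable [IsAlgClosed K] [Algebra.IsAlgebraic k K]

theorem finite_fibre_incidencePoly (E : Set (ι ⊕ Sym2 ι → K)) (x : ι ⊕ Sym2 ι → K) :
    {y ∈ E | polyMap (incidencePoly K ι) y = polyMap (incidencePoly K ι) x}.Finite := by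
  obtain ⟨v, η, rfl⟩ := exists_elim_eq x
  refine (Set.toFinite {Sum.elim v η, Sum.elim (-v) η}).subset ?_
  rintro y ⟨-, hy⟩
  obtain ⟨v', η', rfl⟩ := exists_elim_eq y
  rw [polyMap_incidencePoly, polyMap_incidencePoly, sum_elim_inj, veronese_eq_iff] at hy
  obtain ⟨rfl | rfl, rfl⟩ := hy
  · exact Or.inl rfl
  · exact Or.inr rfl

theorem finite_fibre_incidencePairPoly (E : Set (ι ⊕ ι ⊕ Sym2 ι → K)) (x : ι ⊕ ι ⊕ Sym2 ι → K) :
    {y ∈ E | polyMap (incidencePairPoly K ι) y = polyMap (incidencePairPoly K ι) x}.Finite := by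
  obtain ⟨v₁, x, rfl⟩ := exists_elim_eq x
  obtain ⟨v₂, η, rfl⟩ := exists_elim_eq x
  refine (Set.toFinite {Sum.elim v₁ (Sum.elim v₂ η), Sum.elim v₁ (Sum.elim (-v₂) η),
    Sum.elim (-v₁) (Sum.elim v₂ η), Sum.elim (-v₁) (Sum.elim (-v₂) η)}).subset ?_
  rintro y ⟨-, hy⟩
  obtain ⟨u₁, y, rfl⟩ := exists_elim_eq y
  obtain ⟨u₂, η', rfl⟩ := exists_elim_eq y
  rw [polyMap_incidencePairPoly, polyMap_incidencePairPoly, sum_elim_inj, sum_elim_inj,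
    veronese_eq_iff, veronese_eq_iff] at hy
  obtain ⟨rfl | rfl, rfl | rfl, rfl⟩ := hy <;> simp

/-- The coordinate vectors of the points of `P(i_∘ C)` are parametrized, two to one, by
`conormalQuadrics`. -/
theorem liftSet_projectivization {C : Set (Cotangent k K ι)}
    (hT : IsConicalSet k (cotangentLift C)) :
    liftSet (fun w : {w : CotangentCoord K (Sym2 ι) // w.form ≠ 0} => Sum.elim w.1.vec w.1.form)
      (fun w => Incidence.ofCoord k w.1 w.2) (projectivization (veronesePush C)) =
      polyMap (incidencePoly K ι) '' conormalQuadrics (cotangentLift C) := by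
  ext x
  constructor
  · rintro ⟨⟨a, ha⟩, haZ, rfl⟩
    obtain ⟨v, hv, h⟩ := (ofCoord_mem_projectivization_iff hT a ha).mp haZ
    exact ⟨_, h, by rw [polyMap_incidencePoly, hv]⟩
  · rintro ⟨x, hx, rfl⟩
    obtain ⟨v, η, rfl⟩ := exists_elim_eq x
    obtain ⟨hη, hquad, hvT⟩ := mem_conormalQuadrics.mp hx
    rw [polyMap_incidencePoly]
    exact ⟨⟨⟨veronese v, η, veronese_ne_zero (hT.vec_ne_zero hvT), hquad⟩, hη⟩,
      (ofCoord_mem_projectivization_iff hT _ _).mpr ⟨v, rfl, hx⟩, rfl⟩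

/-- Two nonzero vectors are independent if and only if their images under the Veronese map are not
proportional. -/
theorem exists_minor_ne_zero_iff {v₁ v₂ : ι → K} (h₁ : v₁ ≠ 0) (h₂ : v₂ ≠ 0) :
    (∃ a b, v₁ a * v₂ b - v₁ b * v₂ a ≠ 0) ↔ ¬ ∃ t : Kˣ, veronese v₂ = t • veronese v₁ := by
  constructor
  · rintro ⟨a, b, hab⟩ ⟨t, ht⟩
    obtain ⟨r, -, hr⟩ := exists_veronese_eq_smul t.ne_zero v₁
    rw [Units.smul_def, ← hr, veronese_eq_iff] at ht
    apply hab
    rcases ht with rfl | rfl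
    · simp only [Pi.smul_apply, smul_eq_mul]; ring
    · simp only [Pi.neg_apply, Pi.smul_apply, smul_eq_mul]; ring
  · intro h
    by_contra! hab
    obtain ⟨a, ha⟩ := Function.ne_iff.mp h₁
    have ha' : v₁ a ≠ 0 := ha
    have h3 : v₂ = (v₂ a / v₁ a) • v₁ := by
      ext b
      have := hab a b
      rw [Pi.smul_apply, smul_eq_mul, div_mul_eq_mul_div, eq_div_iff ha']
      linear_combination this
    have h4 : v₂ a / v₁ a ≠ 0 := fun h0 => h₂ (by rw [h3, h0, zero_smul])
    refine h ⟨Units.mk0 _ h4 ^ 2, ?_⟩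
    conv_lhs => rw [h3]
    rw [veronese_smul, Units.smul_def]
    simp

/-- The coordinate vectors of the points off the diagonal of the fibre product are parametrized with
finite fibres by `conormalQuadricPairs`. -/
theorem liftSet_offDiagonal {C₁ C₂ : Set (Cotangent k K ι)}
    (hT₁ : IsConicalSet k (cotangentLift C₁)) (hT₂ : IsConicalSet k (cotangentLift C₂)) :
    liftSet (fun w : PairCoord K (Sym2 ι) => Sum.elim w.vec₁ (Sum.elim w.vec₂ w.form))
      (fun w => IncidencePair.ofCoord k w) (offDiagonal (projectivization (veronesePush C₁))
        (projectivization (veronesePush C₂))) =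
      polyMap (incidencePairPoly K ι) ''
        conormalQuadricPairs (cotangentLift C₁) (cotangentLift C₂) := by
  ext x
  constructor
  · rintro ⟨a, ⟨h1, h2, hne⟩, rfl⟩
    obtain ⟨v₁, hv₁, h1⟩ := (ofCoord_mem_projectivization_iff hT₁ _ _).mp h1
    obtain ⟨v₂, hv₂, h2⟩ := (ofCoord_mem_projectivization_iff hT₂ _ _).mp h2
    dsimp only at hv₁ hv₂ h1 h2
    refine ⟨Sum.elim v₁ (Sum.elim v₂ a.form), ⟨?_, h1, h2⟩, ?_⟩
    · refine (exists_minor_ne_zero_iff (hT₁.vec_ne_zero h1.2.2) (hT₂.vec_ne_zero h2.2.2)).mpr ?_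
      rintro ⟨t, ht⟩
      refine hne ((incidence_ofCoord_eq_iff _ _).mpr ⟨⟨t, ?_⟩, 1, (one_smul _ _).symm⟩)
      change a.vec₂ = t • a.vec₁
      rw [← hv₁, ← hv₂]
      exact ht
    · rw [polyMap_incidencePairPoly, hv₁, hv₂]
  · rintro ⟨x, hx, rfl⟩
    obtain ⟨v₁, x, rfl⟩ := exists_elim_eq x
    obtain ⟨v₂, η, rfl⟩ := exists_elim_eq x
    obtain ⟨hminor, h1, h2⟩ := mem_conormalQuadricPairs.mp hx
    obtain ⟨hη, hquad₁, hvT₁⟩ := mem_conormalQuadrics.mp h1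
    obtain ⟨-, hquad₂, hvT₂⟩ := mem_conormalQuadrics.mp h2
    have hv₁ := hT₁.vec_ne_zero hvT₁
    have hv₂ := hT₂.vec_ne_zero hvT₂
    rw [polyMap_incidencePairPoly]
    refine ⟨⟨veronese v₁, veronese v₂, η, veronese_ne_zero hv₁, veronese_ne_zero hv₂, hη, hquad₁,
      hquad₂⟩, ⟨(ofCoord_mem_projectivization_iff hT₁ _ _).mpr ⟨v₁, rfl, h1⟩,
      (ofCoord_mem_projectivization_iff hT₂ _ _).mpr ⟨v₂, rfl, h2⟩, fun he => ?_⟩, rfl⟩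
    exact (exists_minor_ne_zero_iff hv₁ hv₂).mp hminor
      ((incidence_ofCoord_eq_iff _ _).mp he).1

theorem cotangentLift_conormal (U : Submodule K (ι → K)) :
    cotangentLift (conormal k U) = conormalVectors U := by
  ext x
  constructor
  · rintro ⟨a, ⟨w, hw, hwU, hwU'⟩, rfl⟩
    obtain ⟨t, h1, h2⟩ := Quotient.exact hw
    refine mem_conormalVectors.mpr ⟨a.vec_ne_zero, ?_, fun u hu => ?_⟩
    · rw [h1] at hwU
      have := U.smul_mem ((t⁻¹ : Kˣ) : K) hwU
      rwa [← Units.smul_def, inv_smul_smul] at this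
    · have := hwU' u hu
      rw [h2, smul_dotProduct, smul_eq_zero_iff_eq] at this
      exact this
  · intro hx
    obtain ⟨v, ξ, rfl⟩ := exists_elim_eq x
    obtain ⟨hv, hvU, hξ⟩ := mem_conormalVectors.mp hx
    exact ⟨⟨v, ξ, hv, hξ v hvU⟩, ⟨_, rfl, hvU, hξ⟩, rfl⟩

/-- A closed set is determined by the ideal over `k` of its coordinate vectors. -/
theorem eq_conormalClosure {C : Set (Cotangent k K ι)} (hC : IsClosed C)
    {U : Submodule K (ι → K)}
    (h : vanishingIdeal k (cotangentLift C) = vanishingIdeal k (conormalVectors U)) :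
    C = conormalClosure k U := by
  rw [conormalClosure, ← hC.closure_eq]
  ext x
  have hq := torusQuotient_cotangent (k := k) (K := K) (κ := ι)
  obtain ⟨a, rfl⟩ := hq.surj x
  rw [hq.mem_closure_iff, hq.mem_closure_iff]
  change _ ∈ zeroLocus K (vanishingIdeal k (cotangentLift C)) ↔
    _ ∈ zeroLocus K (vanishingIdeal k (cotangentLift (conormal k U)))
  rw [h, cotangentLift_conormal]

theorem topologicalKrullDim_projectivization {C : Set (Cotangent k K ι)}
    (hT : IsCone k (cotangentLift C)) (hne : (conormalQuadrics (cotangentLift C)).Nonempty) {d : ℕ}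
    (hd : Fintype.card (Sym2 ι) = 2 + d) :
    topologicalKrullDim (projectivization (veronesePush C)) = d := by
  refine (torusQuotient_incidence (k := k)).topologicalKrullDim_eq
    (locClosed_conormalQuadrics hT.locClosed) (liftSet_projectivization hT.toIsConicalSet)
    (fun x _ => finite_fibre_incidencePoly _ x) (fun W hWE hW => ?_) ?_
  · rw [Fintype.card_fin, ← hd]
    exact zdim_le_of_subset_conormalQuadrics hT hWE hW
  · obtain ⟨x, hx⟩ := hne
    obtain ⟨W, hWE, -, hW, h⟩ := exists_large_subset_conormalQuadrics hT hx
    exact ⟨W, hWE, hW, by rwa [Fintype.card_fin, ← hd]⟩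

/-- Conical sets of covectors of the dimension of the base intersect well, after push-forward by the Veronese embedding, unless both are conormal to the same linear subspace. -/
theorem intersectWell_of_not_exists {n : ℕ} (hι : Fintype.card ι = n + 1)
    {C₁ C₂ : Set (Cotangent k K ι)} (h₁ : IsClosed C₁) (hirr₁ : IsIrreducible C₁)
    (hcon₁ : IsConical C₁) (hdim₁ : topologicalKrullDim C₁ = n) (h₂ : IsClosed C₂)
    (hirr₂ : IsIrreducible C₂) (hcon₂ : IsConical C₂) (hdim₂ : topologicalKrullDim C₂ = n)
    (hexc : ¬ ∃ U : Submodule K (ι → K), 2 ≤ finrank K U ∧ C₁ = conormalClosure k U ∧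
      C₂ = conormalClosure k U) :
    IntersectWell (projectivization (veronesePush C₁)) (projectivization (veronesePush C₂)) := by
  intro S hS
  have hlift := liftSet_offDiagonal (isConicalSet_cotangentLift h₁ hirr₁ hcon₁)
    (isConicalSet_cotangentLift h₂ hirr₂ hcon₂)
  have hq := torusQuotient_incidencePair (k := k) (K := K) (κ := Sym2 ι)
  obtain ⟨x, hx⟩ : (conormalQuadricPairs (cotangentLift C₁) (cotangentLift C₂)).Nonempty := by
    obtain ⟨y, -⟩ := hS.1.nonempty
    obtain ⟨a, ha⟩ := hq.surj y.1
    have := hq.mem_liftSet.mpr (ha ▸ y.2)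
    rw [hlift] at this
    obtain ⟨x, hx, -⟩ := this
    exact ⟨x, hx⟩
  obtain ⟨⟨a, b, hab⟩, hx₁, hx₂⟩ := hx
  have hn : 2 ≤ Fintype.card ι := by
    refine Fintype.one_lt_card_iff.mpr ⟨a, b, ?_⟩
    rintro rfl
    exact hab (sub_self _)
  have hM : 3 ≤ Fintype.card (Sym2 ι) := by
    rw [Sym2.card]
    exact Nat.choose_le_choose 2 (Nat.succ_le_succ hn)
  obtain ⟨d, hd⟩ := Nat.exists_eq_add_of_le hM
  have hT₁ := isCone_cotangentLift h₁ hirr₁ hcon₁ (by omega) hι hdim₁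
  have hT₂ := isCone_cotangentLift h₂ hirr₂ hcon₂ (by omega) hι hdim₂
  have hS' := hq.topologicalKrullDim_irreducibleComponent
    (locClosed_conormalQuadricPairs hT₁.locClosed hT₂.locClosed) hlift
    (fun x _ => finite_fibre_incidencePairPoly _ x) (d := d) (fun W hWE hW => by
      rw [Fintype.card_fin, ← hd]
      refine (zdim_le_or_exists_eq_conormalVectors hT₁ hT₂ hWE hW).resolve_right ?_
      rintro ⟨U, hU, -, hI₁, hI₂⟩
      exact hexc ⟨U, hU, eq_conormalClosure h₁ hI₁, eq_conormalClosure h₂ hI₂⟩)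
    (fun e he => by
      rw [Fintype.card_fin, ← hd]
      exact exists_large_subset_conormalQuadricPairs hT₁ hT₂ he) hS
  rw [hS', topologicalKrullDim_projSpace k (Sym2 ι) (d := 2 + d) (by omega),
    topologicalKrullDim_projectivization hT₁ ⟨_, hx₁⟩ (d := 1 + d) (by omega),
    topologicalKrullDim_projectivization hT₂ ⟨_, hx₂⟩ (d := 1 + d) (by omega)]
  have hsum : d + (2 + d) = (1 + d) + (1 + d) := by omega
  exact_mod_cast congrArg (Nat.cast : ℕ → WithBot ℕ∞) hsum

end Intersection

/-! ### Conormal bundles of linear subspaces as conical sets -/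

section LinearConormal

open MvPolynomial Module

set_option linter.unusedSectionVars false

variable {k K : Type*} [Field k] [Field K] [Algebra k K] {ι : Type} [Fintype ι] [DecidableEq ι]
  {U : Submodule K (ι → K)}

theorem smul_mem_conormalVectors {s t : K} (hs : s ≠ 0) {v ξ : ι → K}
    (h : Sum.elim v ξ ∈ conormalVectors U) : Sum.elim (s • v) (t • ξ) ∈ conormalVectors U := by
  obtain ⟨h1, h2, h3⟩ := mem_conormalVectors.mp h
  exact mem_conormalVectors.mpr ⟨smul_ne_zero hs h1, U.smul_mem s h2, (perp U).smul_mem t h3⟩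

variable [IsAlgClosed K] [Algebra.IsAlgebraic k K]

theorem mem_prodSubmodule_of_mem_closure {x : ι ⊕ ι → K}
    (hx : x ∈ zeroLocus K (vanishingIdeal K (conormalVectors U))) :
    x ∈ prodSubmodule U (perp U) := by
  obtain ⟨v, ξ, rfl⟩ := exists_elim_eq x
  refine mem_prodSubmodule.mpr ⟨mem_of_perp_le fun l hl => ?_, fun u hu => ?_⟩
  · have h := hx (∑ i, C (l i) * X (Sum.inl i)) fun y hy => by
      obtain ⟨w, ζ, rfl⟩ := exists_elim_eq y
      simpa [dotProduct] using hl w (mem_conormalVectors.mp hy).2.1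
    simpa [dotProduct] using h
  · have h := hx (∑ i, X (Sum.inr i) * C (u i)) fun y hy => by
      obtain ⟨w, ζ, rfl⟩ := exists_elim_eq y
      simpa [dotProduct] using (mem_conormalVectors.mp hy).2.2 u hu
    simpa [dotProduct] using h

/-- The nonzero vectors of `U` are dense in `U`, so the condition `v ≠ 0` can be dropped. -/
theorem vanishingIdeal_conormalVectors (hU : U ≠ ⊥) :
    vanishingIdeal K (conormalVectors U) =
      vanishingIdeal K (prodSubmodule U (perp U) : Set (ι ⊕ ι → K)) := by
  obtain ⟨v, hv, hv0⟩ := Submodule.exists_mem_ne_zero_of_ne_bot hU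
  obtain ⟨a, ha⟩ := Function.ne_iff.mp hv0
  refine le_antisymm ?_ (vanishingIdeal_anti_mono fun x hx => hx.2)
  rw [← (zirred_submodule (prodSubmodule U (perp U))).vanishingIdeal_inter (f := X (Sum.inl a))
    ⟨Sum.elim v 0, mem_prodSubmodule.mpr ⟨hv, zero_mem _⟩, by simpa using ha⟩]
  refine vanishingIdeal_anti_mono fun x hx => ⟨fun h0 => hx.2 ?_, hx.1⟩
  rw [aeval_X]
  exact congrFun h0 a

theorem isCone_conormalVectors (hU : U ≠ ⊥) : IsCone K (conormalVectors U) where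
  mem_iff v ξ := by
    constructor
    · intro h
      obtain ⟨h1, h2, h3⟩ := mem_conormalVectors.mp h
      exact ⟨h1, h3 v h2, zeroLocus_vanishingIdeal_le _ h⟩
    · rintro ⟨h1, -, h3⟩
      exact ⟨h1, mem_prodSubmodule_of_mem_closure h3⟩
  irred := (zirred_submodule _).of_vanishingIdeal_eq (vanishingIdeal_conormalVectors hU)
  smul_mem hs _ _ _ h := smul_mem_conormalVectors hs h
  dim := by
    rw [zdim_congr (vanishingIdeal_conormalVectors hU), zdim_submodule, finrank_prodSubmodule,
      add_comm, finrank_perp]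

/-- If `U` is not defined over `k`, the closure over `k` is larger than the conormal bundle of `U`;
it is the union of the conormal bundles of the conjugates of `U`. -/
theorem mem_cotangentLift_conormalClosure {v ξ : ι → K} :
    Sum.elim v ξ ∈ cotangentLift (conormalClosure k U) ↔
      v ≠ 0 ∧ ξ ⬝ᵥ v = 0 ∧ Sum.elim v ξ ∈ zeroLocus K (vanishingIdeal k (conormalVectors U)) := by
  have hq := torusQuotient_cotangent (k := k) (K := K) (κ := ι)
  rw [← cotangentLift_conormal (k := k)]
  constructor
  · rintro ⟨w, hw, he⟩
    obtain ⟨rfl, rfl⟩ := sum_elim_inj.mp he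
    exact ⟨w.vec_ne_zero, w.form_vec, hq.mem_closure_iff.mp hw⟩
  · rintro ⟨h1, h2, h3⟩
    exact ⟨⟨v, ξ, h1, h2⟩, hq.mem_closure_iff.mpr h3, rfl⟩

theorem conormalVectors_subset : conormalVectors U ⊆ cotangentLift (conormalClosure k U) := by
  intro x hx
  obtain ⟨v, ξ, rfl⟩ := exists_elim_eq x
  obtain ⟨h1, h2, h3⟩ := mem_conormalVectors.mp hx
  exact mem_cotangentLift_conormalClosure.mpr ⟨h1, h3 v h2, zeroLocus_vanishingIdeal_le _ hx⟩

theorem vanishingIdeal_cotangentLift_conormalClosure :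
    vanishingIdeal k (cotangentLift (conormalClosure k U)) =
      vanishingIdeal k (conormalVectors U) := by
  refine vanishingIdeal_eq_of_subset_of_subset conormalVectors_subset fun x hx => ?_
  obtain ⟨v, ξ, rfl⟩ := exists_elim_eq x
  exact (mem_cotangentLift_conormalClosure.mp hx).2.2

theorem isCone_conormalClosure (hU : U ≠ ⊥) :
    IsCone k (cotangentLift (conormalClosure k U)) where
  mem_iff v ξ := by
    rw [vanishingIdeal_cotangentLift_conormalClosure]
    exact mem_cotangentLift_conormalClosure
  irred := (isCone_conormalVectors hU).irred.base.of_vanishingIdeal_eq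
    vanishingIdeal_cotangentLift_conormalClosure
  smul_mem {s t} hs ht {v ξ} h := by
    obtain ⟨h1, h2, h3⟩ := mem_cotangentLift_conormalClosure.mp h
    refine mem_cotangentLift_conormalClosure.mpr ⟨smul_ne_zero hs h1, ?_, ?_⟩
    · rw [smul_dotProduct, dotProduct_smul, h2, smul_zero, smul_zero]
    · have h4 := torusAct_mem_closure (incidenceWeight ι) (V := conormalVectors U) (by
        rintro _ ⟨t, x, hx, rfl⟩
        obtain ⟨v, ξ, rfl⟩ := exists_elim_eq x
        rw [torusAct_incidenceWeight]
        exact smul_mem_conormalVectors (t 0).ne_zero hx) h3 ![Units.mk0 s hs, Units.mk0 t ht]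
      rwa [torusAct_incidenceWeight] at h4
  dim := by
    rw [zdim_congr vanishingIdeal_cotangentLift_conormalClosure,
      zdim_base (isCone_conormalVectors hU).irred]
    exact (isCone_conormalVectors hU).dim

end LinearConormal

/-! ### A parametrization of the quadrics conormal to a set of covectors -/

section Parametrization

open MvPolynomial Module

set_option linter.unusedSectionVars false

variable {k K : Type*} [Field k] [Field K] [Algebra k K] {ι σ τ : Type}

/-- Taking products with an affine space commutes with closure over the small field: the
coefficients of a polynomial over `k` with respect to the second set of variables are again
polynomials over `k`. -/
theorem elim_mem_closure_prodSet [Infinite K] {V : Set (σ → K)} {x : σ → K}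
    (hx : x ∈ zeroLocus K (vanishingIdeal k V)) (y : τ → K) :
    Sum.elim x y ∈ zeroLocus K (vanishingIdeal k (prodSet V (Set.univ : Set (τ → K)))) := by
  intro F hF
  let e : MvPolynomial (σ ⊕ τ) k →ₐ[k] MvPolynomial τ (MvPolynomial σ k) :=
    aeval (Sum.elim (fun i => C (X i)) X)
  have he : ∀ (x : σ → K) (y : τ → K), aeval (Sum.elim x y) F =
      eval y (map (aeval x : MvPolynomial σ k →ₐ[k] K).toRingHom (e F)) := by
    intro x y
    have h : ((eval y).comp ((map (aeval x : MvPolynomial σ k →ₐ[k] K).toRingHom).comp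
        e.toRingHom)) = (aeval (Sum.elim x y) : MvPolynomial (σ ⊕ τ) k →ₐ[k] K).toRingHom := by
      refine MvPolynomial.ringHom_ext (fun r => ?_) fun i => ?_
      · simp [e, MvPolynomial.algebraMap_apply, MvPolynomial.algebraMap_eq]
      · rcases i with i | i <;> simp [e]
    exact (RingHom.congr_fun h F).symm
  have hcoeff : ∀ m, coeff m (e F) ∈ vanishingIdeal k V := by
    intro m z hz
    have h0 : map (aeval z : MvPolynomial σ k →ₐ[k] K).toRingHom (e F) = 0 :=
      MvPolynomial.funext fun y => by
        rw [← he, map_zero]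
        exact hF _ (elim_mem_prodSet.mpr ⟨hz, trivial⟩)
    have h1 := congrArg (coeff m) h0
    rw [coeff_map, coeff_zero] at h1
    exact h1
  have h0 : map (aeval x : MvPolynomial σ k →ₐ[k] K).toRingHom (e F) = 0 := by
    ext m
    rw [coeff_map, coeff_zero]
    exact hx _ (hcoeff m)
  rw [he, h0, map_zero]

variable [Fintype ι] [DecidableEq ι]

/-- The linear form `v_a y_b - v_b y_a` in `y`, which vanishes at `v`. -/
def minorForm (v : ι → K) (a b : ι) : ι → K := v a • Pi.single b 1 - v b • Pi.single a 1

theorem minorForm_dot (v y : ι → K) (a b : ι) :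
    minorForm v a b ⬝ᵥ y = v a * y b - v b * y a := by
  simp [minorForm, sub_dotProduct]

/-- The quadratic form `y ↦ v_a y_a ξ(y) + ζ(v_a y - y_a v)`. If `v_a` is nonzero, these are the
quadratic forms that vanish at `v` and have differential `v_a² ξ` there. -/
def conormalForm (a : ι) (v ξ : ι → K) (ζ : Sym2 ι → K) : Sym2 ι → K :=
  v a • prodForm (Pi.single a 1) ξ +
    ∑ s, ζ s • prodForm (minorForm v a (Quot.out s).1) (minorForm v a (Quot.out s).2)

theorem conormalForm_dot_veronese (a : ι) (v ξ : ι → K) (ζ : Sym2 ι → K) (y : ι → K) :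
    conormalForm a v ξ ζ ⬝ᵥ veronese y =
      v a * y a * (ξ ⬝ᵥ y) + ζ ⬝ᵥ veronese (v a • y - y a • v) := by
  have h : ∀ s : Sym2 ι, veronese (v a • y - y a • v) s =
      (minorForm v a (Quot.out s).1 ⬝ᵥ y) * (minorForm v a (Quot.out s).2 ⬝ᵥ y) := by
    intro s
    conv_lhs => rw [← Quot.out_eq s]
    refine (veronese_mk _ (Quot.out s).1 (Quot.out s).2).trans ?_
    simp only [minorForm_dot, Pi.sub_apply, Pi.smul_apply, smul_eq_mul]
    ring
  rw [conormalForm, add_dotProduct, smul_dotProduct, prodForm_dot_veronese, sum_dotProduct]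
  simp only [smul_dotProduct, prodForm_dot_veronese, ← h, smul_eq_mul, single_dotProduct, one_mul]
  rw [mul_assoc]
  rfl

theorem codiff_conormalForm (a : ι) {v ξ : ι → K} (hξ : ξ ⬝ᵥ v = 0) (ζ : Sym2 ι → K) :
    codiff v (conormalForm a v ξ ζ) = v a ^ 2 • ξ := by
  refine dotProduct_eq _ _ fun u => ?_
  have hm : ∀ b, minorForm v a b ⬝ᵥ v = 0 := fun b => by rw [minorForm_dot]; ring
  rw [codiff_dot, conormalForm, add_dotProduct, smul_dotProduct, prodForm_dot_polar,
    sum_dotProduct, Finset.sum_eq_zero fun s _ => by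
      rw [smul_dotProduct, prodForm_dot_polar, hm, hm, zero_mul, mul_zero, add_zero, smul_zero],
    hξ, smul_dotProduct]
  simp only [single_dotProduct, one_mul, smul_eq_mul, mul_zero, add_zero]
  ring

/-- Every form `η` that vanishes at `v` is a `conormalForm`: one expands `η(v_a y - y_a v)`. -/
theorem exists_conormalForm_eq {a : ι} {v : ι → K} (ha : v a ≠ 0) {η : Sym2 ι → K}
    (hη : η ⬝ᵥ veronese v = 0) :
    ∃ ζ, conormalForm a v ((v a ^ 2)⁻¹ • codiff v η) ζ = η := by
  refine ⟨(v a ^ 2)⁻¹ • η, eq_of_dot_veronese fun y => ?_⟩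
  have h1 : v a • y - y a • v = v a • y + (-y a) • v := by rw [neg_smul, sub_eq_add_neg]
  rw [conormalForm_dot_veronese, h1, smul_dotProduct, smul_dotProduct, dot_veronese_add,
    dot_veronese_smul, dot_veronese_smul, hη, codiff_smul_vec, smul_dotProduct, dotProduct_smul,
    codiff_dot_comm y v]
  simp only [smul_eq_mul]
  field_simp
  ring

/-- The map `((v, ξ), ζ) ↦ (v, conormalForm a v ξ ζ)` as a family of polynomials. -/
def conormalPoly (k : Type*) [Field k] (a : ι) : ι ⊕ Sym2 ι → MvPolynomial ((ι ⊕ ι) ⊕ Sym2 ι) k :=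
  let v : ι → MvPolynomial ((ι ⊕ ι) ⊕ Sym2 ι) k := fun i => X (Sum.inl (Sum.inl i))
  let m : ι → ι → MvPolynomial ((ι ⊕ ι) ⊕ Sym2 ι) k :=
    fun b => v a • Pi.single b 1 - v b • Pi.single a 1
  let prod (l l' : ι → MvPolynomial ((ι ⊕ ι) ⊕ Sym2 ι) k) (s : Sym2 ι) :
      MvPolynomial ((ι ⊕ ι) ⊕ Sym2 ι) k :=
    ∑ p : ι × ι, if s(p.1, p.2) = s then l p.1 * l' p.2 else 0
  Sum.elim v fun s => v a * prod (Pi.single a 1) (fun i => X (Sum.inl (Sum.inr i))) s +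
    ∑ r, X (Sum.inr r) * prod (m (Quot.out r).1) (m (Quot.out r).2) s

theorem polyMap_conormalPoly (a : ι) (v ξ : ι → K) (ζ : Sym2 ι → K) :
    polyMap (conormalPoly k a) (Sum.elim (Sum.elim v ξ) ζ) =
      Sum.elim v (conormalForm a v ξ ζ) := by
  have h1 : ∀ (x : (ι ⊕ ι) ⊕ Sym2 ι → K) (b i : ι),
      aeval x ((Pi.single b 1 : ι → MvPolynomial ((ι ⊕ ι) ⊕ Sym2 ι) k) i) =
      (Pi.single b 1 : ι → K) i := by
    intro x b i
    rw [Pi.single_apply, Pi.single_apply]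
    split_ifs <;> simp
  ext i
  rcases i with i | s
  · simp [polyMap, conormalPoly]
  · simp only [polyMap, conormalPoly, Sum.elim_inr, map_add, map_mul, map_sum, aeval_X,
      Sum.elim_inl, apply_ite (aeval _), map_zero, h1, Pi.sub_apply, Pi.smul_apply, smul_eq_mul,
      map_sub, conormalForm, Pi.add_apply, Finset.sum_apply, prodForm, minorForm]

/-- The pairs `(v, η)` with `v_a ≠ 0` of a vector and a quadratic form that vanishes at `v`, such
that `(v, dη(v))` belongs to `T`. -/
def conormalChart (a : ι) (T : Set (ι ⊕ ι → K)) : Set (ι ⊕ Sym2 ι → K) :=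
  {x | x (Sum.inl a) ≠ 0 ∧ (x ∘ Sum.inr) ⬝ᵥ veronese (x ∘ Sum.inl) = 0 ∧
    Sum.elim (x ∘ Sum.inl) (codiff (x ∘ Sum.inl) (x ∘ Sum.inr)) ∈ T}

theorem mem_conormalChart {a : ι} {T : Set (ι ⊕ ι → K)} {v : ι → K} {η : Sym2 ι → K} :
    Sum.elim v η ∈ conormalChart a T ↔
      v a ≠ 0 ∧ η ⬝ᵥ veronese v = 0 ∧ Sum.elim v (codiff v η) ∈ T := Iff.rfl

variable [IsAlgClosed K] [Algebra.IsAlgebraic k K] {T : Set (ι ⊕ ι → K)}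

/-- Over the open set `v_a ≠ 0`, the pairs `(v, η)` form a trivial bundle of affine spaces over the
set `T` of covectors; the trivialization is defined over `k`. -/
theorem IsConicalSet.conormalChart_eq (hT : IsConicalSet k T) (a : ι) :
    conormalChart a T = polyMap (conormalPoly k a) ''
      prodSet {x ∈ T | aeval x (X (Sum.inl a) : MvPolynomial (ι ⊕ ι) k) ≠ 0} Set.univ := by
  ext x
  constructor
  · intro hx
    obtain ⟨v, η, rfl⟩ := exists_elim_eq x
    obtain ⟨h1, h2, h3⟩ := mem_conormalChart.mp hx
    obtain ⟨ζ, hζ⟩ := exists_conormalForm_eq h1 h2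
    refine ⟨Sum.elim (Sum.elim v ((v a ^ 2)⁻¹ • codiff v η)) ζ, elim_mem_prodSet.mpr
      ⟨⟨?_, by simpa using h1⟩, trivial⟩, by rw [polyMap_conormalPoly, hζ]⟩
    have := hT.smul_mem one_ne_zero (inv_ne_zero (pow_ne_zero 2 h1)) h3
    rwa [one_smul] at this
  · rintro ⟨y, hy, rfl⟩
    obtain ⟨y, ζ, rfl⟩ := exists_elim_eq y
    obtain ⟨v, ξ, rfl⟩ := exists_elim_eq y
    obtain ⟨⟨hyT, hya⟩, -⟩ := elim_mem_prodSet.mp hy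
    have ha : v a ≠ 0 := by simpa using hya
    have hξ := hT.form_vec hyT
    rw [polyMap_conormalPoly]
    refine mem_conormalChart.mpr ⟨ha, ?_, ?_⟩
    · rw [conormalForm_dot_veronese, sub_self, hξ, mul_zero, zero_add]
      have h0 : veronese (0 : ι → K) = 0 := by
        ext s
        induction s with
        | _ b c => simp [veronese_mk]
      rw [h0, dotProduct_zero]
    · rw [codiff_conormalForm a hξ]
      have := hT.smul_mem one_ne_zero (pow_ne_zero 2 ha) hyT
      rwa [one_smul] at this

theorem IsConicalSet.zirred_conormalChart {T : Set (ι ⊕ ι → K)} (hT : IsConicalSet K T) {a : ι}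
    (hne : (conormalChart a T).Nonempty) : ZIrred K (conormalChart a T) := by
  rw [hT.conormalChart_eq] at hne ⊢
  obtain ⟨_, x, ⟨hx, -⟩, rfl⟩ := hne
  have h := hT.irred.vanishingIdeal_inter ⟨_, hx.1, hx.2⟩
  exact ((hT.irred.of_vanishingIdeal_eq h).prod zirred_univ).image _

/-- The formation of `conormalChart` is compatible with closures. -/
theorem conormalChart_subset_closure {T' : Set (ι ⊕ ι → K)} (hT : IsConicalSet k T)
    (hT' : IsConicalSet K T') (h : T ⊆ zeroLocus K (vanishingIdeal k T')) (a : ι) :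
    conormalChart a T ⊆ zeroLocus K (vanishingIdeal k (conormalChart a T')) := by
  intro x hx f hf
  rw [hT.conormalChart_eq] at hx
  obtain ⟨x, hx, rfl⟩ := hx
  obtain ⟨x, ζ, rfl⟩ := exists_elim_eq x
  obtain ⟨⟨hxT, hxa⟩, -⟩ := elim_mem_prodSet.mp hx
  -- multiplication by `v_a` makes the function vanish also where the chart is not defined
  have h1 := elim_mem_closure_prodSet (h hxT) ζ
    (X (Sum.inl (Sum.inl a)) * aeval (conormalPoly k a) f) fun y hy => by
      by_cases hya : y (Sum.inl (Sum.inl a)) = 0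
      · rw [map_mul, aeval_X, hya, zero_mul]
      rw [map_mul, ← aeval_polyMap]
      refine mul_eq_zero_of_right _ (hf _ ?_)
      rw [hT'.conormalChart_eq]
      refine ⟨y, ⟨⟨hy.1, by simpa using hya⟩, trivial⟩, ?_⟩
      obtain ⟨y, ζ, rfl⟩ := exists_elim_eq y
      obtain ⟨v, ξ, rfl⟩ := exists_elim_eq y
      rw [polyMap_conormalPoly, polyMap_conormalPoly]
  rw [map_mul, ← aeval_polyMap] at h1
  refine (mul_eq_zero.mp h1).resolve_left ?_
  simpa using hxa

end Parametrization

/-! ### Quadrics conormal to a linear subspace -/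

section Radicial

open MvPolynomial Module

set_option linter.unusedSectionVars false

variable {k K : Type*} [Field k] [Field K] [Algebra k K] {ι : Type} [Fintype ι] [DecidableEq ι]
  [IsAlgClosed K] [Algebra.IsAlgebraic k K] {U : Submodule K (ι → K)}

/-- The quadratic form of a pair of a vector and a quadratic form, as a polynomial map. -/
def formPoly (k : Type*) [Field k] (ι : Type) : Sym2 ι → MvPolynomial (ι ⊕ Sym2 ι) k :=
  fun s => X (Sum.inr s)

theorem polyMap_formPoly (v : ι → K) (η : Sym2 ι → K) :
    polyMap (formPoly k ι) (Sum.elim v η) = η := polyMap_X_comp _ _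

/-- The quadratic form of a triple of two vectors and a quadratic form, as a polynomial map. -/
def pairFormPoly (k : Type*) [Field k] (ι : Type) : Sym2 ι → MvPolynomial (ι ⊕ ι ⊕ Sym2 ι) k :=
  fun s => X (Sum.inr (Sum.inr s))

theorem polyMap_pairFormPoly (v₁ v₂ : ι → K) (η : Sym2 ι → K) :
    polyMap (pairFormPoly k ι) (Sum.elim v₁ (Sum.elim v₂ η)) = η := polyMap_X_comp _ _

/-- The dual variety of a linear subspace of positive projective dimension is a hypersurface: some
conormal quadric has a unique point of conormality. -/
theorem card_le_zdim_formPoly_conormalChart (hU : 2 ≤ finrank K U) {a : ι}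
    (hne : (conormalChart a (conormalVectors U)).Nonempty) :
    Fintype.card (Sym2 ι) ≤ zdim K (polyMap (formPoly K ι) '' conormalChart a (conormalVectors U)) +
      1 := by
  have hU0 : U ≠ ⊥ := by
    rintro rfl
    rw [finrank_bot] at hU
    omega
  have hM := isCone_conormalVectors hU0
  have hY := hM.zirred_conormalChart hne
  obtain ⟨x, hx⟩ := hne
  obtain ⟨v₀, η, rfl⟩ := exists_elim_eq x
  obtain ⟨ha, -, hv₀⟩ := mem_conormalChart.mp hx
  obtain ⟨hv, hvU, -⟩ := mem_conormalVectors.mp hv₀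
  -- the fibre over `η₀` is the line of `v₀`
  obtain ⟨η₀, hη₀, hsing⟩ := exists_form_singular_at_point hvU
  have hη₀0 : η₀ ≠ 0 := by
    rintro rfl
    have h1 : U ≤ Submodule.span K {v₀} := fun v hv => by
      obtain ⟨c, rfl⟩ := hsing v hv ((singularForms v U).zero_mem)
      exact Submodule.smul_mem _ _ (Submodule.mem_span_singleton_self v₀)
    have h2 := Submodule.finrank_mono h1
    rw [finrank_span_singleton hv] at h2
    omega
  have hx₀ : Sum.elim v₀ η₀ ∈ conormalQuadrics (conormalVectors U) :=
    mem_conormalQuadrics.mpr ⟨hη₀0, hη₀.1, mem_conormalVectors.mpr ⟨hv, hvU, hη₀.2⟩⟩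
  obtain ⟨W, hWE, hxW, hW, hWd⟩ := exists_large_subset_conormalQuadrics hM hx₀
  have hne : aeval (Sum.elim v₀ η₀) (X (Sum.inl a) : MvPolynomial (ι ⊕ Sym2 ι) K) ≠ 0 := by
    simpa using ha
  have hI := hW.vanishingIdeal_inter ⟨_, hxW, hne⟩
  let S : Set (ι ⊕ Sym2 ι → K) :=
    {x ∈ W | aeval x (X (Sum.inl a) : MvPolynomial (ι ⊕ Sym2 ι) K) ≠ 0}
  have hS : ZIrred K S := hW.of_vanishingIdeal_eq hI
  have hSY : S ⊆ conormalChart a (conormalVectors U) := fun y hy =>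
    ⟨by simpa using hy.2, (hWE hy.1).2⟩
  obtain ⟨F, hFE, hxF, hF, -, hFc, hFd⟩ := exists_fibre
    (locClosed_conormalQuadrics hM.locClosed) (formPoly K ι) (S := S) (x := Sum.elim v₀ η₀)
    (fun y hy => hWE hy.1) hS ⟨hxW, hne⟩
  have h1 : zdim K F ≤ 1 := by
    refine (zdim_le_finrank (L := Submodule.span K {Sum.elim v₀ 0}) (Sum.elim v₀ η₀) hF
      fun y hy => ?_).trans ((finrank_span_le_card _).trans (by simp))
    have hyE := hFE hy
    have hyc := hFc y hy
    obtain ⟨v, η, rfl⟩ := exists_elim_eq y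
    rw [polyMap_formPoly, polyMap_formPoly] at hyc
    subst hyc
    obtain ⟨-, h3, h4⟩ := mem_conormalQuadrics.mp hyE
    obtain ⟨-, h5, h6⟩ := mem_conormalVectors.mp h4
    obtain ⟨c, rfl⟩ := hsing v h5 ⟨h3, h6⟩
    refine Submodule.mem_span_singleton.mpr ⟨c - 1, ?_⟩
    ext i
    rcases i with i | i <;> simp [sub_mul]
  have h2 := zdim_mono (hS.image (formPoly K ι)) (hY.image _) (Set.image_mono hSY)
  have h3 : zdim K S = zdim K W := zdim_congr hI
  omega

/-- The quadratic forms that are singular along `U` at a point of a hyperplane section of `U` have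
codimension at least two: the choice of the point, up to scaling, adds `dim U - 2` to the dimension,
and being singular there along `U` imposes `dim U` conditions. -/
theorem zdim_formPoly_add_two_le (hU : U ≠ ⊥) {a : ι} (ha : ∃ u ∈ U, u a ≠ 0)
    {S : Set (ι ⊕ Sym2 ι → K)} (hS : ZIrred K S)
    (hSE : S ⊆ conormalQuadrics (conormalVectors U)) (hSa : ∀ x ∈ S, x (Sum.inl a) = 0) :
    zdim K (polyMap (formPoly K ι) '' S) + 2 ≤ Fintype.card (Sym2 ι) := by
  have hM := isCone_conormalVectors hU
  -- the vectors can be scaled, so the dimension of `S` may be assumed to exceed that of its image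
  let w : ι ⊕ Sym2 ι → Unit → ℤ := Sum.elim (fun _ => Pi.single () 1) (fun _ => 0)
  have hw : ∀ (t : Unit → Kˣ) (v : ι → K) (η : Sym2 ι → K),
      torusAct w t (Sum.elim v η) = Sum.elim ((t () : K) • v) η := by
    intro t v η
    ext i
    rcases i with i | i
    · exact torusAct_apply_of_single w rfl t _
    · exact torusAct_apply_of_zero w rfl t _
  let S' := torusSat w S
  have hS' : ZIrred K S' := hS.torusSat w
  have hS'E : S' ⊆ conormalQuadrics (conormalVectors U) := by
    rintro _ ⟨t, x, hx, rfl⟩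
    obtain ⟨v, η, rfl⟩ := exists_elim_eq x
    obtain ⟨h1, h2, h3⟩ := mem_conormalQuadrics.mp (hSE hx)
    rw [hw]
    refine mem_conormalQuadrics.mpr ⟨h1, ?_, ?_⟩
    · rw [dot_veronese_smul, h2, mul_zero]
    · rw [codiff_smul_vec]
      exact smul_mem_conormalVectors (t ()).ne_zero h3
  have hS'a : ∀ x ∈ S', x (Sum.inl a) = 0 := by
    rintro _ ⟨t, x, hx, rfl⟩
    rw [torusAct, hSa x hx, mul_zero]
  have h1 : 1 + zdim K (polyMap (formPoly K ι) '' S) ≤ zdim K S' := by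
    obtain ⟨x, hx⟩ := hS.nonempty
    obtain ⟨v, η, rfl⟩ := exists_elim_eq x
    obtain ⟨b, hb⟩ := Function.ne_iff.mp (hM.vec_ne_zero (hSE hx).2.2)
    have := zdim_torusSat_ge w hS (j := Sum.inr) (s := fun _ => Sum.inl b) (fun _ => rfl)
      (fun _ => rfl) ⟨_, hx, fun _ => hb⟩
    rwa [Fintype.card_unit] at this
  let U' : Submodule K (ι → K) := U ⊓ LinearMap.ker (LinearMap.proj a)
  have hU' : finrank K U' < finrank K U := by
    refine Submodule.finrank_lt_finrank_of_lt (lt_of_le_of_ne inf_le_left fun he => ?_)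
    obtain ⟨u, hu, hua⟩ := ha
    rw [← he] at hu
    exact hua hu.2
  let p : ι → MvPolynomial (ι ⊕ Sym2 ι) K := fun i => X (Sum.inl i)
  have h2 : zdim K (polyMap p '' S') ≤ finrank K U' := by
    refine zdim_le_finrank 0 (hS'.image p) ?_
    rintro _ ⟨x, hx, rfl⟩
    rw [polyMap_X_comp, sub_zero]
    exact ⟨(hS'E hx).2.2.2.1, hS'a x hx⟩
  have h3 := zdim_le_of_fibre_le (locClosed_conormalQuadrics hM.locClosed) p
    (c := Fintype.card (Sym2 ι) - finrank K U) (fun W hWE hW hc => by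
      obtain ⟨x₀, hx₀⟩ := hW.nonempty
      have hc' : ∀ x ∈ W, ∀ y ∈ W, x ∘ Sum.inl = y ∘ Sum.inl := fun x hx y hy => by
        have := hc x hx y hy
        rwa [polyMap_X_comp, polyMap_X_comp] at this
      obtain ⟨v, η, rfl⟩ := exists_elim_eq x₀
      refine (zdim_le_zdim_image_inr hW hc').trans ?_
      refine (zdim_le_finrank (L := singularForms v U) 0 (hW.image _) ?_).trans ?_
      · rintro _ ⟨x, hx, rfl⟩
        have h4 := hc' x hx _ hx₀
        have h5 := hWE hx
        obtain ⟨v', η', rfl⟩ := exists_elim_eq x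
        have h6 : v' = v := h4
        subst h6
        rw [polyMap_X_comp, sub_zero]
        exact ⟨h5.2.1, (mem_conormalVectors.mp h5.2.2).2.2⟩
      · have : finrank K (singularForms v U) + _ ≤ _ :=
          finrank_singularForms_le (hM.vec_ne_zero (hWE hx₀).2.2)
        omega) hS'E hS'
  obtain ⟨x, hx⟩ := hS.nonempty
  have h4 := finrank_singularForms_le (U := U) (hM.vec_ne_zero (hSE hx).2.2)
  omega

/-- The quadrics that are conormal to a conical set of dimension equal to that of the base at two
different points have codimension at least two, as cones in the space of quadratic forms. In the
exceptional case of the conormal bundle of a linear subspace `U`, such a quadric is singular along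
the line through the two points, hence at a point of any given hyperplane section of `U`. -/
theorem zdim_pairFormPoly_add_two_le {T : Set (ι ⊕ ι → K)} (hT : IsCone k T)
    {S : Set (ι ⊕ ι ⊕ Sym2 ι → K)} (hS : ZIrred K S) (hSE : S ⊆ conormalQuadricPairs T T) :
    zdim K (polyMap (pairFormPoly K ι) '' S) + 2 ≤ Fintype.card (Sym2 ι) := by
  let w : ι ⊕ ι ⊕ Sym2 ι → Fin 2 → ℤ :=
    Sum.elim (fun _ => Pi.single 0 1) (Sum.elim (fun _ => Pi.single 1 1) (fun _ => 0))
  have hw : ∀ (t : Fin 2 → Kˣ) (v₁ v₂ : ι → K) (η : Sym2 ι → K),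
      torusAct w t (Sum.elim v₁ (Sum.elim v₂ η)) =
        Sum.elim ((t 0 : K) • v₁) (Sum.elim ((t 1 : K) • v₂) η) := by
    intro t v₁ v₂ η
    ext i
    rcases i with i | i | i
    · exact torusAct_apply_of_single w rfl t _
    · exact torusAct_apply_of_single w rfl t _
    · exact torusAct_apply_of_zero w rfl t _
  have hsmul : ∀ {s : K} {v : ι → K} {η : Sym2 ι → K}, s ≠ 0 →
      Sum.elim v η ∈ conormalQuadrics T → Sum.elim (s • v) η ∈ conormalQuadrics T := by
    intro s v η hs h
    obtain ⟨h1, h2, h3⟩ := mem_conormalQuadrics.mp h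
    refine mem_conormalQuadrics.mpr ⟨h1, ?_, ?_⟩
    · rw [dot_veronese_smul, h2, mul_zero]
    · rw [codiff_smul_vec]
      exact hT.smul_mem hs hs h3
  let S' := torusSat w S
  have hS' : ZIrred K S' := hS.torusSat w
  have hS'E : S' ⊆ conormalQuadricPairs T T := by
    rintro _ ⟨t, x, hx, rfl⟩
    obtain ⟨v₁, x, rfl⟩ := exists_elim_eq x
    obtain ⟨v₂, η, rfl⟩ := exists_elim_eq x
    obtain ⟨⟨a, b, hab⟩, h1, h2⟩ := mem_conormalQuadricPairs.mp (hSE hx)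
    rw [hw]
    refine mem_conormalQuadricPairs.mpr ⟨⟨a, b, ?_⟩, hsmul (t 0).ne_zero h1,
      hsmul (t 1).ne_zero h2⟩
    have := mul_ne_zero (mul_ne_zero (t 0).ne_zero (t 1).ne_zero) hab
    simp only [Pi.smul_apply, smul_eq_mul]
    convert this using 1
    ring
  obtain ⟨x, hx⟩ := hS.nonempty
  obtain ⟨v₁, x, rfl⟩ := exists_elim_eq x
  obtain ⟨v₂, η, rfl⟩ := exists_elim_eq x
  obtain ⟨-, hx₁, hx₂⟩ := mem_conormalQuadricPairs.mp (hSE hx)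
  obtain ⟨a, ha⟩ := Function.ne_iff.mp (hT.vec_ne_zero hx₁.2.2)
  obtain ⟨b, hb⟩ := Function.ne_iff.mp (hT.vec_ne_zero hx₂.2.2)
  have h1 : 2 + zdim K (polyMap (pairFormPoly K ι) '' S) ≤ zdim K S' := by
    have := zdim_torusSat_ge w hS (j := fun s => Sum.inr (Sum.inr s))
      (s := ![Sum.inl a, Sum.inr (Sum.inl b)]) (fun _ => rfl)
      (fun i => by fin_cases i <;> rfl) ⟨_, hx, fun i => by
        fin_cases i
        · exact ha
        · exact hb⟩
    rwa [Fintype.card_fin] at this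
  rcases zdim_le_or_exists_eq_conormalVectors hT hT hS'E hS' with h2 | ⟨U, hU, hSU, -, -⟩
  · omega
  have hU0 : U ≠ ⊥ := by
    rintro rfl
    rw [finrank_bot] at hU
    omega
  -- on a dense open subset, the two points span a line that is not contained in the hyperplane `a`
  let S₀ : Set (ι ⊕ ι ⊕ Sym2 ι → K) :=
    {x ∈ S | aeval x (X (Sum.inl a) : MvPolynomial (ι ⊕ ι ⊕ Sym2 ι) K) ≠ 0}
  have hI : vanishingIdeal K S₀ = vanishingIdeal K S :=
    hS.vanishingIdeal_inter ⟨_, hx, by simpa using ha⟩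
  have hS₀ : ZIrred K S₀ := hS.of_vanishingIdeal_eq hI
  rw [← zdim_congr (show vanishingIdeal K (polyMap (pairFormPoly K ι) '' S₀) = _ by
    rw [vanishingIdeal_image, vanishingIdeal_image, hI])]
  -- the point of the hyperplane `a` on the line through the two points
  let m : ι ⊕ Sym2 ι → MvPolynomial (ι ⊕ ι ⊕ Sym2 ι) K := Sum.elim
    (fun i => X (Sum.inr (Sum.inl a)) * X (Sum.inl i) - X (Sum.inl a) * X (Sum.inr (Sum.inl i)))
    (fun s => X (Sum.inr (Sum.inr s)))
  have hm : ∀ (v₁ v₂ : ι → K) (η : Sym2 ι → K), polyMap m (Sum.elim v₁ (Sum.elim v₂ η)) =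
      Sum.elim (v₂ a • v₁ + (-v₁ a) • v₂) η := by
    intro v₁ v₂ η
    ext i
    rcases i with i | i
    · simp [polyMap, m, sub_eq_add_neg]
    · simp [polyMap, m]
  have hmS : polyMap m '' S₀ ⊆ conormalQuadrics (conormalVectors U) := by
    rintro _ ⟨x, ⟨hx, hxa⟩, rfl⟩
    obtain ⟨v₁, x, rfl⟩ := exists_elim_eq x
    obtain ⟨v₂, η, rfl⟩ := exists_elim_eq x
    have hv₁a : v₁ a ≠ 0 := by simpa using hxa
    obtain ⟨h3, h4⟩ := hSU _ _ _ (subset_torusSat w S hx)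
    obtain ⟨h5, h6, h7⟩ := mem_conormalVectors.mp h3
    obtain ⟨h8, h9, h10⟩ := mem_conormalVectors.mp h4
    obtain ⟨⟨i, j, hij⟩, h11, h12⟩ := mem_conormalQuadricPairs.mp (hSE hx)
    obtain ⟨hη, h11, -⟩ := mem_conormalQuadrics.mp h11
    obtain ⟨-, h12, -⟩ := mem_conormalQuadrics.mp h12
    rw [hm]
    refine mem_conormalQuadrics.mpr ⟨hη, ?_, mem_conormalVectors.mpr ⟨fun h0 => hij ?_, ?_, ?_⟩⟩
    · rw [dot_veronese_add, dot_veronese_smul, dot_veronese_smul, h11, h12, codiff_smul_vec,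
        smul_dotProduct, dotProduct_smul, h7 v₂ h9]
      simp
    · have h13 : ∀ l, v₂ a * v₁ l - v₁ a * v₂ l = 0 := fun l => by
        have := congrFun h0 l
        simp only [Pi.add_apply, Pi.smul_apply, smul_eq_mul, Pi.zero_apply] at this
        linear_combination this
      refine (mul_eq_zero.mp (?_ : v₁ a * _ = 0)).resolve_left hv₁a
      linear_combination v₁ j * h13 i - v₁ i * h13 j
    · exact U.add_mem (U.smul_mem _ h6) (U.smul_mem _ h9)
    · rw [codiff_add_vec, codiff_smul_vec, codiff_smul_vec]
      exact (perp U).add_mem ((perp U).smul_mem _ h7) ((perp U).smul_mem _ h10)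
  have h3 := zdim_formPoly_add_two_le hU0 (a := a)
    ⟨v₁, (mem_conormalVectors.mp (hSU _ _ _ (subset_torusSat w S hx)).1).2.1, ha⟩
    (hS₀.image m) hmS (by
      rintro _ ⟨x, hx, rfl⟩
      obtain ⟨v₁, x, rfl⟩ := exists_elim_eq x
      obtain ⟨v₂, η, rfl⟩ := exists_elim_eq x
      rw [hm]
      simp [mul_comm])
  convert h3 using 3
  rw [Set.image_image]
  refine Set.image_congr fun x hx => ?_
  obtain ⟨v₁, x, rfl⟩ := exists_elim_eq x
  obtain ⟨v₂, η, rfl⟩ := exists_elim_eq x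
  rw [hm, polyMap_formPoly, polyMap_pairFormPoly]

/-- The points of the incidence variety over a given point of the dual projective space. -/
theorem exists_vec_of_hyp_eq {κ : Type} [Fintype κ] {z : Incidence k K κ} {η : κ → K} (hη : η ≠ 0)
    (hz : z.hyp = Projectivization.mk K η hη) :
    ∃ (a : CotangentCoord K κ) (ha : a.form ≠ 0), a.form = η ∧ Incidence.ofCoord k a ha = z := by
  obtain ⟨x, y, hxy⟩ := z
  dsimp only at hz
  subst hz
  induction x using Projectivization.ind with
  | h v hv => exact ⟨⟨v, η, hv, by
      rw [Projectivization.orthogonal_mk] at hxy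
      rw [dotProduct_comm]
      exact hxy⟩, hη, rfl, rfl⟩

/-- The dual variety of a linear subspace of positive projective dimension, with respect
to the Veronese embedding, is generically radicial. -/
theorem genericallyRadicial_conormalClosure (hU : 2 ≤ finrank K U) :
    GenericallyRadicial (projectivization (veronesePush (conormalClosure k U))) := by
  have hU0 : U ≠ ⊥ := by
    rintro rfl
    rw [finrank_bot] at hU
    omega
  have hT := isCone_conormalClosure (k := k) hU0
  have hM := isCone_conormalVectors hU0
  set Z := projectivization (veronesePush (conormalClosure k U))
  set T := cotangentLift (conormalClosure k U)
  have hTM : T ⊆ zeroLocus K (vanishingIdeal k (conormalVectors U)) := fun x hx => by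
    rw [← vanishingIdeal_cotangentLift_conormalClosure]
    exact zeroLocus_vanishingIdeal_le _ hx
  have hq := torusQuotient_projSpace (k := k) (K := K) (κ := Sym2 ι)
  let B : Set (ProjSpace k K (Sym2 ι)) := {h | ∃ z ∈ Z, ∃ z' ∈ Z, z ≠ z' ∧ z.hyp = h ∧ z'.hyp = h}
  -- the open set is the complement of the closure of the points over which injectivity fails
  refine ⟨(closure B)ᶜ, isClosed_closure.isOpen_compl, ?_, ?_⟩
  swap
  · rintro z ⟨hz, hzB⟩ z' ⟨hz', -⟩ he
    by_contra hne
    exact hzB (subset_closure ⟨z, hz, z', hz', hne, rfl, he.symm⟩)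
  -- forms with two points of conormality come from `conormalQuadricPairs`
  have hBE : liftSet (fun v : {v : Sym2 ι → K // v ≠ 0} => v.1)
      (fun v => (Projectivization.mk K v.1 v.2 : ProjSpace k K (Sym2 ι))) B ⊆
      polyMap (pairFormPoly K ι) '' conormalQuadricPairs T T := by
    rintro _ ⟨⟨η, hη⟩, ⟨z, hz, z', hz', hne, hzη, hzη'⟩, rfl⟩
    obtain ⟨a, ha, rfl, rfl⟩ := exists_vec_of_hyp_eq hη hzη
    obtain ⟨a', ha', haa', rfl⟩ := exists_vec_of_hyp_eq hη hzη'
    obtain ⟨v, hv, hvE⟩ := (ofCoord_mem_projectivization_iff hT.toIsConicalSet _ _).mp hz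
    obtain ⟨v', hv', hvE'⟩ := (ofCoord_mem_projectivization_iff hT.toIsConicalSet _ _).mp hz'
    rw [haa'] at hvE'
    refine ⟨Sum.elim v (Sum.elim v' a.form), ⟨?_, hvE, hvE'⟩, polyMap_pairFormPoly _ _ _⟩
    refine (exists_minor_ne_zero_iff (hT.vec_ne_zero hvE.2.2) (hT.vec_ne_zero hvE'.2.2)).mpr ?_
    rintro ⟨t, ht⟩
    rw [Sum.elim_comp_inl, Sum.elim_comp_inl, hv, hv'] at ht
    exact hne ((incidence_ofCoord_eq_iff _ _).mpr ⟨⟨t, ht⟩, 1, by rw [haa', one_smul]⟩)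
  rintro _ ⟨z, hz, rfl⟩
  obtain ⟨c, hc, rfl⟩ := exists_incidence_ofCoord z
  obtain ⟨v, hv, hvE⟩ := (ofCoord_mem_projectivization_iff hT.toIsConicalSet _ _).mp hz
  obtain ⟨a, ha⟩ := Function.ne_iff.mp (hT.vec_ne_zero hvE.2.2)
  refine (hq.mem_closure_iff (a := ⟨c.form, hc⟩)).mpr fun f hf => ?_
  by_contra hfc
  change aeval c.form f ≠ 0 at hfc
  obtain ⟨s, hs⟩ := Function.ne_iff.mp hc
  have hclos := conormalChart_subset_closure hT.toIsConicalSet hM.toIsConicalSet hTM a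
    (show Sum.elim v c.form ∈ _ from ⟨ha, hvE.2⟩)
  -- a function of the form that does not vanish at `c.form` does not vanish on the chart
  have hex : ∀ g : MvPolynomial (Sym2 ι) k, aeval c.form g ≠ 0 →
      ∃ y ∈ conormalChart a (conormalVectors U), aeval y (aeval (formPoly k ι) g) ≠ 0 := by
    intro g hg
    by_contra! h0
    apply hg
    rw [← polyMap_formPoly (k := k) v c.form, aeval_polyMap]
    exact hclos _ h0
  have hY := hM.zirred_conormalChart (a := a) (by
    obtain ⟨y, hy, -⟩ := hex f hfc
    exact ⟨y, hy⟩)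
  have hYk := (hY.image (formPoly K ι)).base (k := k)
  have hle : vanishingIdeal k (liftSet (fun v : {v : Sym2 ι → K // v ≠ 0} => v.1)
      (fun v => (Projectivization.mk K v.1 v.2 : ProjSpace k K (Sym2 ι))) B) ≤
      vanishingIdeal k (polyMap (formPoly K ι) '' conormalChart a (conormalVectors U)) := by
    intro g hg
    rintro _ ⟨y, hy, rfl⟩
    by_contra hgy
    have hform : ∀ (y : ι ⊕ Sym2 ι → K) (g : MvPolynomial (Sym2 ι) k),
        aeval (polyMap (formPoly K ι) y) g = aeval y (aeval (formPoly k ι) g) := by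
      intro y g
      rw [← aeval_polyMap]
      obtain ⟨v, η, rfl⟩ := exists_elim_eq y
      rw [polyMap_formPoly, polyMap_formPoly]
    have hfs : aeval c.form (f * X s) ≠ 0 := by
      rw [map_mul, aeval_X]
      exact mul_ne_zero hfc hs
    rw [hform] at hgy
    obtain ⟨x, hx, hx₁, hx₂⟩ := (zirred_iff.mp hY.base).2 _ _ (hex _ hfs) ⟨y, hy, hgy⟩
    obtain ⟨u, η, rfl⟩ := exists_elim_eq x
    rw [← aeval_polyMap, polyMap_formPoly] at hx₁ hx₂
    rw [map_mul, aeval_X] at hx₁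
    have hη : η ≠ 0 := fun h0 => hx₁ (by rw [h0, Pi.zero_apply, mul_zero])
    obtain ⟨-, hηu, huT⟩ := mem_conormalChart.mp hx
    have hu := conormalVectors_subset (k := k) huT
    let b : CotangentCoord K (Sym2 ι) :=
      ⟨veronese u, η, veronese_ne_zero (hT.vec_ne_zero hu), hηu⟩
    have hbZ : Incidence.ofCoord k b hη ∈ Z :=
      (ofCoord_mem_projectivization_iff hT.toIsConicalSet b hη).mpr ⟨u, rfl, hη, hηu, hu⟩
    refine left_ne_zero_of_mul hx₁ (hf _ ⟨⟨η, hη⟩, ⟨⟨_, hbZ, rfl⟩, fun hB => ?_⟩, rfl⟩)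
    exact hx₂ ((hq.mem_closure_iff (a := ⟨η, hη⟩)).mp hB g hg)
  -- so the pairs would dominate the dual variety, which contradicts the dimension counts
  obtain ⟨S, hSE, hS, hSI⟩ := exists_zirred_subset_image_dense (k := k) (conormalQuadricPairs T T)
    (polyMap (pairFormPoly K ι)) _ (hP := hYk) ((vanishingIdeal_anti_mono hBE).trans hle)
  have h1 := zdim_pairFormPoly_add_two_le hT hS hSE
  have h2 := card_le_zdim_formPoly_conormalChart hU hY.nonempty
  have h3 := zdim_anti ((hS.image (pairFormPoly K ι)).base (k := k)) hYk hSI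
  rw [zdim_base (hS.image _), zdim_base (hY.image _)] at h3
  omega

end Radicial

end

end VeroneseQuadric

theorem proposition4p7 (k K : Type*) [Field k] [Field K] [Algebra k K] [IsAlgClosure k K]
    (n : ℕ) :
    (∀ C₁ C₂ : Set (VeroneseQuadric.Cotangent k K (Fin (n + 1))),
      IsClosed C₁ → IsIrreducible C₁ → VeroneseQuadric.IsConical C₁ →
      topologicalKrullDim C₁ = (n : WithBot ℕ∞) →
      IsClosed C₂ → IsIrreducible C₂ → VeroneseQuadric.IsConical C₂ →
      topologicalKrullDim C₂ = (n : WithBot ℕ∞) →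
      (¬ ∃ W : Submodule K (Fin (n + 1) → K), 2 ≤ Module.finrank K W ∧
        C₁ = VeroneseQuadric.conormalClosure k W ∧ C₂ = VeroneseQuadric.conormalClosure k W) →
      VeroneseQuadric.IntersectWell
        (VeroneseQuadric.projectivization (VeroneseQuadric.veronesePush C₁))
        (VeroneseQuadric.projectivization (VeroneseQuadric.veronesePush C₂))) ∧
    (∀ W : Submodule K (Fin (n + 1) → K), 2 ≤ Module.finrank K W →
      VeroneseQuadric.GenericallyRadicial
        (VeroneseQuadric.projectivization
          (VeroneseQuadric.veronesePush (VeroneseQuadric.conormalClosure k W)))) := by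
  have : IsAlgClosed K := IsAlgClosure.isAlgClosed k
  have : Algebra.IsAlgebraic k K := IsAlgClosure.isAlgebraic
  exact ⟨fun C₁ C₂ hC₁ hirr₁ hcon₁ hdim₁ hC₂ hirr₂ hcon₂ hdim₂ hexc =>
    VeroneseQuadric.intersectWell_of_not_exists (Fintype.card_fin _) hC₁ hirr₁ hcon₁ hdim₁ hC₂ hirr₂
      hcon₂ hdim₂ hexc, fun W hW => VeroneseQuadric.genericallyRadicial_conormalClosure hW⟩
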